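/- **Setting.** Let $p\ge 1$, let $\Omega\subset\mathbb R^2$ be a compact domain with piecewise smooth boundary $\partial\Omega=\Gamma^D\cup\Gamma^N$ and outward unit normal $\bm n$, let $\lambda$ be a symmetric positive definite $2\times2$ tensor on $\Omega$, $\lambda\in C^{2p+1}(\Omega)$, and let $U,\psi\in C^{2p+2}(\Omega)$ satisfy $-\nabla\cdot(\lambda\nabla U)=F$ and $-\nabla\cdot(\lambda\nabla\psi)=G$ in $\Omega$, $\psi=\psi_D$ on $\Gamma^D$, $\bm n\cdot(\lambda\nabla\psi)=\psi_N$ on $\Gamma^N$ (the boundary data of $U$ are its own values on $\Gamma^D$ and $\bm n\cdot(\lambda\nabla U)$ on $\Gamma^N$). Put $$I(U)=\int_\Omega G\,U\,d\Omega-\int_{\Gamma^D}\psi_D\,(\lambda\nabla U)\cdot\bm n\,d\Gamma+\int_{\Gamma^N}\psi_N\,U\,d\Gamma .$$ **Reference operator.** On the triangle $\hat\Omega$ with vertices $(-1,-1),(1,-1),(-1,1)$ fix a degree-$p$ diagonal-norm SBP operator: volume nodes in $\hat\Omega$; a positive diagonal matrix $\hat H$; for each facet $\gamma$ of $\hat\Omega$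 a matrix $R_\gamma$ extrapolating from the volume nodes to the facet nodes, exact on polynomials of degree $p$; facet nodes and positive weights given by one symmetric quadrature rule of degree at least $2p$, the weights (with respect to arc length) forming the diagonal matrix $\hat B_\gamma$; and matrices $\hat D_d=\hat H^{-1}\hat Q_d$, $d\in\{\xi,\eta\}$, exact on polynomials of degree $p$, with $\hat Q_d=\hat S_d+\tfrac12\hat E_d$, $\hat S_d^T=-\hat S_d$, $\hat E_d=\sum_\gamma \hat n_{\gamma d}\,R_\gamma^T\hat B_\gamma R_\gamma$. **Meshes.** Consider a sequence of conforming meshes, each exactly tessellating $\Omega$ (boundary facets filling $\Gamma^D$ and $\Gamma^N$) by elements $\Omega_k=\mathcal M_k(\hat\Omega)$, where $\mathcal M_k$ is a polynomial mapping of degree at most $p+1$, injective on $\hat\Omega$, with Jacobian determinant $J_k>0$ there. Let $h_k$ be the largest distance between two volume nodes of $\Omega_k$ and $h=\max_k h_k\to0$. The family is shape regular: with constants $c>0$ and $C$ independent of the mesh, on $\hat\Omega$, $J_k\ge c\,h_k^2$ and all derivatives of $\mathcal M_k$ of each order $j\ge1$ are at most $C h_k^j$. With exact metric terms, let $H_k=\mathrm{diag}(J_k)\hat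 H$, let $B_\gamma$ be $\hat B_\gamma$ times the arc-length Jacobian of the mapped facet, let $N_{x\gamma k},N_{y\gamma k}$ be the diagonal matrices of the components of the outward unit normal of $\Omega_k$ at the facet nodes, and let $$D_{xk}=H_k^{-1}\big(S_{xk}+\tfrac12E_{xk}\big),\quad E_{xk}=\sum_{\gamma}R_\gamma^TB_\gamma N_{x\gamma k}R_\gamma,\quad S_{xk}=\tfrac12\big(y_\eta\hat Q_\xi-\hat Q_\xi^Ty_\eta\big)+\tfrac12\big(-y_\xi\hat Q_\eta+\hat Q_\eta^Ty_\xi\big),$$ where $y_\eta,y_\xi$ (and below $x_\eta,x_\xi$) denote diagonal matrices of values at the volume nodes; $D_{yk}$ is defined in the same way with $N_{y\gamma k}$ and with $-x_\eta,\,x_\xi$ in place of $y_\eta,\,-y_\xi$. With the block matrix $\Lambda_k$ of nodal values of $\lambda$, put $$D^{(2)}_k=[D_{xk}\ D_{yk}]\,\Lambda_k\begin{bmatrix}D_{xk}\\D_{yk}\end{bmatrix},\qquad D_{\gamma k}=[N_{x\gamma k}R_\gamma\ \ N_{y\gamma k}R_\gamma]\,\Lambda_k\begin{bmatrix}D_{xk}\\D_{yk}\end{bmatrix}.$$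 Write $R_{\gamma k}$ for $R_\gamma$ acting on the nodal vector of $\Omega_k$; on a facet shared by two elements, vectors and matrices are written in a common numbering of the facet nodes. **Discretization.** Let $f_k,g_k$ be the nodal values of $F,G$, and on a facet $\gamma$ let $u_{\gamma k},\psi_{\gamma k},w_{\gamma k},z_{\gamma k}$ be the facet-node values of $U,\ \psi,\ \bm n\cdot(\lambda\nabla U),\ \bm n\cdot(\lambda\nabla\psi)$. The discrete problem is $L_{h,k}(u_h)=f_k$ for all $k$, with $$L_{h,k}(u_h)=-D_k^{(2)}u_{h,k}+H_k^{-1}\big(s^I_k(u_h)+s^B_k(u_h)\big),$$ $$s^B_k=\sum_{\gamma\subset\Gamma_k\cap\Gamma^D}\big(R_{\gamma k}^TT^{(D)}_\gamma-D_{\gamma k}^TB_\gamma\big)(R_{\gamma k}u_{h,k}-u_{\gamma k})+\sum_{\gamma\subset\Gamma_k\cap\Gamma^N}R_{\gamma k}^TB_\gamma(D_{\gamma k}u_{h,k}-w_{\gamma k}),$$ $$\begin{aligned}s^I_k=\sum_{\gamma\subset\Gamma^I_k}\Big\{&R_{\gamma k}^T\big(T^{(1)}_{\gamma k}j_{\gamma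 k}+T^{(3)}_{\gamma k}d_\gamma\big)+D_{\gamma k}^T\big(T^{(2)}_{\gamma k}j_{\gamma k}+T^{(4)}_{\gamma k}d_\gamma\big)\\&+\sum_{\epsilon\subset\Gamma^I_k,\ \epsilon\ne\gamma}R_{\gamma k}^TT^{(5)}_{\gamma\epsilon k}\,j_{\epsilon k}+\sum_{\delta\subset\Gamma_v^I,\ \delta\neq\gamma}R_{\gamma k}^TT^{(6)}_{\gamma\delta v}\,j_{\delta v}\Big\},\end{aligned}$$ where $\Gamma_k$ and $\Gamma_k^I$ are the sets of all facets and of the interior facets of $\Omega_k$, $\Omega_v$ is the neighbour of $\Omega_k$ across $\gamma$, $j_{\gamma k}=R_{\gamma k}u_{h,k}-R_{\gamma v}u_{h,v}$ is the difference between an element's own extrapolation and that of its neighbour across the facet (so $j_{\epsilon k}$, $j_{\delta v}$ are those of $\Omega_k$ on $\epsilon$ and of $\Omega_v$ on $\delta$), and $d_\gamma=D_{\gamma k}u_{h,k}+D_{\gamma v}u_{h,v}$. The terms with $T^{(5)},T^{(6)}$ are the wide-stencil ones. The discrete adjoint problem is $L^*_{h,k}(\psi_h)=g_k$ for all $k$,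 where $L^*_{h,k}$ is the discrete adjoint operator, i.e. $L^*_{h,k}(\psi_h)=-D^{(2)}_k\psi_{h,k}+H_k^{-1}\big((s_k^I)^*+(s_k^B)^*\big)$, with $(s_k^B)^*$ given by the formula for $s_k^B$ with $\psi_h,\psi_{\gamma k},z_{\gamma k}$ in place of $u_h,u_{\gamma k},w_{\gamma k}$, and $$\begin{aligned}(s_k^I)^*=\sum_{\gamma\subset\Gamma_k^I}\Big\{&R_{\gamma k}^T\big[T^{(1)}_{\gamma k}R_{\gamma k}\psi_{h,k}-T^{(1)}_{\gamma v}R_{\gamma v}\psi_{h,v}+(T^{(2)}_{\gamma k}+B_\gamma)D_{\gamma k}\psi_{h,k}-T^{(2)}_{\gamma v}D_{\gamma v}\psi_{h,v}\big]\\&+D_{\gamma k}^T\big[(T^{(3)}_{\gamma k}-B_\gamma)R_{\gamma k}\psi_{h,k}+T^{(3)}_{\gamma v}R_{\gamma v}\psi_{h,v}+T^{(4)}_{\gamma k}D_{\gamma k}\psi_{h,k}+T^{(4)}_{\gamma v}D_{\gamma v}\psi_{h,v}\big]\\&+\sum_{\epsilon\subset\Gamma_k^I,\ \epsilon\ne\gamma}R_{\gamma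 k}^T\big[T^{(5)}_{\gamma\epsilon k}R_{\epsilon k}\psi_{h,k}+T^{(6)}_{\gamma\epsilon k}R_{\epsilon g}\psi_{h,g}\big]-\sum_{\delta\subset\Gamma_v^I,\ \delta\ne\gamma}R_{\gamma k}^T\big[T^{(5)}_{\gamma\delta v}R_{\delta v}\psi_{h,v}+T^{(6)}_{\gamma\delta v}R_{\delta q}\psi_{h,q}\big]\Big\},\end{aligned}$$ $\Omega_g$ being the neighbour of $\Omega_k$ across $\epsilon$ and $\Omega_q$ that of $\Omega_v$ across $\delta$. The modified discrete functional is $$I_h(u_h)=\sum_k g_k^TH_ku_{h,k}-\sum_{\gamma\subset\Gamma^D}\psi_{\gamma k}^TB_\gamma D_{\gamma k}u_{h,k}+\sum_{\gamma\subset\Gamma^N}z_{\gamma k}^TB_\gamma R_{\gamma k}u_{h,k}+\sum_{\gamma\subset\Gamma^D}\psi_{\gamma k}^TT^{(D)}_\gamma(R_{\gamma k}u_{h,k}-u_{\gamma k}).$$ **Assumptions on the coefficients.** $T^{(1)},T^{(2)},T^{(3)},T^{(4)},T^{(D)}$ are symmetric, $T^{(5)}_{abk}=(T^{(5)}_{bak})^T$,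 $T^{(6)}_{abk}=(T^{(6)}_{bak})^T$. The scheme is adjoint consistent in the sense of the coefficient relations: on each facet $\gamma$ shared by $\Omega_k,\Omega_v$, $$T^{(1)}_{\gamma k}=T^{(1)}_{\gamma v},\quad T^{(2)}_{\gamma k}+T^{(2)}_{\gamma v}=-B_\gamma,\quad T^{(3)}_{\gamma k}+T^{(3)}_{\gamma v}=B_\gamma,\quad T^{(4)}_{\gamma k}=T^{(4)}_{\gamma v},\quad T^{(5)}_{abk}=-T^{(6)}_{abk}.$$ The coefficients have the scaling that keeps the primal and adjoint truncation errors of order $h^{p-1}$: uniformly over the family, the entries of $T^{(1)},T^{(5)},T^{(6)},T^{(D)}$ are $O(1)$, those of $T^{(2)},T^{(3)}$ are $O(h_k)$ and those of $T^{(4)}$ are $O(h_k^2)$. **Assumption on the discrete solutions.** Both discrete problems have unique solutions $u_h,\psi_h$, and $\max_k\|u_{h,k}-u_k\|_\infty=O(h^{p+1})$, $\max_k\|\psi_{h,k}-\psi_k\|_\infty=O(h^{p+1})$, where $u_k,\psi_k$ are the nodal values of $U,\psi$. **Conclusion.** As $h\to0$, $$I(U)-I_h(u_h)=O(h^{2p}).$$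 -/

import Mathlib

open MeasureTheory Filter Topology Asymptotics Matrix

namespace SBPSAT

/-! ### The plane, the reference triangle and its facets -/

/-- The Euclidean plane. -/
abbrev Pt : Type := EuclideanSpace ℝ (Fin 2)

/-- The closed reference triangle with vertices `(-1,-1)`, `(1,-1)`, `(-1,1)`. -/
def refTriangle : Set Pt := {ξ | -1 ≤ ξ 0 ∧ -1 ≤ ξ 1 ∧ ξ 0 + ξ 1 ≤ 0}

/-- The three vertices of the reference triangle. -/
def refVertices : Set Pt := {!₂[-1, -1], !₂[1, -1], !₂[-1, 1]}

/-- Counterclockwise affine parametrization, over `s ∈ [-1,1]`, of the three facets: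
the hypotenuse from `(1,-1)` to `(-1,1)`, the left edge from `(-1,1)` to `(-1,-1)`, the lower edge
from `(-1,-1)` to `(1,-1)`. -/
noncomputable def facetParam (f : Fin 3) (s : ℝ) : Pt :=
  (![!₂[-s, s], !₂[-1, -s], !₂[s, -1]] : Fin 3 → Pt) f

/-- Outward unit normals of the three reference facets. -/
noncomputable def refNormal : Fin 3 → Fin 2 → ℝ :=
  ![![1 / √2, 1 / √2], ![-1, 0], ![0, -1]]

/-- Unit tangents of the three reference facets, in the direction of `facetParam`. -/
noncomputable def refTangent : Fin 3 → Fin 2 → ℝ :=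
  ![![-1 / √2, 1 / √2], ![0, -1], ![1, 0]]

/-- Half of the length of each reference facet (the speed of `facetParam`). -/
noncomputable def refHalfLength : Fin 3 → ℝ := ![√2, 1, 1]

/-- Value of a bivariate polynomial at a point of the plane. -/
noncomputable def polyEval (q : MvPolynomial (Fin 2) ℝ) (ξ : Pt) : ℝ :=
  MvPolynomial.eval (fun i => ξ i) q

/-! ### Diagonal-norm SBP operators on the reference triangle -/

/-- The raw data of a diagonal-norm multidimensional SBP operator on the reference triangle, with
`np` volume nodes and `nf` quadrature nodes on each facet. -/
structure RefOperator (np nf : ℕ) where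
  /-- the volume nodes -/
  node : Fin np → Pt
  /-- the diagonal of the norm matrix -/
  H : Fin np → ℝ
  /-- the matrices `S` in the two coordinate directions -/
  S : Fin 2 → Matrix (Fin np) (Fin np) ℝ
  /-- the volume-to-facet extrapolation matrix of each facet -/
  R : Fin 3 → Matrix (Fin nf) (Fin np) ℝ
  /-- the nodes of the facet quadrature rule, on `[-1,1]` -/
  facetNode : Fin nf → ℝ
  /-- the weights of the facet quadrature rule, on `[-1,1]` -/
  facetWeight : Fin nf → ℝ

namespace RefOperator

variable {np nf : ℕ} (op : RefOperator np nf)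

/-- Position of the `i`-th node of facet `f` in the reference triangle. -/
noncomputable def facetPt (f : Fin 3) (i : Fin nf) : Pt := facetParam f (op.facetNode i)

/-- Diagonal of the facet weight matrix on the reference facet `f` (arc-length quadrature). -/
noncomputable def Bhat (f : Fin 3) (i : Fin nf) : ℝ := refHalfLength f * op.facetWeight i

/-- The surface integral matrix in direction `d`: the sum over the facets of `Rᵀ B̂ N̂ R`. -/
noncomputable def E (d : Fin 2) : Matrix (Fin np) (Fin np) ℝ :=
  ∑ f : Fin 3, (op.R f)ᵀ * diagonal (fun i => op.Bhat f i * refNormal f d) * op.R f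

/-- `Q = S + E / 2`. -/
noncomputable def Q (d : Fin 2) : Matrix (Fin np) (Fin np) ℝ := op.S d + (1 / 2 : ℝ) • op.E d

/-- The derivative operator `D = H⁻¹ Q` in direction `d`. -/
noncomputable def D (d : Fin 2) : Matrix (Fin np) (Fin np) ℝ :=
  diagonal (fun i => (op.H i)⁻¹) * op.Q d

/-- `op` is a degree `p` diagonal-norm SBP operator on the reference triangle: the derivative
matrices are exact on polynomials of degree `p`, the norm matrix is positive, `S` is
skew-symmetric, the facet weights are positive and form a (symmetric) quadrature rule of degree at
least `2p`, and the extrapolation matrices are exact on polynomials of degree `p`. -/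
structure IsSBP (p : ℕ) : Prop where
  node_mem : ∀ i, op.node i ∈ refTriangle
  H_pos : ∀ i, 0 < op.H i
  S_skew : ∀ d, (op.S d)ᵀ = -op.S d
  D_exact : ∀ (d : Fin 2) (q : MvPolynomial (Fin 2) ℝ), q.totalDegree ≤ p →
    (op.D d) *ᵥ (fun j => polyEval q (op.node j)) =
      fun i => polyEval (MvPolynomial.pderiv d q) (op.node i)
  R_exact : ∀ (f : Fin 3) (q : MvPolynomial (Fin 2) ℝ), q.totalDegree ≤ p →
    (op.R f) *ᵥ (fun j => polyEval q (op.node j)) = fun i => polyEval q (op.facetPt f i)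
  facetNode_mem : ∀ i, op.facetNode i ∈ Set.Icc (-1 : ℝ) 1
  facetNode_rev : ∀ i, op.facetNode i.rev = -op.facetNode i
  facetWeight_pos : ∀ i, 0 < op.facetWeight i
  facetWeight_rev : ∀ i, op.facetWeight i.rev = op.facetWeight i
  facet_exact : ∀ q : Polynomial ℝ, q.natDegree ≤ 2 * p →
    ∑ i, op.facetWeight i * q.eval (op.facetNode i) = ∫ s in (-1 : ℝ)..1, q.eval s

end RefOperator

/-! ### Polynomial mappings and the mapped operators -/

/-- A polynomial mapping of the plane, given by its two component polynomials. -/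
abbrev PolyMap : Type := Fin 2 → MvPolynomial (Fin 2) ℝ

namespace PolyMap

variable (M : PolyMap)

/-- The mapping as a function. -/
noncomputable def toFun (ξ : Pt) : Pt := !₂[polyEval (M 0) ξ, polyEval (M 1) ξ]

/-- The exact grid metric `∂ x_a / ∂ ξ_b`. -/
noncomputable def metric (a b : Fin 2) (ξ : Pt) : ℝ := polyEval (MvPolynomial.pderiv b (M a)) ξ

/-- The determinant of the mapping Jacobian. -/
noncomputable def jac (ξ : Pt) : ℝ :=
  M.metric 0 0 ξ * M.metric 1 1 ξ - M.metric 0 1 ξ * M.metric 1 0 ξ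

/-- The entries `|J| ∂ ξ_b / ∂ x_d` of the transposed cofactor matrix. -/
noncomputable def cof (d b : Fin 2) (ξ : Pt) : ℝ :=
  (!![M.metric 1 1 ξ, -M.metric 1 0 ξ; -M.metric 0 1 ξ, M.metric 0 0 ξ] :
    Matrix (Fin 2) (Fin 2) ℝ) d b

/-- The facet Jacobian `|∂ (x,y) / ∂ s|` on facet `f`, with `s` the reference arc length. -/
noncomputable def facetJac (f : Fin 3) (ξ : Pt) : ℝ :=
  √(∑ a : Fin 2, (∑ b : Fin 2, M.metric a b ξ * refTangent f b) ^ 2)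

/-- Component `d` of the outward unit normal of the physical element at the image of the point `ξ`
of the reference facet `f`. -/
noncomputable def normal (f : Fin 3) (d : Fin 2) (ξ : Pt) : ℝ :=
  (∑ b : Fin 2, M.cof d b ξ * refNormal f b) / M.facetJac f ξ

variable {np nf : ℕ} (op : RefOperator np nf)

/-- Physical volume node. -/
noncomputable def pnode (i : Fin np) : Pt := M.toFun (op.node i)

/-- Physical facet node. -/
noncomputable def pfacet (f : Fin 3) (i : Fin nf) : Pt := M.toFun (op.facetPt f i)

/-- Diagonal of the physical norm matrix `H_k = J_k Ĥ`. -/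
noncomputable def H (i : Fin np) : ℝ := M.jac (op.node i) * op.H i

/-- The physical facet weight matrix `B_γ = J_f B̂`. -/
noncomputable def B (f : Fin 3) : Matrix (Fin nf) (Fin nf) ℝ :=
  diagonal fun i => M.facetJac f (op.facetPt f i) * op.Bhat f i

/-- The diagonal normal matrix on facet `f`, component `d`. -/
noncomputable def N (f : Fin 3) (d : Fin 2) : Matrix (Fin nf) (Fin nf) ℝ :=
  diagonal fun i => M.normal f d (op.facetPt f i)

/-- The physical surface integral matrix in direction `d`. -/
noncomputable def E (d : Fin 2) : Matrix (Fin np) (Fin np) ℝ :=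
  ∑ f : Fin 3, (op.R f)ᵀ * M.B op f * M.N op f d * op.R f

/-- The diagonal matrix of a cofactor entry at the volume nodes. -/
noncomputable def cofDiag (d b : Fin 2) : Matrix (Fin np) (Fin np) ℝ :=
  diagonal fun i => M.cof d b (op.node i)

/-- The physical skew-symmetric matrix in direction `d`. -/
noncomputable def S (d : Fin 2) : Matrix (Fin np) (Fin np) ℝ :=
  (1 / 2 : ℝ) • ∑ b : Fin 2, (M.cofDiag op d b * op.Q b - (op.Q b)ᵀ * M.cofDiag op d b)

/-- The physical derivative operator `D = H⁻¹ (S + E / 2)` in direction `d`. -/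
noncomputable def D (d : Fin 2) : Matrix (Fin np) (Fin np) ℝ :=
  diagonal (fun i => (M.H op i)⁻¹) * (M.S op d + (1 / 2 : ℝ) • M.E op d)

variable (lam : Pt → Matrix (Fin 2) (Fin 2) ℝ)

/-- The diagonal block `(a,b)` of the diffusivity at the volume nodes. -/
noncomputable def Lam (a b : Fin 2) : Matrix (Fin np) (Fin np) ℝ :=
  diagonal fun i => lam (M.pnode op i) a b

/-- The second derivative operator approximating `∇·(λ∇)`. -/
noncomputable def D2 : Matrix (Fin np) (Fin np) ℝ :=
  ∑ a : Fin 2, ∑ b : Fin 2, M.D op a * M.Lam op lam a b * M.D op b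

/-- The normal derivative operator approximating `n·(λ∇)` on facet `f`. -/
noncomputable def Dn (f : Fin 3) : Matrix (Fin nf) (Fin np) ℝ :=
  ∑ a : Fin 2, ∑ b : Fin 2, M.N op f a * op.R f * M.Lam op lam a b * M.D op b

/-- Diameter of the element, measured on its volume nodes. -/
noncomputable def diam : ℝ := ⨆ i : Fin np, ⨆ j : Fin np, dist (M.pnode op i) (M.pnode op j)

end PolyMap

/-! ### Differential operators and the continuous problem -/

/-- Partial derivative of `u` in direction `i`, for a function on the domain `Ω`. -/
noncomputable def pd (Ω : Set Pt) (u : Pt → ℝ) (i : Fin 2) (x : Pt) : ℝ :=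
  fderivWithin ℝ u Ω x (EuclideanSpace.single i 1)

/-- Component `a` of the flux `λ∇u`. -/
noncomputable def flux (Ω : Set Pt) (lam : Pt → Matrix (Fin 2) (Fin 2) ℝ) (u : Pt → ℝ)
    (a : Fin 2) (x : Pt) : ℝ :=
  ∑ b : Fin 2, lam x a b * pd Ω u b x

/-- The diffusion operator `L(u) = -∇·(λ∇u)`; it is its own adjoint operator. -/
noncomputable def diffusion (Ω : Set Pt) (lam : Pt → Matrix (Fin 2) (Fin 2) ℝ) (u : Pt → ℝ)
    (x : Pt) : ℝ :=
  -∑ a : Fin 2, pd Ω (flux Ω lam u a) a x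

/-- The conormal derivative `(λ∇u)·n` in direction `n`. -/
noncomputable def normalFlux (Ω : Set Pt) (lam : Pt → Matrix (Fin 2) (Fin 2) ℝ) (u : Pt → ℝ)
    (n x : Pt) : ℝ :=
  ∑ a : Fin 2, flux Ω lam u a x * n a

/-- `n` is the outward unit normal of `Ω` at the (smooth) boundary point `x`: rays from `x` start
inside `Ω` or outside `Ω` according to the sign of their inner product with `n`. -/
def IsOutwardUnitNormal (Ω : Set Pt) (x n : Pt) : Prop :=
  ‖n‖ = 1 ∧ ∀ v : Pt,
    (inner ℝ v n < 0 → ∀ᶠ t in 𝓝[>] (0 : ℝ), x + t • v ∈ Ω) ∧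
    (0 < inner ℝ v n → ∀ᶠ t in 𝓝[>] (0 : ℝ), x + t • v ∉ Ω)

/-- The linear functional
`I(U) = ∫_Ω G U - ∫_{ΓD} ψD (λ∇U)·n + ∫_{ΓN} ψN U`, boundary integrals being taken with respect to
arc length (one-dimensional Hausdorff measure). -/
noncomputable def functional (Ω ΓD ΓN : Set Pt) (n : Pt → Pt)
    (lam : Pt → Matrix (Fin 2) (Fin 2) ℝ) (G ψD ψN U : Pt → ℝ) : ℝ :=
  (∫ x in Ω, G x * U x) - (∫ x in ΓD, ψD x * normalFlux Ω lam U (n x) x ∂μH[1])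
    + ∫ x in ΓN, ψN x * U x ∂μH[1]

/-! ### Meshes of curved triangles -/

/-- What lies on the other side of a facet: facet `f` of element `v`, or one of the two parts of
the boundary. -/
inductive FacetKind (ne : ℕ) : Type
  | interior (v : Fin ne) (f : Fin 3) : FacetKind ne
  | dirichlet : FacetKind ne
  | neumann : FacetKind ne

/-- A conforming mesh of `ne` curved triangles, each the image of the reference triangle under a
polynomial mapping of degree at most `p + 1` that is injective on it with positive Jacobian. -/
structure Mesh (p : ℕ) where
  /-- number of elements -/
  ne : ℕ
  /-- the mapping of each element -/
  map : Fin ne → PolyMap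
  /-- the kind of each facet of each element -/
  kind : Fin ne → Fin 3 → FacetKind ne
  degree_le : ∀ k a, (map k a).totalDegree ≤ p + 1
  injOn : ∀ k, Set.InjOn (map k).toFun refTriangle
  jac_pos : ∀ k, ∀ ξ ∈ refTriangle, 0 < (map k).jac ξ
  kind_symm : ∀ k f v f', kind k f = .interior v f' → kind v f' = .interior k f
  /-- the two sides of an interior facet match, with opposite orientations -/
  facet_match : ∀ k f v f', kind k f = .interior v f' → ∀ s ∈ Set.Icc (-1 : ℝ) 1,
    (map k).toFun (facetParam f s) = (map v).toFun (facetParam f' (-s))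
  /-- distinct elements meet only in common vertices and common interior facets -/
  conforming : ∀ k v, k ≠ v → ∀ ξ ∈ refTriangle, ∀ η ∈ refTriangle,
    (map k).toFun ξ = (map v).toFun η →
      (ξ ∈ refVertices ∧ η ∈ refVertices) ∨
      ∃ f f' s, kind k f = .interior v f' ∧ s ∈ Set.Icc (-1 : ℝ) 1 ∧
        ξ = facetParam f s ∧ η = facetParam f' (-s)

namespace Mesh

variable {p : ℕ} (m : Mesh p)

/-- Facet `f` of element `k`, as a set of points. -/
def facetSet (k : Fin m.ne) (f : Fin 3) : Set Pt :=
  (fun s => (m.map k).toFun (facetParam f s)) '' Set.Icc (-1 : ℝ) 1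

/-- The elements of the mesh fill `Ω`, and its boundary facets of the two kinds fill the Dirichlet
and the Neumann parts of the boundary. -/
structure IsTessellation (Ω ΓD ΓN : Set Pt) : Prop where
  volume_eq : ⋃ k, (m.map k).toFun '' refTriangle = Ω
  dirichlet_eq : ⋃ k, ⋃ f, ⋃ _ : m.kind k f = .dirichlet, m.facetSet k f = ΓD
  neumann_eq : ⋃ k, ⋃ f, ⋃ _ : m.kind k f = .neumann, m.facetSet k f = ΓN

variable {np nf : ℕ} (op : RefOperator np nf)

/-- The mesh size: the largest element diameter. -/
noncomputable def h : ℝ := ⨆ k, (m.map k).diam op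

/-- A grid function: one value at each volume node of each element. -/
abbrev GridFun (np : ℕ) : Type := Fin m.ne → Fin np → ℝ

/-- Restriction of a function to the volume nodes. -/
noncomputable def restrict (u : Pt → ℝ) : m.GridFun np := fun k i => u ((m.map k).pnode op i)

/-- Restriction of a function to the nodes of facet `f` of element `k`. -/
noncomputable def facetRestrict (u : Pt → ℝ) (k : Fin m.ne) (f : Fin 3) : Fin nf → ℝ :=
  fun i => u ((m.map k).pfacet op f i)

/-- Restriction of `n·(λ∇u)`, with `n` the outward normal of element `k`, to the nodes of its
facet `f`. -/
noncomputable def fluxRestrict (Ω : Set Pt) (lam : Pt → Matrix (Fin 2) (Fin 2) ℝ) (u : Pt → ℝ)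
    (k : Fin m.ne) (f : Fin 3) : Fin nf → ℝ :=
  fun i => normalFlux Ω lam u !₂[(m.map k).normal f 0 (op.facetPt f i),
    (m.map k).normal f 1 (op.facetPt f i)] ((m.map k).pfacet op f i)

/-- A family of meshes is shape regular: the derivatives of order `j` of the mapping of an element
of diameter `h_k` are `O(h_k ^ j)`, and its Jacobian determinant is at least of order `h_k ^ 2`. -/
def ShapeRegular (mesh : ℕ → Mesh p) : Prop :=
  ∃ c C : ℝ, 0 < c ∧ ∀ (n : ℕ) (k : Fin (mesh n).ne), ∀ ξ ∈ refTriangle,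
    c * ((mesh n).map k).diam op ^ 2 ≤ ((mesh n).map k).jac ξ ∧
    ∀ j : ℕ, 1 ≤ j →
      ‖iteratedFDeriv ℝ j ((mesh n).map k).toFun ξ‖ ≤ C * ((mesh n).map k).diam op ^ j

end Mesh

/-! ### Simultaneous approximation terms

The nodes of a facet are numbered by each of the two adjacent elements along its own orientation,
so a vector on the facet passes from one numbering to the other by reversal of the indices. -/

/-- A facet vector in the numbering of the element on the other side. -/
def flip {nf : ℕ} (w : Fin nf → ℝ) : Fin nf → ℝ := fun i => w i.rev

/-- A facet matrix in the numbering of the element on the other side. -/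
def flipMat {nf : ℕ} (A : Matrix (Fin nf) (Fin nf) ℝ) : Matrix (Fin nf) (Fin nf) ℝ :=
  A.submatrix Fin.rev Fin.rev

/-- The SAT coefficient matrices. For facets `a`, `b` of element `k`, `T1 k a`, ..., `T4 k a` are
the coefficients of the compact interior facet SATs, `T5 k a b` and `T6 k a b` (with `a ≠ b`) those
of the wide-stencil SATs, and `TD k a` that of the Dirichlet SAT; entries that belong to facets of
another kind are never used. -/
structure SATCoeffs (ne nf : ℕ) where
  T1 : Fin ne → Fin 3 → Matrix (Fin nf) (Fin nf) ℝ
  T2 : Fin ne → Fin 3 → Matrix (Fin nf) (Fin nf) ℝ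
  T3 : Fin ne → Fin 3 → Matrix (Fin nf) (Fin nf) ℝ
  T4 : Fin ne → Fin 3 → Matrix (Fin nf) (Fin nf) ℝ
  T5 : Fin ne → Fin 3 → Fin 3 → Matrix (Fin nf) (Fin nf) ℝ
  T6 : Fin ne → Fin 3 → Fin 3 → Matrix (Fin nf) (Fin nf) ℝ
  TD : Fin ne → Fin 3 → Matrix (Fin nf) (Fin nf) ℝ

namespace SATCoeffs

/-- The symmetry assumption on the coefficient matrices. -/
structure IsSymmetric {ne nf : ℕ} (T : SATCoeffs ne nf) : Prop where
  T1_symm : ∀ k a, (T.T1 k a).IsSymm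
  T2_symm : ∀ k a, (T.T2 k a).IsSymm
  T3_symm : ∀ k a, (T.T3 k a).IsSymm
  T4_symm : ∀ k a, (T.T4 k a).IsSymm
  TD_symm : ∀ k a, (T.TD k a).IsSymm
  T5_symm : ∀ k a b, T.T5 k a b = (T.T5 k b a)ᵀ
  T6_symm : ∀ k a b, T.T6 k a b = (T.T6 k b a)ᵀ

/-- The relations between the coefficients that make the discretization (which is always
consistent) adjoint consistent. -/
structure IsAdjointConsistent {p np nf : ℕ} (op : RefOperator np nf) (m : Mesh p)
    (T : SATCoeffs m.ne nf) : Prop where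
  T1_eq : ∀ k a v b, m.kind k a = .interior v b → T.T1 k a = flipMat (T.T1 v b)
  T2_add : ∀ k a v b, m.kind k a = .interior v b →
    T.T2 k a + flipMat (T.T2 v b) = -(m.map k).B op a
  T3_add : ∀ k a v b, m.kind k a = .interior v b →
    T.T3 k a + flipMat (T.T3 v b) = (m.map k).B op a
  T4_eq : ∀ k a v b, m.kind k a = .interior v b → T.T4 k a = flipMat (T.T4 v b)
  T5_eq : ∀ k a b, T.T5 k a b = -T.T6 k a b

/-- The coefficients of a family of discretizations are scaled so that every SAT is of the order of
the truncation error: with `h_k` the diameter of the element, the entries of `T1`, `T5`, `T6`, `TD`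
are `O(1)`, those of `T2` and `T3` are `O(h_k)` like the facet weights, those of `T4` are
`O(h_k ^ 2)`. -/
def IsScaled {p np nf : ℕ} (op : RefOperator np nf) (mesh : ℕ → Mesh p)
    (T : ∀ n, SATCoeffs (mesh n).ne nf) : Prop :=
  ∃ C : ℝ, ∀ (n : ℕ) (k : Fin (mesh n).ne) (a : Fin 3) (i j : Fin nf),
    |(T n).T1 k a i j| ≤ C ∧
    |(T n).T2 k a i j| ≤ C * ((mesh n).map k).diam op ∧
    |(T n).T3 k a i j| ≤ C * ((mesh n).map k).diam op ∧
    |(T n).T4 k a i j| ≤ C * ((mesh n).map k).diam op ^ 2 ∧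
    (∀ b, |(T n).T5 k a b i j| ≤ C ∧ |(T n).T6 k a b i j| ≤ C) ∧
    |(T n).TD k a i j| ≤ C

end SATCoeffs

/-! ### The discrete primal and adjoint problems and the discrete functional -/

section Discretization

variable {p np nf : ℕ} (op : RefOperator np nf) (Ω : Set Pt)
  (lam : Pt → Matrix (Fin 2) (Fin 2) ℝ) (m : Mesh p) (T : SATCoeffs m.ne nf)

/-- Extrapolation of a grid function to facet `f` of element `k`, from the inside. -/
noncomputable def tr (v : m.GridFun np) (k : Fin m.ne) (f : Fin 3) : Fin nf → ℝ :=
  op.R f *ᵥ v k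

/-- Discrete outward conormal derivative on facet `f` of element `k`. -/
noncomputable def dn (v : m.GridFun np) (k : Fin m.ne) (f : Fin 3) : Fin nf → ℝ :=
  (m.map k).Dn op lam f *ᵥ v k

/-- Difference of the extrapolations from the two sides of an interior facet (zero on boundary
facets). -/
noncomputable def jump (v : m.GridFun np) (k : Fin m.ne) (f : Fin 3) : Fin nf → ℝ :=
  match m.kind k f with
  | .interior g f' => tr op m v k f - flip (tr op m v g f')
  | _ => 0

/-- The interior facet SAT of element `k`. -/
noncomputable def satI (v : m.GridFun np) (k : Fin m.ne) : Fin np → ℝ :=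
  ∑ f : Fin 3, match m.kind k f with
    | .interior g f' =>
        (op.R f)ᵀ *ᵥ (T.T1 k f *ᵥ jump op m v k f
          + T.T3 k f *ᵥ (dn op lam m v k f + flip (dn op lam m v g f')))
        + ((m.map k).Dn op lam f)ᵀ *ᵥ (T.T2 k f *ᵥ jump op m v k f
          + T.T4 k f *ᵥ (dn op lam m v k f + flip (dn op lam m v g f')))
        + (∑ e ∈ Finset.univ.erase f, (op.R f)ᵀ *ᵥ (T.T5 k f e *ᵥ jump op m v k e))
        + ∑ d ∈ Finset.univ.erase f', (op.R f)ᵀ *ᵥ flip (T.T6 g f' d *ᵥ jump op m v g d)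
    | _ => 0

/-- The boundary SAT of element `k`, for the boundary data given by the function `U`. -/
noncomputable def satB (U : Pt → ℝ) (v : m.GridFun np) (k : Fin m.ne) : Fin np → ℝ :=
  ∑ f : Fin 3, match m.kind k f with
    | .interior _ _ => 0
    | .dirichlet =>
        (op.R f)ᵀ *ᵥ (T.TD k f *ᵥ (tr op m v k f - m.facetRestrict op U k f))
        - ((m.map k).Dn op lam f)ᵀ *ᵥ
          ((m.map k).B op f *ᵥ (tr op m v k f - m.facetRestrict op U k f))
    | .neumann =>
        (op.R f)ᵀ *ᵥ
          ((m.map k).B op f *ᵥ (dn op lam m v k f - m.fluxRestrict op Ω lam U k f))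

/-- The discrete primal operator `L_{h,k}`. -/
noncomputable def primalOp (U : Pt → ℝ) (v : m.GridFun np) (k : Fin m.ne) : Fin np → ℝ :=
  -((m.map k).D2 op lam *ᵥ v k)
    + diagonal (fun i => ((m.map k).H op i)⁻¹) *ᵥ
        (satI op lam m T v k + satB op Ω lam m T U v k)

/-- Evaluation of the wide-stencil adjoint coefficients of a pair of facets `f`, `e` of element
`k`. -/
noncomputable def wideAdjoint (v : m.GridFun np) (k : Fin m.ne) (f e : Fin 3) : Fin nf → ℝ :=
  match m.kind k e with
  | .interior g e' => T.T5 k f e *ᵥ tr op m v k e + T.T6 k f e *ᵥ flip (tr op m v g e')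
  | _ => 0

/-- The adjoint interior facet SAT of element `k`. -/
noncomputable def adjSatI (v : m.GridFun np) (k : Fin m.ne) : Fin np → ℝ :=
  ∑ f : Fin 3, match m.kind k f with
    | .interior g f' =>
        (op.R f)ᵀ *ᵥ (T.T1 k f *ᵥ tr op m v k f - flip (T.T1 g f' *ᵥ tr op m v g f')
          + (T.T2 k f + (m.map k).B op f) *ᵥ dn op lam m v k f
          - flip (T.T2 g f' *ᵥ dn op lam m v g f'))
        + ((m.map k).Dn op lam f)ᵀ *ᵥ ((T.T3 k f - (m.map k).B op f) *ᵥ tr op m v k f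
          + flip (T.T3 g f' *ᵥ tr op m v g f')
          + T.T4 k f *ᵥ dn op lam m v k f + flip (T.T4 g f' *ᵥ dn op lam m v g f'))
        + (∑ e ∈ Finset.univ.erase f, (op.R f)ᵀ *ᵥ wideAdjoint op m T v k f e)
        - ∑ d ∈ Finset.univ.erase f', (op.R f)ᵀ *ᵥ flip (wideAdjoint op m T v g f' d)
    | _ => 0

/-- The discrete adjoint operator `L*_{h,k}`; the adjoint boundary SAT has the form of the primal
one, with the data of the adjoint problem. -/
noncomputable def adjointOp (ψ : Pt → ℝ) (v : m.GridFun np) (k : Fin m.ne) : Fin np → ℝ :=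
  -((m.map k).D2 op lam *ᵥ v k)
    + diagonal (fun i => ((m.map k).H op i)⁻¹) *ᵥ
        (adjSatI op lam m T v k + satB op Ω lam m T ψ v k)

/-- `v` is the unique solution of the discrete primal problem with source `F` and boundary data
`U`. -/
def IsUniquePrimalSolution (F U : Pt → ℝ) (v : m.GridFun np) : Prop :=
  ∀ w : m.GridFun np, primalOp op Ω lam m T U w = m.restrict op F ↔ w = v

/-- `v` is the unique solution of the discrete adjoint problem with source `G` and boundary data
`ψ`. -/
def IsUniqueAdjointSolution (G ψ : Pt → ℝ) (v : m.GridFun np) : Prop :=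
  ∀ w : m.GridFun np, adjointOp op Ω lam m T ψ w = m.restrict op G ↔ w = v

/-- The modified discrete functional `I_h`. -/
noncomputable def discreteFunctional (G ψ U : Pt → ℝ) (v : m.GridFun np) : ℝ :=
  ∑ k : Fin m.ne, ((∑ i, m.restrict op G k i * (m.map k).H op i * v k i)
    + ∑ f : Fin 3, match m.kind k f with
        | .interior _ _ => 0
        | .dirichlet =>
            -(m.facetRestrict op ψ k f ⬝ᵥ ((m.map k).B op f *ᵥ dn op lam m v k f))
            + m.facetRestrict op ψ k f ⬝ᵥ
                (T.TD k f *ᵥ (tr op m v k f - m.facetRestrict op U k f))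
        | .neumann =>
            m.fluxRestrict op Ω lam ψ k f ⬝ᵥ ((m.map k).B op f *ᵥ tr op m v k f))

end Discretization

end SBPSAT

open SBPSAT

/-! Duality reduces the functional error to three small quantities. Let (v, w) be the inner product
of the norm matrices. Summation by parts and the coefficient relations turn the primal and the
adjoint scheme into one bilinear form a: (v, L_h w) = a(v, w) - l_U(v) and (L*_h v, w) = a(v, w) -
l_ψ(w), where l_U and l_ψ carry the boundary data (`primalOp_test`, `adjointOp_test`). Since I_h(v)
is (v, G) + l_ψ(v) up to a constant, testing with the discrete solutions and with the restrictions
of U and ψ gives (`discreteFunctional_identity`) I_h(u_h) = (U, G) + c(ψ, U) - (ψ_h - ψ, L_h U - F),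
where c contains exact functions only. The last product is a truncation error of order h^(p-1) times
an adjoint error of order h^(p+1). It remains to compare (U, G) + c(ψ, U) with I(U), that is, to
bound a quadrature error and a consistency defect.

The defect must have order 2p although the derivative operators are accurate only to order p; this
is superconvergence. Exactness on degree p together with summation by parts makes the volume and
facet quadratures satisfy the divergence theorem on degree 2p (`RefOperator.IsSBP.div_exact`). Hence
a derivative error tested with a smooth function equals a facet extrapolation term up to the doubled
order (`RefOperator.IsSBP.Q_superconvergence`). The skew-symmetric mapped operator averages the
advective and the conservative form, which agree by the metric identities, so the property passes to
curved elements (`ElemFamily.D_superconvergence`) and to the energy (Dψ)ᵀHΛDU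
(`ElemFamily.energy_approx`). On the facets, `consistency_identity` shows that all terms linear in
an error cancel; there remain the element energy defects and products of two errors, jumps or flux
sums, which have the doubled order by the scaling of the coefficients.

All local estimates live on the reference triangle. A pulled back smooth function gains one power of
h_k with each derivative (`Scaled`), so Taylor polynomials convert exactness degrees into powers of
h_k, uniformly over all elements of all meshes. The local errors entering the quadrature and the
defect have order h_k^(2p+2); the sum of h_k^2 is bounded by a multiple of the area of Ω
(`Mesh.IsTessellation.sum_sq_le`), so summation costs two powers.

The comparison with the continuous functional also needs one-dimensional Hausdorff measure to be arc
length on the facets (`integral_image_hausdorffMeasure`), the normal of Ω to be that of the adjacent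
element (`PolyMap.eq_normal_of_isOutwardUnitNormal`), and the volume rule to have degree 2p-1, which
follows from the SBP property (`RefOperator.IsSBP.volume_polyEval`). -/

namespace SBPSAT

/-! ### Symmetry of iterated derivatives -/

/-- Adjacent transpositions generate the symmetric group. Exchanging the last two arguments is the
symmetry of the second derivative, differentiated further; any earlier exchange leaves the last
argument alone and is the induction hypothesis for `fderiv ℝ f`, which is why `F` is quantified
inside the induction. -/
theorem iteratedFDeriv_comp_perm_of_contDiffAt {E : Type} [NormedAddCommGroup E]
    [NormedSpace ℝ E] (n : ℕ) : ∀ {F : Type} [NormedAddCommGroup F] [NormedSpace ℝ F] {f : E → F}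
      {x : E}, ContDiffAt ℝ n f x → ∀ (v : Fin n → E) (σ : Equiv.Perm (Fin n)),
        iteratedFDeriv ℝ n f x (v ∘ σ) = iteratedFDeriv ℝ n f x v := by
  induction n with
  | zero =>
    intro F _ _ f x hf v σ
    rw [Subsingleton.elim (v ∘ σ) v]
  | succ n ih =>
    intro F _ _ f x hf v σ
    have key : ∀ (i : Fin n) (v : Fin (n + 1) → E),
        iteratedFDeriv ℝ (n + 1) f x (v ∘ Equiv.swap i.castSucc i.succ)
          = iteratedFDeriv ℝ (n + 1) f x v := by
      intro i v
      obtain _ | k := n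
      · exact i.elim0
      refine Fin.lastCases ?_ (fun j => ?_) i
      · have hx2 : ContDiffAt ℝ (k : ℕ) (fderiv ℝ (fderiv ℝ f)) x := by
          have h1 : ContDiffAt ℝ ((k + 1 : ℕ)) (fderiv ℝ f) x := by
            apply hf.fderiv_right; norm_cast
          apply h1.fderiv_right; norm_cast
        -- The symmetry is needed on a neighbourhood of `x`, not only at `x`, because the identity
        -- is differentiated `k` times.
        have hev : fderiv ℝ (fderiv ℝ f) =ᶠ[𝓝 x]
            (ContinuousLinearMap.flipₗᵢ ℝ E E F).toContinuousLinearEquiv.toContinuousLinearMap ∘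
              fderiv ℝ (fderiv ℝ f) := by
          have h2 : ∀ᶠ y in 𝓝 x, ContDiffAt ℝ ((k + 1 + 1 : ℕ)) f y :=
            hf.eventually (by simp)
          filter_upwards [h2] with y hy
          have hs := hy.isSymmSndFDerivAt (by
            simp only [minSmoothness_of_isRCLikeNormedField]; norm_cast; omega)
          ext a b
          exact hs a b
        have h3 := hev.iteratedFDeriv ℝ k |>.eq_of_nhds
        rw [ContinuousLinearMap.iteratedFDeriv_comp_left _ hx2 le_rfl] at h3
        simp only [Fin.succ_last]
        have e1 : ∀ w : Fin (k + 1 + 1) → E,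
            iteratedFDeriv ℝ (k + 1 + 1) f x w
            = iteratedFDeriv ℝ k (fderiv ℝ (fderiv ℝ f)) x (Fin.init (Fin.init w))
                (w (Fin.last k).castSucc) (w (Fin.last (k + 1))) := by
          intro w
          rw [iteratedFDeriv_succ_apply_right, iteratedFDeriv_succ_apply_right]
          rfl
        rw [e1, e1]
        have e2 : Fin.init (Fin.init (v ∘ Equiv.swap (Fin.last k).castSucc (Fin.last (k + 1))))
            = Fin.init (Fin.init v) := by
          funext j
          simp only [Fin.init, Function.comp]
          rw [Equiv.swap_apply_of_ne_of_ne]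
          · exact fun h => by simp [Fin.ext_iff, j.2.ne] at h
          · exact fun h => by
              have := Fin.ext_iff.1 h
              have := j.2
              simp at *
        rw [e2]
        simp only [Function.comp, Equiv.swap_apply_left, Equiv.swap_apply_right]
        conv_lhs => rw [h3]
        rfl
      · have e0 : ∀ w : Fin (k + 1 + 1) → E, iteratedFDeriv ℝ (k + 1 + 1) f x w
            = iteratedFDeriv ℝ (k + 1) (fderiv ℝ f) x (Fin.init w) (w (Fin.last (k + 1))) :=
          fun w => iteratedFDeriv_succ_apply_right w
        rw [e0, e0]
        have h1 : ContDiffAt ℝ ((k + 1 : ℕ)) (fderiv ℝ f) x := by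
          apply hf.fderiv_right; norm_cast
        have e1 : Fin.init (v ∘ Equiv.swap j.castSucc.castSucc j.castSucc.succ)
            = Fin.init v ∘ Equiv.swap j.castSucc j.succ := by
          funext l
          simp only [Fin.init, Function.comp]
          apply congrArg v
          rw [show j.castSucc.succ = j.succ.castSucc from rfl]
          exact (Fin.castSucc_injective (k + 1)).swap_apply j.castSucc j.succ l
        have e2 : (v ∘ Equiv.swap j.castSucc.castSucc j.castSucc.succ) (Fin.last (k + 1))
            = v (Fin.last (k + 1)) := by
          simp only [Function.comp]
          rw [Equiv.swap_apply_of_ne_of_ne]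
          · exact fun h => by
              have := Fin.ext_iff.1 h
              have := j.2
              simp at *; omega
          · exact fun h => by
              have := Fin.ext_iff.1 h
              have := j.2
              simp at *; omega
        rw [e1, e2]
        exact congrArg (fun A : E →L[ℝ] F => A (v (Fin.last (k + 1))))
          (ih h1 (Fin.init v) (Equiv.swap j.castSucc j.succ))
    have hσ : σ ∈ Submonoid.closure (Set.range fun i : Fin n => Equiv.swap i.castSucc i.succ) := by
      rw [Equiv.Perm.mclosure_swap_castSucc_succ]; trivial
    induction hσ using Submonoid.closure_induction generalizing v with
    | mem y hy => obtain ⟨i, rfl⟩ := hy; exact key i v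
    | one => rfl
    | mul a b _ _ ha hb =>
      rw [show v ∘ (a * b : Equiv.Perm (Fin (n + 1))) = (v ∘ a) ∘ b from rfl, hb, ha]

/-! ### Polynomials as functions on the plane -/

@[simp] theorem polyEval_add (q r : MvPolynomial (Fin 2) ℝ) (ξ : Pt) :
    polyEval (q + r) ξ = polyEval q ξ + polyEval r ξ := by simp [polyEval]

@[simp] theorem polyEval_mul (q r : MvPolynomial (Fin 2) ℝ) (ξ : Pt) :
    polyEval (q * r) ξ = polyEval q ξ * polyEval r ξ := by simp [polyEval]

@[simp] theorem polyEval_zero (ξ : Pt) : polyEval 0 ξ = 0 := by simp [polyEval]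

@[simp] theorem polyEval_C (a : ℝ) (ξ : Pt) : polyEval (MvPolynomial.C a) ξ = a := by
  simp [polyEval]

@[simp] theorem polyEval_X (i : Fin 2) (ξ : Pt) : polyEval (MvPolynomial.X i) ξ = ξ i := by
  simp [polyEval]

theorem contDiff_polyEval (q : MvPolynomial (Fin 2) ℝ) {n : WithTop ℕ∞} :
    ContDiff ℝ n (polyEval q) := by
  induction q using MvPolynomial.induction_on with
  | C a =>
    rw [show polyEval (MvPolynomial.C a) = fun _ => a from funext fun ξ => polyEval_C a ξ]
    exact contDiff_const
  | add q r hq hr =>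
    rw [show polyEval (q + r) = fun ξ => polyEval q ξ + polyEval r ξ from
      funext fun ξ => polyEval_add q r ξ]
    exact hq.add hr
  | mul_X q i hq =>
    rw [show polyEval (q * MvPolynomial.X i) = fun ξ => polyEval q ξ * ξ i from
      funext fun ξ => by simp]
    exact hq.mul (by fun_prop)

theorem hasFDerivAt_polyEval (q : MvPolynomial (Fin 2) ℝ) (ξ : Pt) :
    HasFDerivAt (polyEval q)
      (∑ b, polyEval (MvPolynomial.pderiv b q) ξ • EuclideanSpace.proj (𝕜 := ℝ) b) ξ := by
  induction q using MvPolynomial.induction_on with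
  | C a =>
    rw [show polyEval (MvPolynomial.C a) = fun _ => a from funext fun ξ => polyEval_C a ξ]
    convert hasFDerivAt_const a ξ using 1
    simp [polyEval]
  | add q r hq hr =>
    rw [show polyEval (q + r) = fun ξ => polyEval q ξ + polyEval r ξ from
      funext fun ξ => polyEval_add q r ξ]
    refine (hq.add hr).congr_fderiv ?_
    simp only [map_add, polyEval_add, add_smul, Finset.sum_add_distrib]
  | mul_X q i hq =>
    rw [show polyEval (q * MvPolynomial.X i) = fun ξ => polyEval q ξ * ξ i from
      funext fun ξ => by simp]
    have h2 : HasFDerivAt (fun ξ : Pt => ξ i) (EuclideanSpace.proj (𝕜 := ℝ) i : Pt →L[ℝ] ℝ) ξ :=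
      (EuclideanSpace.proj (𝕜 := ℝ) i : Pt →L[ℝ] ℝ).hasFDerivAt
    refine (hq.mul h2).congr_fderiv ?_
    ext v
    fin_cases i <;> simp [Fin.sum_univ_two, MvPolynomial.pderiv_X, Pi.single_apply] <;> ring

theorem fderiv_polyEval_single (q : MvPolynomial (Fin 2) ℝ) (ξ : Pt) (b : Fin 2) :
    fderiv ℝ (polyEval q) ξ (EuclideanSpace.single b 1) = polyEval (MvPolynomial.pderiv b q) ξ := by
  rw [(hasFDerivAt_polyEval q ξ).fderiv]
  fin_cases b <;> simp

/-! ### The reference triangle -/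

/-- An interior point of the reference triangle. -/
noncomputable def refCenter : Pt := !₂[-1 / 2, -1 / 2]

theorem convex_refTriangle : Convex ℝ refTriangle := by
  intro x hx y hy a b ha hb hab
  simp only [refTriangle, Set.mem_ofPred_eq, PiLp.add_apply, PiLp.smul_apply, smul_eq_mul] at *
  refine ⟨?_, ?_, ?_⟩ <;> nlinarith [hx.1, hx.2.1, hx.2.2, hy.1, hy.2.1, hy.2.2]

theorem isClosed_refTriangle : IsClosed refTriangle := by
  have h0 : Continuous fun ξ : Pt => ξ 0 := by fun_prop
  have h1 : Continuous fun ξ : Pt => ξ 1 := by fun_prop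
  exact (isClosed_le continuous_const h0).inter
    ((isClosed_le continuous_const h1).inter (isClosed_le (h0.add h1) continuous_const))

/-- The diameter is `2 * √2`; the integer 4 is a convenient bound for it. -/
theorem norm_sub_le_of_mem_refTriangle {ξ η : Pt} (hξ : ξ ∈ refTriangle) (hη : η ∈ refTriangle) :
    ‖ξ - η‖ ≤ 4 := by
  rw [EuclideanSpace.norm_eq, Real.sqrt_le_left (by norm_num)]
  simp only [refTriangle, Set.mem_ofPred_eq] at hξ hη
  simp only [Fin.sum_univ_two, PiLp.sub_apply, Real.norm_eq_abs, sq_abs]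
  have a1 : |ξ 0 - η 0| ≤ 2 := abs_le.2 ⟨by linarith, by linarith⟩
  have a2 : |ξ 1 - η 1| ≤ 2 := abs_le.2 ⟨by linarith, by linarith⟩
  have b1 := sq_le_sq' (abs_le.1 a1).1 (abs_le.1 a1).2
  have b2 := sq_le_sq' (abs_le.1 a2).1 (abs_le.1 a2).2
  linarith

theorem isCompact_refTriangle : IsCompact refTriangle := by
  refine Metric.isCompact_of_isClosed_isBounded isClosed_refTriangle ?_
  refine Metric.isBounded_iff.2 ⟨4, fun x hx y hy => ?_⟩
  rw [dist_eq_norm]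
  exact norm_sub_le_of_mem_refTriangle hx hy

theorem refCenter_mem_interior : refCenter ∈ interior refTriangle := by
  rw [mem_interior_iff_mem_nhds]
  have h0 : Continuous fun ξ : Pt => ξ 0 := by fun_prop
  have h1 : Continuous fun ξ : Pt => ξ 1 := by fun_prop
  have a : ∀ᶠ ξ in 𝓝 refCenter, (-1 : ℝ) < ξ 0 :=
    h0.continuousAt.eventually (lt_mem_nhds (by simp [refCenter]; norm_num))
  have b : ∀ᶠ ξ in 𝓝 refCenter, (-1 : ℝ) < ξ 1 :=
    h1.continuousAt.eventually (lt_mem_nhds (by simp [refCenter]; norm_num))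
  have c : ∀ᶠ ξ in 𝓝 refCenter, ξ 0 + ξ 1 < (0 : ℝ) :=
    (h0.add h1).continuousAt.eventually (gt_mem_nhds (by simp [refCenter]))
  filter_upwards [a, b, c] with ξ ha hb hc
  exact ⟨ha.le, hb.le, hc.le⟩

theorem refCenter_mem : refCenter ∈ refTriangle := interior_subset refCenter_mem_interior

theorem uniqueDiffOn_refTriangle : UniqueDiffOn ℝ refTriangle :=
  uniqueDiffOn_convex convex_refTriangle ⟨_, refCenter_mem_interior⟩

/-! ### Degrees and derivatives of polynomials -/

theorem totalDegree_pderiv_le (q : MvPolynomial (Fin 2) ℝ) (b : Fin 2) :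
    (MvPolynomial.pderiv b q).totalDegree ≤ q.totalDegree - 1 := by
  conv_lhs => rw [q.as_sum, map_sum]
  refine (MvPolynomial.totalDegree_finsetSum _ _).trans (Finset.sup_le fun s hs => ?_)
  rw [MvPolynomial.pderiv_monomial]
  by_cases h0 : s b = 0
  · simp [h0]
  refine (MvPolynomial.totalDegree_monomial_le _ _).trans ?_
  have h1 := MvPolynomial.le_totalDegree hs
  have h2 : (s - Finsupp.single b 1).degree + 1 = s.degree := by
    have h3 : s - Finsupp.single b 1 + Finsupp.single b 1 = s :=
      tsub_add_cancel_of_le (by rw [Finsupp.single_le_iff]; omega)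
    conv_rhs => rw [← h3]
    simp
  have h4 : s.degree = s.sum fun _ e => e := rfl
  have h5 : (s - Finsupp.single b 1).degree = (s - Finsupp.single b 1).sum fun _ => id := rfl
  omega

theorem iteratedFDeriv_polyEval_eq_zero (m : ℕ) : ∀ (q : MvPolynomial (Fin 2) ℝ),
    q.totalDegree ≤ m → ∀ ξ, ‖iteratedFDeriv ℝ (m + 1) (polyEval q) ξ‖ = 0 := by
  have hf : ∀ q : MvPolynomial (Fin 2) ℝ, fderiv ℝ (polyEval q) = fun ξ =>
      ∑ b, polyEval (MvPolynomial.pderiv b q) ξ • (EuclideanSpace.proj (𝕜 := ℝ) b : Pt →L[ℝ] ℝ) :=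
    fun q => funext fun ξ => (hasFDerivAt_polyEval q ξ).fderiv
  induction m with
  | zero =>
    intro q hq ξ
    rw [MvPolynomial.totalDegree_eq_zero_iff_eq_C.1 (Nat.le_zero.1 hq), ← norm_iteratedFDeriv_fderiv,
      hf]
    simp
  | succ m ih =>
    intro q hq ξ
    rw [← norm_iteratedFDeriv_fderiv, hf, norm_eq_zero]
    have hc : ∀ b : Fin 2, ContDiff ℝ (m + 1 : ℕ) fun ξ : Pt =>
        polyEval (MvPolynomial.pderiv b q) ξ • (EuclideanSpace.proj (𝕜 := ℝ) b : Pt →L[ℝ] ℝ) :=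
      fun b => (contDiff_polyEval _).smul contDiff_const
    rw [iteratedFDeriv_sum (fun b _ => hc b), Finset.sum_apply]
    refine Finset.sum_eq_zero fun b _ => ?_
    have h1 : (fun ξ : Pt =>
        polyEval (MvPolynomial.pderiv b q) ξ • (EuclideanSpace.proj (𝕜 := ℝ) b : Pt →L[ℝ] ℝ))
        = (ContinuousLinearMap.smulRight (1 : ℝ →L[ℝ] ℝ)
          (EuclideanSpace.proj (𝕜 := ℝ) b : Pt →L[ℝ] ℝ)) ∘ polyEval (MvPolynomial.pderiv b q) := by
      funext ξ; simp
    rw [h1, ContinuousLinearMap.iteratedFDeriv_comp_left _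
      (contDiff_polyEval _ (n := (m + 1 : ℕ))).contDiffAt le_rfl,
      norm_eq_zero.1 (ih _ (by have := totalDegree_pderiv_le q b; omega) ξ)]
    ext; simp

/-! ### Taylor polynomials -/

/-- Expanding `ξ - x` in the standard basis turns the value into a sum of products of `n` affine
coordinate functions. -/
theorem exists_polyEval_eq_multilinear (n : ℕ) (A : ContinuousMultilinearMap ℝ (fun _ : Fin n => Pt) ℝ)
    (x : Pt) : ∃ q : MvPolynomial (Fin 2) ℝ, q.totalDegree ≤ n ∧
      ∀ ξ, polyEval q ξ = A fun _ => ξ - x := by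
  refine ⟨∑ s : Fin n → Fin 2, MvPolynomial.C (A fun l => EuclideanSpace.single (s l) 1) *
    ∏ l, (MvPolynomial.X (s l) - MvPolynomial.C (x (s l))), ?_, fun ξ => ?_⟩
  · refine (MvPolynomial.totalDegree_finsetSum _ _).trans (Finset.sup_le fun s _ => ?_)
    refine (MvPolynomial.totalDegree_mul _ _).trans ?_
    rw [MvPolynomial.totalDegree_C, zero_add]
    refine (MvPolynomial.totalDegree_finsetProd _ _).trans ?_
    refine (Finset.sum_le_card_nsmul _ _ 1 fun l _ => ?_).trans (by simp)
    refine (MvPolynomial.totalDegree_sub_C_le _ _).trans ?_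
    simp
  · have h1 : ξ - x = ∑ b : Fin 2, (ξ b - x b) • (EuclideanSpace.single b (1 : ℝ) : Pt) := by
      ext i; fin_cases i <;> simp
    have h2 : (A fun _ => ξ - x) = ∑ s : Fin n → Fin 2,
        A fun l => (ξ (s l) - x (s l)) • (EuclideanSpace.single (s l) (1 : ℝ) : Pt) := by
      conv_lhs => rw [h1]
      exact A.map_sum _
    rw [h2]
    simp only [polyEval, map_sum, map_mul, map_prod, map_sub, MvPolynomial.eval_C,
      MvPolynomial.eval_X]
    refine Finset.sum_congr rfl fun s _ => ?_
    rw [A.map_smul_univ]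
    simp [mul_comm]

/-- The Taylor sum has the finite power series `A`, so its derivative of order `j` at the centre is
the sum of `A j` over all permutations of the arguments. By symmetry of derivatives the `j!`
summands are equal, which cancels the factor `1 / j!`. -/
theorem exists_taylor_polynomial (m : ℕ) {f : Pt → ℝ} {x : Pt} (hf : ContDiffAt ℝ m f x) :
    ∃ q : MvPolynomial (Fin 2) ℝ, q.totalDegree ≤ m ∧
      ∀ j ≤ m, iteratedFDeriv ℝ j (polyEval q) x = iteratedFDeriv ℝ j f x := by
  let A : FormalMultilinearSeries ℝ Pt ℝ := fun i =>
    if i ≤ m then ((i.factorial : ℝ)⁻¹) • iteratedFDeriv ℝ i f x else 0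
  choose Q hQd hQ using fun i => exists_polyEval_eq_multilinear i (A i) x
  refine ⟨∑ i ∈ Finset.range (m + 1), Q i, ?_, fun j hj => ?_⟩
  · refine (MvPolynomial.totalDegree_finsetSum _ _).trans (Finset.sup_le fun i hi => ?_)
    have := Finset.mem_range.1 hi
    exact (hQd i).trans (by omega)
  · have hp : HasFiniteFPowerSeriesOnBall (polyEval (∑ i ∈ Finset.range (m + 1), Q i)) A x (m + 1)
        ⊤ := by
      refine HasFiniteFPowerSeriesOnBall.mk' (fun i hi => ?_) (by simp) fun y _ => ?_
      · simp only [A]; rw [if_neg (by omega)]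
      · have h1 : polyEval (∑ i ∈ Finset.range (m + 1), Q i) (x + y)
            = ∑ i ∈ Finset.range (m + 1), polyEval (Q i) (x + y) := by simp [polyEval]
        rw [h1]
        refine Finset.sum_congr rfl fun i _ => ?_
        rw [hQ]; simp
    ext v
    rw [hp.toHasFPowerSeriesOnBall.iteratedFDeriv_eq_sum
      (by rw [analyticOn_univ]; exact fun y _ => (contDiff_polyEval _).contDiffAt.analyticAt)]
    have h2 : ∀ σ : Equiv.Perm (Fin j), (A j fun i => v (σ i))
        = (j.factorial : ℝ)⁻¹ * iteratedFDeriv ℝ j f x v := by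
      intro σ
      simp only [A, if_pos hj, _root_.smul_apply, smul_eq_mul]
      congr 1
      exact iteratedFDeriv_comp_perm_of_contDiffAt j (hf.of_le (by exact_mod_cast hj)) v σ
    rw [Finset.sum_congr rfl fun σ _ => h2 σ]
    simp only [Finset.sum_const, Finset.card_univ, Fintype.card_perm, Fintype.card_fin,
      nsmul_eq_mul]
    field_simp

/-- Polynomial approximation on the reference triangle, with derivatives. -/
theorem exists_polynomial_approx (m : ℕ) {f : Pt → ℝ} {B : ℝ}
    (hf : ContDiffOn ℝ (m + 1 : ℕ) f refTriangle)
    (hB : ∀ ξ ∈ refTriangle, ‖iteratedFDerivWithin ℝ (m + 1) f refTriangle ξ‖ ≤ B) :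
    ∃ q : MvPolynomial (Fin 2) ℝ, q.totalDegree ≤ m ∧ ∀ j ≤ m + 1, ∀ ξ ∈ refTriangle,
      ‖iteratedFDerivWithin ℝ j (fun η => f η - polyEval q η) refTriangle ξ‖
        ≤ B * 4 ^ (m + 1 - j) := by
  have hnhds : refTriangle ∈ 𝓝 refCenter := mem_interior_iff_mem_nhds.1 refCenter_mem_interior
  have hfa : ContDiffAt ℝ (m + 1 : ℕ) f refCenter := hf.contDiffAt hnhds
  obtain ⟨q, hq, hj⟩ := exists_taylor_polynomial m (hfa.of_le (by norm_cast; omega))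
  refine ⟨q, hq, ?_⟩
  set r : Pt → ℝ := fun η => f η - polyEval q η with hr
  have hrc : ContDiffOn ℝ (m + 1 : ℕ) r refTriangle := hf.sub (contDiff_polyEval q).contDiffOn
  have hsub : ∀ j ≤ m + 1, ∀ ξ ∈ refTriangle, iteratedFDerivWithin ℝ j r refTriangle ξ
      = iteratedFDerivWithin ℝ j f refTriangle ξ - iteratedFDeriv ℝ j (polyEval q) ξ := by
    intro j hj ξ hξ
    rw [← iteratedFDerivWithin_eq_iteratedFDeriv uniqueDiffOn_refTriangle
      (contDiff_polyEval q (n := (m + 1 : ℕ)) |>.contDiffAt.of_le (by exact_mod_cast hj)) hξ]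
    exact fun_iteratedFDerivWithin_sub_apply ((hf ξ hξ).of_le (by exact_mod_cast hj))
      ((contDiff_polyEval q).contDiffWithinAt) uniqueDiffOn_refTriangle hξ
  have hB0 : 0 ≤ B := (norm_nonneg _).trans (hB _ refCenter_mem)
  -- Downward induction on the order of differentiation, starting at `m + 1`, where `q` contributes
  -- nothing. Lower derivatives of the remainder vanish at the centre, so the mean value inequality
  -- on the convex triangle costs one factor 4 at each stage.
  have main : ∀ l ≤ m + 1, ∀ ξ ∈ refTriangle,
      ‖iteratedFDerivWithin ℝ (m + 1 - l) r refTriangle ξ‖ ≤ B * 4 ^ l := by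
    intro l
    induction l with
    | zero =>
      intro _ ξ hξ
      rw [Nat.sub_zero, hsub _ le_rfl ξ hξ,
        norm_eq_zero.1 (iteratedFDeriv_polyEval_eq_zero m q hq ξ), sub_zero, pow_zero, mul_one]
      exact hB ξ hξ
    | succ l ih =>
      intro hl ξ hξ
      have hd : DifferentiableOn ℝ (iteratedFDerivWithin ℝ (m + 1 - (l + 1)) r refTriangle)
          refTriangle :=
        hrc.differentiableOn_iteratedFDerivWithin (by norm_cast; omega) uniqueDiffOn_refTriangle
      have h0 : iteratedFDerivWithin ℝ (m + 1 - (l + 1)) r refTriangle refCenter = 0 := by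
        rw [hsub _ (by omega) _ refCenter_mem, hj _ (by omega),
          iteratedFDerivWithin_eq_iteratedFDeriv uniqueDiffOn_refTriangle
            (hfa.of_le (by norm_cast; omega)) refCenter_mem, sub_self]
      have h1 := Convex.norm_image_sub_le_of_norm_fderivWithin_le (C := B * 4 ^ l) hd
        (fun η hη => by
          rw [norm_fderivWithin_iteratedFDerivWithin,
            show m + 1 - (l + 1) + 1 = m + 1 - l by omega]
          exact ih (by omega) η hη) convex_refTriangle refCenter_mem hξ
      rw [h0, sub_zero] at h1
      refine h1.trans ?_
      rw [pow_succ, ← mul_assoc]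
      exact mul_le_mul_of_nonneg_left (norm_sub_le_of_mem_refTriangle hξ refCenter_mem)
        (by positivity)
  intro j hj ξ hξ
  have := main (m + 1 - j) (by omega) ξ hξ
  rwa [show m + 1 - (m + 1 - j) = j by omega] at this

/-! ### Families of quantities and of functions of a given order in a mesh size -/

section Families

variable {ι : Type*} {h : ι → Set.Ioc (0 : ℝ) 1}

/-- The family `X` is `O(h ^ e)`, uniformly. -/
def BigOh (h : ι → Set.Ioc (0 : ℝ) 1) (e : ℕ) (X : ι → ℝ) : Prop :=
  ∃ C : ℝ, ∀ i, |X i| ≤ C * (h i : ℝ) ^ e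

namespace BigOh

variable {e e₁ e₂ : ℕ} {X Y : ι → ℝ}

theorem exists_nonneg (hX : BigOh h e X) : ∃ C : ℝ, 0 ≤ C ∧ ∀ i, |X i| ≤ C * (h i : ℝ) ^ e := by
  obtain ⟨C, hC⟩ := hX
  refine ⟨|C|, abs_nonneg _, fun i => (hC i).trans ?_⟩
  exact mul_le_mul_of_nonneg_right (le_abs_self C) (pow_nonneg (h i).2.1.le _)

theorem congr (hX : BigOh h e X) (hXY : ∀ i, X i = Y i) : BigOh h e Y := by
  rwa [← funext hXY]

theorem add (hX : BigOh h e X) (hY : BigOh h e Y) : BigOh h e fun i => X i + Y i := by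
  obtain ⟨C, hC⟩ := hX
  obtain ⟨C', hC'⟩ := hY
  exact ⟨C + C', fun i => (abs_add_le _ _).trans (by rw [add_mul]; exact add_le_add (hC i) (hC' i))⟩

theorem neg (hX : BigOh h e X) : BigOh h e fun i => -X i := by
  obtain ⟨C, hC⟩ := hX
  exact ⟨C, fun i => by rw [abs_neg]; exact hC i⟩

theorem sub (hX : BigOh h e X) (hY : BigOh h e Y) : BigOh h e fun i => X i - Y i :=
  (hX.add hY.neg).congr fun _ => (sub_eq_add_neg _ _).symm

theorem mul (hX : BigOh h e₁ X) (hY : BigOh h e₂ Y) : BigOh h (e₁ + e₂) fun i => X i * Y i := by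
  obtain ⟨C, hC0, hC⟩ := hX.exists_nonneg
  obtain ⟨C', hC0', hC'⟩ := hY.exists_nonneg
  refine ⟨C * C', fun i => ?_⟩
  rw [abs_mul, pow_add]
  calc |X i| * |Y i| ≤ (C * (h i : ℝ) ^ e₁) * (C' * (h i : ℝ) ^ e₂) :=
        mul_le_mul (hC i) (hC' i) (abs_nonneg _) (mul_nonneg hC0 (pow_nonneg (h i).2.1.le _))
    _ = _ := by ring

theorem const (c : ℝ) : BigOh h 0 fun _ => c := ⟨|c|, fun i => by simp⟩

theorem const_mul (c : ℝ) (hX : BigOh h e X) : BigOh h e fun i => c * X i := by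
  have := (const (h := h) c).mul hX
  rwa [zero_add] at this

theorem zero : BigOh h e fun _ => 0 := ⟨0, fun i => by simp⟩

theorem sum {α : Type*} {s : Finset α} {X : α → ι → ℝ} (hX : ∀ a ∈ s, BigOh h e (X a)) :
    BigOh h e fun i => ∑ a ∈ s, X a i := by
  classical
  induction s using Finset.induction_on with
  | empty => simpa using zero
  | insert a s ha ih =>
    simp only [Finset.sum_insert ha]
    exact (hX a (Finset.mem_insert_self _ _)).add
      (ih fun b hb => hX b (Finset.mem_insert_of_mem hb))

/-- Sizes are at most 1, so a higher order implies a lower one. -/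
theorem mono (hX : BigOh h e₁ X) (he : e₂ ≤ e₁) : BigOh h e₂ X := by
  obtain ⟨C, hC0, hC⟩ := hX.exists_nonneg
  exact ⟨C, fun i => (hC i).trans (mul_le_mul_of_nonneg_left
    (pow_le_pow_of_le_one (h i).2.1.le (h i).2.2 he) hC0)⟩

theorem comp {κ : Type*} (hX : BigOh h e X) (r : κ → ι) :
    BigOh (fun k => h (r k)) e fun k => X (r k) := by
  obtain ⟨C, hC⟩ := hX
  exact ⟨C, fun k => hC _⟩

/-- Needed to pass from the size of a neighbouring element to that of the element itself. -/
theorem of_le {h' : ι → Set.Ioc (0 : ℝ) 1} (hX : BigOh h e X)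
    (hh : ∃ C : ℝ, ∀ i, (h i : ℝ) ≤ C * h' i) : BigOh h' e X := by
  obtain ⟨C, hC0, hC⟩ := hX.exists_nonneg
  obtain ⟨c, hc⟩ := hh
  refine ⟨C * c ^ e, fun i => (hC i).trans ?_⟩
  rw [mul_assoc, ← mul_pow]
  exact mul_le_mul_of_nonneg_left (pow_le_pow_left₀ (h i).2.1.le (hc i) e) hC0

theorem mulVec {α β : Type*} [Fintype β] {A : ι → Matrix α β ℝ} {x : ι → β → ℝ} {a : α}
    (hA : ∀ b, BigOh h e₁ fun i => A i a b) (hx : ∀ b, BigOh h e₂ fun i => x i b) :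
    BigOh h (e₁ + e₂) fun i => (A i *ᵥ x i) a := by
  simp only [Matrix.mulVec, dotProduct]
  exact sum fun b _ => (hA b).mul (hx b)

theorem const_mulVec {α β : Type*} [Fintype β] (A : Matrix α β ℝ) {x : ι → β → ℝ} (a : α)
    (hx : ∀ b, BigOh h e fun i => x i b) : BigOh h e fun i => (A *ᵥ x i) a := by
  simpa using mulVec (A := fun _ => A) (a := a) (fun b => const _) hx

theorem dotProduct {β : Type*} [Fintype β] {x y : ι → β → ℝ}
    (hx : ∀ b, BigOh h e₁ fun i => x i b) (hy : ∀ b, BigOh h e₂ fun i => y i b) :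
    BigOh h (e₁ + e₂) fun i => x i ⬝ᵥ y i :=
  sum fun b _ => (hx b).mul (hy b)

end BigOh

/-- The functions of the family `φ` are `C^N` on the reference triangle and their derivatives of
each order `j ≤ N` are `O(h ^ (e + j))`, uniformly. -/
structure Scaled (h : ι → Set.Ioc (0 : ℝ) 1) (N e : ℕ) (φ : ι → Pt → ℝ) : Prop where
  contDiffOn : ∀ i, ContDiffOn ℝ N (φ i) refTriangle
  bound : ∃ K : ℝ, ∀ i, ∀ j ≤ N, ∀ ξ ∈ refTriangle,
    ‖iteratedFDerivWithin ℝ j (φ i) refTriangle ξ‖ ≤ K * (h i : ℝ) ^ (e + j)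

namespace Scaled

variable {N N' e e₁ e₂ : ℕ} {φ ψ : ι → Pt → ℝ}

theorem exists_nonneg (hφ : Scaled h N e φ) : ∃ K : ℝ, 0 ≤ K ∧ ∀ i, ∀ j ≤ N, ∀ ξ ∈ refTriangle,
    ‖iteratedFDerivWithin ℝ j (φ i) refTriangle ξ‖ ≤ K * (h i : ℝ) ^ (e + j) := by
  obtain ⟨C, hC⟩ := hφ.bound
  refine ⟨|C|, abs_nonneg _, fun i j hj ξ hξ => (hC i j hj ξ hξ).trans ?_⟩
  exact mul_le_mul_of_nonneg_right (le_abs_self C) (pow_nonneg (h i).2.1.le _)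

theorem congr (hφ : Scaled h N e φ) (hφψ : ∀ i, ∀ ξ ∈ refTriangle, ψ i ξ = φ i ξ) :
    Scaled h N e ψ := by
  refine ⟨fun i => (hφ.contDiffOn i).congr (hφψ i), ?_⟩
  obtain ⟨K, hK⟩ := hφ.bound
  refine ⟨K, fun i j hj ξ hξ => ?_⟩
  rw [iteratedFDerivWithin_congr (hφψ i) hξ]
  exact hK i j hj ξ hξ

theorem of_le (hφ : Scaled h N e φ) (hN : N' ≤ N) : Scaled h N' e φ := by
  refine ⟨fun i => (hφ.contDiffOn i).of_le (by exact_mod_cast hN), ?_⟩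
  obtain ⟨K, hK⟩ := hφ.bound
  exact ⟨K, fun i j hj ξ hξ => hK i j (hj.trans hN) ξ hξ⟩

theorem add (hφ : Scaled h N e φ) (hψ : Scaled h N e ψ) :
    Scaled h N e fun i ξ => φ i ξ + ψ i ξ := by
  refine ⟨fun i => (hφ.contDiffOn i).add (hψ.contDiffOn i), ?_⟩
  obtain ⟨K, hK⟩ := hφ.bound
  obtain ⟨K', hK'⟩ := hψ.bound
  refine ⟨K + K', fun i j hj ξ hξ => ?_⟩
  rw [fun_iteratedFDerivWithin_add_apply
    ((hφ.contDiffOn i ξ hξ).of_le (by exact_mod_cast hj))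
    ((hψ.contDiffOn i ξ hξ).of_le (by exact_mod_cast hj)) uniqueDiffOn_refTriangle hξ, add_mul]
  exact (norm_add_le _ _).trans (add_le_add (hK i j hj ξ hξ) (hK' i j hj ξ hξ))

/-- Leibniz rule: the orders `e₁ + l` and `e₂ + (j - l)` always add up to `e₁ + e₂ + j`, and the
binomial coefficients sum to `2 ^ j`. -/
theorem mul (hφ : Scaled h N e₁ φ) (hψ : Scaled h N e₂ ψ) :
    Scaled h N (e₁ + e₂) fun i ξ => φ i ξ * ψ i ξ := by
  refine ⟨fun i => (hφ.contDiffOn i).mul (hψ.contDiffOn i), ?_⟩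
  obtain ⟨K, hK0, hK⟩ := hφ.exists_nonneg
  obtain ⟨K', hK0', hK'⟩ := hψ.exists_nonneg
  refine ⟨2 ^ N * K * K', fun i j hj ξ hξ => ?_⟩
  refine (norm_iteratedFDerivWithin_mul_le (hφ.contDiffOn i) (hψ.contDiffOn i)
    uniqueDiffOn_refTriangle hξ (by exact_mod_cast hj)).trans ?_
  have hh := (h i).2.1.le
  calc _ ≤ ∑ l ∈ Finset.range (j + 1), (j.choose l : ℝ) *
        (K * K' * (h i : ℝ) ^ (e₁ + e₂ + j)) := by
        refine Finset.sum_le_sum fun l hl => ?_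
        have hl' := Finset.mem_range_succ_iff.1 hl
        rw [mul_assoc]
        refine mul_le_mul_of_nonneg_left ?_ (Nat.cast_nonneg _)
        calc _ ≤ (K * (h i : ℝ) ^ (e₁ + l)) * (K' * (h i : ℝ) ^ (e₂ + (j - l))) :=
              mul_le_mul (hK i l (by omega) ξ hξ) (hK' i (j - l) (by omega) ξ hξ)
                (norm_nonneg _) (by positivity)
          _ = K * K' * (h i : ℝ) ^ ((e₁ + l) + (e₂ + (j - l))) := by rw [pow_add _ (e₁ + l)]; ring
          _ = _ := by congr 2; omega
    _ = 2 ^ j * (K * K' * (h i : ℝ) ^ (e₁ + e₂ + j)) := by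
        rw [← Finset.sum_mul]
        congr 1
        exact_mod_cast Nat.sum_range_choose j
    _ ≤ 2 ^ N * (K * K' * (h i : ℝ) ^ (e₁ + e₂ + j)) :=
        mul_le_mul_of_nonneg_right (pow_le_pow_right₀ (by norm_num) hj) (by positivity)
    _ = _ := by ring

theorem const (c : ℝ) : Scaled h N 0 fun _ _ => c := by
  refine ⟨fun i => contDiffOn_const, |c|, fun i j _ ξ hξ => ?_⟩
  rcases j with _ | j
  · simp
  · rw [iteratedFDerivWithin_const_of_ne (by omega)]
    have := (h i).2.1.le
    simp; positivity

theorem const_mul (c : ℝ) (hφ : Scaled h N e φ) : Scaled h N e fun i ξ => c * φ i ξ := by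
  have := (const (h := h) (N := N) c).mul hφ
  rwa [zero_add] at this

theorem neg (hφ : Scaled h N e φ) : Scaled h N e fun i ξ => -φ i ξ :=
  (hφ.const_mul (-1)).congr fun i ξ _ => by ring

theorem zero : Scaled h N e fun _ _ => 0 :=
  ⟨fun i => contDiffOn_const, 0, fun i j _ ξ hξ => by simp⟩

theorem sum {α : Type*} {s : Finset α} {φ : α → ι → Pt → ℝ} (hφ : ∀ a ∈ s, Scaled h N e (φ a)) :
    Scaled h N e fun i ξ => ∑ a ∈ s, φ a i ξ := by
  classical
  induction s using Finset.induction_on with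
  | empty => simpa using zero
  | insert a s ha ih =>
    simp only [Finset.sum_insert ha]
    exact (hφ a (Finset.mem_insert_self _ _)).add
      (ih fun b hb => hφ b (Finset.mem_insert_of_mem hb))

theorem bigOh (hφ : Scaled h N e φ) {ξ : Pt} (hξ : ξ ∈ refTriangle) :
    BigOh h e fun i => φ i ξ := by
  obtain ⟨K, hK⟩ := hφ.bound
  exact ⟨K, fun i => by simpa using hK i 0 (Nat.zero_le _) ξ hξ⟩

/-- Uniform polynomial approximation of a family of functions. -/
theorem exists_polynomial (hφ : Scaled h N e φ) {m : ℕ} (hm : m + 1 ≤ N) :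
    ∃ q : ι → MvPolynomial (Fin 2) ℝ, (∀ i, (q i).totalDegree ≤ m) ∧
      (∀ N', Scaled h N' e fun i => polyEval (q i)) ∧
      (∃ K : ℝ, ∀ i, ∀ ξ ∈ refTriangle,
        |φ i ξ - polyEval (q i) ξ| ≤ K * (h i : ℝ) ^ (e + m + 1)) ∧
      ∀ b, ∀ ξ ∈ refTriangle, BigOh h (e + m + 1) fun i =>
        SBPSAT.pd refTriangle (φ i) b ξ - polyEval (MvPolynomial.pderiv b (q i)) ξ := by
  obtain ⟨K, hK0, hK⟩ := hφ.exists_nonneg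
  have hφc : ∀ i, ContDiffOn ℝ (m + 1 : ℕ) (φ i) refTriangle := fun i =>
    (hφ.contDiffOn i).of_le (by exact_mod_cast hm)
  choose q hqd hq using fun i => exists_polynomial_approx m (hφc i)
    (fun ξ hξ => hK i (m + 1) hm ξ hξ)
  have hq' : ∀ i, ∀ j ≤ m + 1, ∀ ξ ∈ refTriangle,
      ‖iteratedFDerivWithin ℝ j (fun η => φ i η - polyEval (q i) η) refTriangle ξ‖
        ≤ K * 4 ^ (m + 1) * (h i : ℝ) ^ (e + m + 1) := by
    intro i j hj ξ hξ
    refine (hq i j hj ξ hξ).trans ?_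
    have hh := (h i).2.1.le
    calc K * (h i : ℝ) ^ (e + (m + 1)) * 4 ^ (m + 1 - j)
        ≤ K * (h i : ℝ) ^ (e + (m + 1)) * 4 ^ (m + 1) :=
          mul_le_mul_of_nonneg_left (pow_le_pow_right₀ (by norm_num) (by omega)) (by positivity)
      _ = _ := by rw [← add_assoc]; ring
  refine ⟨q, hqd, fun N' => ⟨fun i => (contDiff_polyEval _).contDiffOn, K + K * 4 ^ (m + 1),
    fun i j _ ξ hξ => ?_⟩, ⟨K * 4 ^ (m + 1), fun i ξ hξ => ?_⟩, fun b ξ hξ =>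
    ⟨K * 4 ^ (m + 1), fun i => ?_⟩⟩
  · have hh := (h i).2.1.le
    -- Up to order `m`, derivatives of the polynomial are those of `φ` minus a remainder of the
    -- higher order `e + m + 1`; beyond `m` they vanish. Hence the polynomial is scaled for every
    -- `N'`, even if `φ` is not.
    by_cases hj : j ≤ m
    · have h1 : iteratedFDerivWithin ℝ j (polyEval (q i)) refTriangle ξ
          = iteratedFDerivWithin ℝ j (φ i) refTriangle ξ
          - iteratedFDerivWithin ℝ j (fun η => φ i η - polyEval (q i) η) refTriangle ξ := by
        rw [fun_iteratedFDerivWithin_sub_apply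
          ((hφc i ξ hξ).of_le (by norm_cast; omega))
          ((contDiff_polyEval (q i)).contDiffWithinAt) uniqueDiffOn_refTriangle hξ]
        abel
      rw [h1, add_mul]
      refine (norm_sub_le _ _).trans (add_le_add (hK i j (by omega) ξ hξ)
        ((hq' i j (by omega) ξ hξ).trans ?_))
      exact mul_le_mul_of_nonneg_left
        (pow_le_pow_of_le_one (h i).2.1.le (h i).2.2 (by omega)) (by positivity)
    · obtain ⟨l, rfl⟩ : ∃ l, j = l + 1 := ⟨j - 1, by omega⟩
      rw [iteratedFDerivWithin_eq_iteratedFDeriv uniqueDiffOn_refTriangle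
        (contDiff_polyEval _).contDiffAt hξ,
        iteratedFDeriv_polyEval_eq_zero l (q i) ((hqd i).trans (by omega))]
      positivity
  · simpa using hq' i 0 (by omega) ξ hξ
  · have h1 := hq' i 1 (by omega) ξ hξ
    have hu := uniqueDiffOn_refTriangle ξ hξ
    rw [norm_iteratedFDerivWithin_one _ hu] at h1
    have hd : DifferentiableWithinAt ℝ (φ i) refTriangle ξ :=
      (hφc i ξ hξ).differentiableWithinAt (by norm_cast)
    have hdq : DifferentiableAt ℝ (polyEval (q i)) ξ :=
      (hasFDerivAt_polyEval _ _).differentiableAt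
    rw [fderivWithin_fun_sub hu hd hdq.differentiableWithinAt, hdq.fderivWithin hu] at h1
    beta_reduce
    rw [← fderiv_polyEval_single, SBPSAT.pd]
    have h2 := (fderivWithin ℝ (φ i) refTriangle ξ - fderiv ℝ (polyEval (q i)) ξ).le_opNorm
      (EuclideanSpace.single b (1 : ℝ) : Pt)
    refine le_trans ?_ (h2.trans (le_trans (le_of_eq ?_) h1))
    · simp
    · simp

end Scaled

end Families

/-! ### The reference operator -/

theorem facetParam_mem_refTriangle (f : Fin 3) {s : ℝ} (hs : s ∈ Set.Icc (-1 : ℝ) 1) :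
    facetParam f s ∈ refTriangle := by
  obtain ⟨h1, h2⟩ := hs
  fin_cases f <;> simp [facetParam, refTriangle] <;> constructor <;> linarith

namespace RefOperator

variable {np nf : ℕ} {op : RefOperator np nf} {p : ℕ}

theorem IsSBP.facetPt_mem (hop : op.IsSBP p) (f : Fin 3) (l : Fin nf) :
    op.facetPt f l ∈ refTriangle :=
  facetParam_mem_refTriangle f (hop.facetNode_mem l)

theorem IsSBP.Q_add_transpose (hop : op.IsSBP p) (b : Fin 2) :
    op.Q b + (op.Q b)ᵀ = op.E b := by
  have hE : (op.E b)ᵀ = op.E b := by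
    simp only [E, Matrix.transpose_sum, Matrix.transpose_mul, Matrix.transpose_transpose,
      Matrix.diagonal_transpose, Matrix.mul_assoc]
  rw [Q, Matrix.transpose_add, hop.S_skew, Matrix.transpose_smul, hE]
  have : op.E b = (1 / 2 : ℝ) • op.E b + (1 / 2 : ℝ) • op.E b := by
    rw [← add_smul]; norm_num
  conv_rhs => rw [this]
  abel

theorem dotProduct_E_mulVec (b : Fin 2) (x y : Fin np → ℝ) :
    x ⬝ᵥ (op.E b *ᵥ y) = ∑ f, ∑ l, op.Bhat f l * refNormal f b * (op.R f *ᵥ x) l *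
      (op.R f *ᵥ y) l := by
  rw [E, Matrix.sum_mulVec, dotProduct_sum]
  refine Finset.sum_congr rfl fun f _ => ?_
  rw [← Matrix.mulVec_mulVec, ← Matrix.mulVec_mulVec, Matrix.dotProduct_mulVec,
    Matrix.vecMul_transpose]
  simp only [dotProduct, Matrix.mulVec_diagonal]
  exact Finset.sum_congr rfl fun l _ => by ring

/-- Discrete integration by parts. -/
theorem IsSBP.sum_by_parts (hop : op.IsSBP p) (b : Fin 2) (x y : Fin np → ℝ) :
    x ⬝ᵥ (op.Q b *ᵥ y) + (op.Q b *ᵥ x) ⬝ᵥ y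
      = ∑ f, ∑ l, op.Bhat f l * refNormal f b * (op.R f *ᵥ x) l * (op.R f *ᵥ y) l := by
  rw [← dotProduct_E_mulVec, ← hop.Q_add_transpose, Matrix.add_mulVec, dotProduct_add]
  congr 1
  rw [Matrix.dotProduct_mulVec, Matrix.vecMul_transpose]

theorem IsSBP.Q_mulVec (hop : op.IsSBP p) (b : Fin 2) (y : Fin np → ℝ) (j : Fin np) :
    (op.Q b *ᵥ y) j = op.H j * (op.D b *ᵥ y) j := by
  rw [D, ← Matrix.mulVec_mulVec, Matrix.mulVec_diagonal, mul_inv_cancel_left₀ (hop.H_pos j).ne']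

/-- Values of a function at the volume nodes. -/
def nodal (op : RefOperator np nf) (φ : Pt → ℝ) : Fin np → ℝ := fun j => φ (op.node j)

theorem IsSBP.Q_polyEval (hop : op.IsSBP p) (b : Fin 2) {q : MvPolynomial (Fin 2) ℝ}
    (hq : q.totalDegree ≤ p) (j : Fin np) :
    (op.Q b *ᵥ op.nodal (polyEval q)) j = op.H j * polyEval (MvPolynomial.pderiv b q) (op.node j) := by
  rw [hop.Q_mulVec]
  congr 1
  exact congrFun (hop.D_exact b q hq) j

theorem IsSBP.R_polyEval (hop : op.IsSBP p) (f : Fin 3) {q : MvPolynomial (Fin 2) ℝ}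
    (hq : q.totalDegree ≤ p) (l : Fin nf) :
    (op.R f *ᵥ op.nodal (polyEval q)) l = polyEval q (op.facetPt f l) :=
  congrFun (hop.R_exact f q hq) l

/-- The volume and facet quadratures satisfy the divergence theorem for polynomials of degree
`2p`. -/
theorem IsSBP.div_exact (hop : op.IsSBP p) (b : Fin 2) {q : MvPolynomial (Fin 2) ℝ}
    (hq : q.totalDegree ≤ 2 * p) :
    ∑ j, op.H j * polyEval (MvPolynomial.pderiv b q) (op.node j)
      = ∑ f, ∑ l, op.Bhat f l * refNormal f b * polyEval q (op.facetPt f l) := by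
  -- For a product of two polynomials of degree at most `p` the claim is discrete integration by
  -- parts, all operators being exact on each factor. Every monomial of degree at most `2 * p` is
  -- such a product.
  have hmul : ∀ q₁ q₂ : MvPolynomial (Fin 2) ℝ, q₁.totalDegree ≤ p → q₂.totalDegree ≤ p →
      ∑ j, op.H j * polyEval (MvPolynomial.pderiv b (q₁ * q₂)) (op.node j)
        = ∑ f, ∑ l, op.Bhat f l * refNormal f b * polyEval (q₁ * q₂) (op.facetPt f l) := by
    intro q₁ q₂ h₁ h₂
    have h := hop.sum_by_parts b (op.nodal (polyEval q₁)) (op.nodal (polyEval q₂))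
    simp only [dotProduct, hop.Q_polyEval b h₁, hop.Q_polyEval b h₂, hop.R_polyEval _ h₁,
      hop.R_polyEval _ h₂] at h
    simp only [polyEval_mul, ← mul_assoc]
    rw [← h, ← Finset.sum_add_distrib]
    refine Finset.sum_congr rfl fun j _ => ?_
    simp only [Derivation.leibniz, smul_eq_mul, polyEval_add, polyEval_mul, nodal]
    ring
  have hmon : ∀ s ∈ q.support, ∑ j, op.H j *
      polyEval (MvPolynomial.pderiv b (MvPolynomial.monomial s (q.coeff s))) (op.node j)
        = ∑ f, ∑ l, op.Bhat f l * refNormal f b *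
          polyEval (MvPolynomial.monomial s (q.coeff s)) (op.facetPt f l) := by
    intro s hs
    have hs' : s 0 + s 1 ≤ 2 * p := by
      refine le_trans (le_of_eq ?_) ((MvPolynomial.le_totalDegree hs).trans hq)
      rw [Finsupp.sum_fintype _ _ (fun _ => rfl), Fin.sum_univ_two]
    -- The first factor takes as many `X 0` as degree `p` allows and is filled up with `X 1`; what
    -- remains has degree at most `p`.
    have hm : MvPolynomial.monomial s (q.coeff s)
        = (MvPolynomial.C (q.coeff s) * (MvPolynomial.X 0 ^ min (s 0) p *
            MvPolynomial.X 1 ^ min (s 1) (p - min (s 0) p))) *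
          (MvPolynomial.X 0 ^ (s 0 - min (s 0) p) *
            MvPolynomial.X 1 ^ (s 1 - min (s 1) (p - min (s 0) p))) := by
      rw [MvPolynomial.monomial_eq, Finsupp.prod_fintype _ _ (fun _ => pow_zero _),
        Fin.prod_univ_two]
      rw [show (MvPolynomial.X 0 : MvPolynomial (Fin 2) ℝ) ^ s 0
          = MvPolynomial.X 0 ^ min (s 0) p * MvPolynomial.X 0 ^ (s 0 - min (s 0) p) by
            rw [← pow_add]; congr 1; omega,
        show (MvPolynomial.X 1 : MvPolynomial (Fin 2) ℝ) ^ s 1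
          = MvPolynomial.X 1 ^ min (s 1) (p - min (s 0) p) *
            MvPolynomial.X 1 ^ (s 1 - min (s 1) (p - min (s 0) p)) by
            rw [← pow_add]; congr 1; omega]
      ring
    have hXX : ∀ a c : ℕ, ((MvPolynomial.X 0 : MvPolynomial (Fin 2) ℝ) ^ a *
        MvPolynomial.X 1 ^ c).totalDegree ≤ a + c := by
      intro a c
      refine (MvPolynomial.totalDegree_mul _ _).trans ?_
      simp
    rw [hm]
    refine hmul _ _ ((MvPolynomial.totalDegree_mul _ _).trans ?_) ((hXX _ _).trans ?_)
    · rw [MvPolynomial.totalDegree_C, zero_add]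
      exact (hXX _ _).trans (by omega)
    · omega
  have hsum : ∀ ξ, polyEval q ξ
      = ∑ s ∈ q.support, polyEval (MvPolynomial.monomial s (q.coeff s)) ξ := by
    intro ξ
    conv_lhs => rw [q.as_sum]
    simp only [polyEval, map_sum]
  have hsum' : ∀ ξ, polyEval (MvPolynomial.pderiv b q) ξ = ∑ s ∈ q.support,
      polyEval (MvPolynomial.pderiv b (MvPolynomial.monomial s (q.coeff s))) ξ := by
    intro ξ
    conv_lhs => rw [q.as_sum]
    simp only [polyEval, map_sum]
  simp only [hsum, hsum', Finset.mul_sum]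
  rw [Finset.sum_comm, Finset.sum_congr rfl hmon]
  rw [Finset.sum_comm]
  refine Finset.sum_congr rfl fun f _ => ?_
  rw [Finset.sum_comm]

/-! ### Approximation orders of the reference operators -/

section Families

variable {ι : Type*} {h : ι → Set.Ioc (0 : ℝ) 1} {e e₁ e₂ : ℕ} {u q : ι → Pt → ℝ}

/-- Accuracy of the extrapolation to the facets. -/
theorem IsSBP.R_approx (hop : op.IsSBP p) (hu : Scaled h (p + 1) e u) (f : Fin 3) (l : Fin nf) :
    BigOh h (e + p + 1) fun i => (op.R f *ᵥ op.nodal (u i)) l - u i (op.facetPt f l) := by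
  obtain ⟨q, hqd, -, ⟨K, hK⟩, -⟩ := hu.exists_polynomial le_rfl
  have h1 : BigOh h (e + p + 1) fun i =>
      (op.R f *ᵥ fun j => u i (op.node j) - polyEval (q i) (op.node j)) l :=
    BigOh.const_mulVec _ l fun j => ⟨K, fun i => hK i _ (hop.node_mem j)⟩
  have h2 : BigOh h (e + p + 1) fun i => u i (op.facetPt f l) - polyEval (q i) (op.facetPt f l) :=
    ⟨K, fun i => hK i _ (hop.facetPt_mem f l)⟩
  refine (h1.sub h2).congr fun i => ?_
  have h3 : (fun j => u i (op.node j) - polyEval (q i) (op.node j))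
      = op.nodal (u i) - op.nodal (polyEval (q i)) := rfl
  rw [h3, Matrix.mulVec_sub, Pi.sub_apply, hop.R_polyEval f (hqd i)]
  ring

/-- Accuracy of the derivative operators. -/
theorem IsSBP.D_approx (hop : op.IsSBP p) (hu : Scaled h (p + 1) e u) (b : Fin 2) (j : Fin np) :
    BigOh h (e + p + 1) fun i =>
      (op.D b *ᵥ op.nodal (u i)) j - pd refTriangle (u i) b (op.node j) := by
  obtain ⟨q, hqd, -, ⟨K, hK⟩, hpd⟩ := hu.exists_polynomial le_rfl
  have h1 : BigOh h (e + p + 1) fun i =>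
      (op.D b *ᵥ fun j => u i (op.node j) - polyEval (q i) (op.node j)) j :=
    BigOh.const_mulVec _ j fun j => ⟨K, fun i => hK i _ (hop.node_mem j)⟩
  refine (h1.sub (hpd b _ (hop.node_mem j))).congr fun i => ?_
  have h3 : (fun j => u i (op.node j) - polyEval (q i) (op.node j))
      = op.nodal (u i) - op.nodal (polyEval (q i)) := rfl
  have h4 : (op.D b *ᵥ op.nodal (polyEval (q i))) j
      = polyEval (MvPolynomial.pderiv b (q i)) (op.node j) :=
    congrFun (hop.D_exact b (q i) (hqd i)) j
  rw [h3, Matrix.mulVec_sub, Pi.sub_apply, h4]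
  ring

/-- The quadratures satisfy the divergence theorem up to terms of order `2p + 1`. -/
theorem IsSBP.div_approx (hop : op.IsSBP p) (hu : Scaled h (2 * p + 1) e u) (b : Fin 2) :
    BigOh h (e + 2 * p + 1) fun i =>
      ∑ j, op.H j * pd refTriangle (u i) b (op.node j)
        - ∑ f, ∑ l, op.Bhat f l * refNormal f b * u i (op.facetPt f l) := by
  obtain ⟨q, hqd, -, ⟨K, hK⟩, hpd⟩ := hu.exists_polynomial le_rfl
  have h1 : BigOh h (e + 2 * p + 1) fun i => ∑ j, op.H j * (pd refTriangle (u i) b (op.node j)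
      - polyEval (MvPolynomial.pderiv b (q i)) (op.node j)) :=
    BigOh.sum fun j _ => (hpd b _ (hop.node_mem j)).const_mul _
  have h2 : BigOh h (e + 2 * p + 1) fun i => ∑ f, ∑ l, op.Bhat f l * refNormal f b *
      (u i (op.facetPt f l) - polyEval (q i) (op.facetPt f l)) :=
    BigOh.sum fun f _ => BigOh.sum fun l _ =>
      BigOh.const_mul _ ⟨K, fun i => hK i _ (hop.facetPt_mem f l)⟩
  refine (h1.sub h2).congr fun i => ?_
  have h3 := hop.div_exact b (hqd i)
  simp only [mul_sub, Finset.sum_sub_distrib]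
  rw [h3]
  ring

/-- Superconvergence of the derivative operator tested with a smooth function. -/
theorem IsSBP.Q_superconvergence (hop : op.IsSBP p) (hq : Scaled h (p + 1) e₁ q)
    (hu : Scaled h (2 * p + 1) e₂ u) (b : Fin 2) :
    BigOh h (e₁ + e₂ + 2 * p + 1) fun i =>
      op.nodal (q i) ⬝ᵥ (op.Q b *ᵥ op.nodal (u i))
        - ∑ j, op.H j * q i (op.node j) * pd refTriangle (u i) b (op.node j)
        - ∑ f, ∑ l, op.Bhat f l * refNormal f b * q i (op.facetPt f l) *
          ((op.R f *ᵥ op.nodal (u i)) l - u i (op.facetPt f l)) := by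
  -- Replacing `q` by a polynomial `r` of degree `p` costs products of two errors of relative order
  -- `p + 1`, in the volume and on the facets. For `r`, summation by parts moves the derivative onto
  -- `r`, where it is exact, and what is left is the divergence theorem for `r * u`.
  obtain ⟨r, hrd, hr, ⟨K, hK⟩, -⟩ := hq.exists_polynomial le_rfl
  have hu' : Scaled h (p + 1) e₂ u := hu.of_le (by omega)
  have hK' : ∀ ξ ∈ refTriangle, BigOh h (e₁ + p + 1) fun i => q i ξ - polyEval (r i) ξ :=
    fun ξ hξ => ⟨K, fun i => hK i ξ hξ⟩
  have h1 : BigOh h (e₁ + e₂ + 2 * p + 1) fun i => ∑ j, op.H j *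
      ((q i (op.node j) - polyEval (r i) (op.node j)) *
        ((op.D b *ᵥ op.nodal (u i)) j - pd refTriangle (u i) b (op.node j))) :=
    BigOh.sum fun j _ => BigOh.const_mul _
      (((hK' _ (hop.node_mem j)).mul (hop.D_approx hu' b j)).mono (by omega))
  have h2 : BigOh h (e₁ + e₂ + 2 * p + 1) fun i => ∑ f, ∑ l, op.Bhat f l * refNormal f b *
      ((q i (op.facetPt f l) - polyEval (r i) (op.facetPt f l)) *
        ((op.R f *ᵥ op.nodal (u i)) l - u i (op.facetPt f l))) :=
    BigOh.sum fun f _ => BigOh.sum fun l _ => BigOh.const_mul _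
      (((hK' _ (hop.facetPt_mem f l)).mul (hop.R_approx hu' f l)).mono (by omega))
  -- Only `p + 1` derivatives of `q` are controlled, but its polynomial approximant is scaled to
  -- every order, as the divergence theorem for `r * u` demands.
  have h3 := hop.div_approx ((hr (2 * p + 1)).mul hu) b
  refine ((h1.sub h2).sub h3).congr fun i => ?_
  have hsbp := hop.sum_by_parts b (op.nodal (polyEval (r i))) (op.nodal (u i))
  simp only [dotProduct, hop.Q_polyEval b (hrd i), hop.R_polyEval _ (hrd i), hop.Q_mulVec,
    nodal] at hsbp
  have hpd : ∀ j, pd refTriangle (fun ξ => polyEval (r i) ξ * u i ξ) b (op.node j)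
      = polyEval (r i) (op.node j) * pd refTriangle (u i) b (op.node j)
        + u i (op.node j) * polyEval (MvPolynomial.pderiv b (r i)) (op.node j) := by
    intro j
    have hun := uniqueDiffOn_refTriangle _ (hop.node_mem j)
    have hdq : DifferentiableAt ℝ (polyEval (r i)) (op.node j) :=
      (hasFDerivAt_polyEval _ _).differentiableAt
    have hdu : DifferentiableWithinAt ℝ (u i) refTriangle (op.node j) :=
      (hu.contDiffOn i _ (hop.node_mem j)).differentiableWithinAt (by norm_cast)
    rw [← fderiv_polyEval_single, pd,
      fderivWithin_fun_mul hun hdq.differentiableWithinAt hdu, hdq.fderivWithin hun]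
    simp [pd]
  simp only [hpd, dotProduct, hop.Q_mulVec, nodal]
  simp only [mul_sub, sub_mul, mul_add, Finset.sum_sub_distrib, Finset.sum_add_distrib]
  have e1 : ∀ (g w : Fin np → ℝ), ∑ j, op.H j * (g j * w j) = ∑ j, g j * (op.H j * w j) :=
    fun g w => Finset.sum_congr rfl fun j _ => by ring
  have e2 : ∀ (g w : Fin np → ℝ), ∑ j, op.H j * (g j * w j) = ∑ j, op.H j * w j * g j :=
    fun g w => Finset.sum_congr rfl fun j _ => by ring
  have e3 : ∀ (g w : Fin np → ℝ), ∑ j, op.H j * (g j * w j) = ∑ j, op.H j * g j * w j :=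
    fun g w => Finset.sum_congr rfl fun j _ => by ring
  have e4 : ∀ (B g w : Fin 3 → Fin nf → ℝ), ∑ f, ∑ l, B f l * (g f l * w f l)
      = ∑ f, ∑ l, B f l * g f l * w f l :=
    fun B g w => Finset.sum_congr rfl fun f _ => Finset.sum_congr rfl fun j _ => by ring
  have e5 := e4 (fun f l => op.Bhat f l * refNormal f b)
    (fun f l => polyEval (r i) (op.facetPt f l)) (fun f l => u i (op.facetPt f l))
  have e6 := e4 (fun f l => op.Bhat f l * refNormal f b)
    (fun f l => polyEval (r i) (op.facetPt f l)) (fun f l => (op.R f *ᵥ op.nodal (u i)) l)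
  have e7 := e4 (fun f l => op.Bhat f l * refNormal f b)
    (fun f l => q i (op.facetPt f l)) (fun f l => u i (op.facetPt f l))
  have e8 := e4 (fun f l => op.Bhat f l * refNormal f b)
    (fun f l => q i (op.facetPt f l)) (fun f l => (op.R f *ᵥ op.nodal (u i)) l)
  have e9 := e1 (fun j => q i (op.node j)) (fun j => (op.D b *ᵥ op.nodal (u i)) j)
  have e10 := e1 (fun j => polyEval (r i) (op.node j))
    (fun j => (op.D b *ᵥ op.nodal (u i)) j)
  have e11 := e3 (fun j => q i (op.node j)) (fun j => pd refTriangle (u i) b (op.node j))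
  have e12 := e2 (fun j => u i (op.node j))
    (fun j => polyEval (MvPolynomial.pderiv b (r i)) (op.node j))
  linarith

end Families

end RefOperator

/-! ### Metric terms of a polynomial mapping -/

theorem refNormal_zero (f : Fin 3) : refNormal f 0 = refTangent f 1 := by
  fin_cases f <;> simp [refNormal, refTangent]

theorem refNormal_one (f : Fin 3) : refNormal f 1 = -refTangent f 0 := by
  fin_cases f <;> simp [refNormal, refTangent]; ring

theorem refNormal_sq (f : Fin 3) : refNormal f 0 ^ 2 + refNormal f 1 ^ 2 = 1 := by
  fin_cases f <;> simp [refNormal]; norm_num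

theorem pderiv_comm (q : MvPolynomial (Fin 2) ℝ) :
    MvPolynomial.pderiv 0 (MvPolynomial.pderiv 1 q) = MvPolynomial.pderiv 1 (MvPolynomial.pderiv 0 q) := by
  induction q using MvPolynomial.induction_on with
  | C a => simp
  | add q r hq hr => simp [hq, hr]
  | mul_X q i hq =>
    fin_cases i <;> simp [Derivation.leibniz, MvPolynomial.pderiv_X, hq] <;> ring

namespace PolyMap

variable (M : PolyMap)

/-- The cofactors as polynomials. -/
noncomputable def cofPoly : Matrix (Fin 2) (Fin 2) (MvPolynomial (Fin 2) ℝ) :=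
  !![MvPolynomial.pderiv 1 (M 1), -MvPolynomial.pderiv 0 (M 1);
    -MvPolynomial.pderiv 1 (M 0), MvPolynomial.pderiv 0 (M 0)]

theorem cof_eq_polyEval (d b : Fin 2) : M.cof d b = polyEval (M.cofPoly d b) := by
  funext ξ
  fin_cases d <;> fin_cases b <;> simp [cof, cofPoly, metric, polyEval]

theorem pd_polyEval (q : MvPolynomial (Fin 2) ℝ) (b : Fin 2) {ξ : Pt} (hξ : ξ ∈ refTriangle) :
    pd refTriangle (polyEval q) b ξ = polyEval (MvPolynomial.pderiv b q) ξ := by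
  rw [pd, (hasFDerivAt_polyEval q ξ).differentiableAt.fderivWithin (uniqueDiffOn_refTriangle ξ hξ),
    fderiv_polyEval_single]

/-- The metric identities. -/
theorem sum_pd_cof (d : Fin 2) {ξ : Pt} (hξ : ξ ∈ refTriangle) :
    ∑ b, pd refTriangle (M.cof d b) b ξ = 0 := by
  simp only [cof_eq_polyEval, pd_polyEval _ _ hξ, Fin.sum_univ_two]
  fin_cases d <;> simp [cofPoly, pderiv_comm, ← polyEval_add]

theorem sum_cof_mul_metric (d a : Fin 2) (ξ : Pt) :
    ∑ b, M.cof d b ξ * M.metric a b ξ = if d = a then M.jac ξ else 0 := by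
  fin_cases d <;> fin_cases a <;> simp [cof, jac] <;> ring

theorem sum_metric_mul_cof (b c : Fin 2) (ξ : Pt) :
    ∑ d, M.metric d b ξ * M.cof d c ξ = if b = c then M.jac ξ else 0 := by
  fin_cases b <;> fin_cases c <;> simp [cof, jac] <;> ring

theorem facetJac_sq (f : Fin 3) (ξ : Pt) :
    M.facetJac f ξ ^ 2 = ∑ d, (∑ b, M.cof d b ξ * refNormal f b) ^ 2 := by
  rw [facetJac, Real.sq_sqrt (by positivity)]
  simp [Fin.sum_univ_two, cof, refNormal_zero, refNormal_one]
  ring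

theorem facetJac_mul_normal {f : Fin 3} {ξ : Pt} (hf : M.facetJac f ξ ≠ 0) (d : Fin 2) :
    M.facetJac f ξ * M.normal f d ξ = ∑ b, M.cof d b ξ * refNormal f b := by
  rw [normal, mul_div_cancel₀ _ hf]

theorem normal_sq {f : Fin 3} {ξ : Pt} (hf : M.facetJac f ξ ≠ 0) :
    M.normal f 0 ξ ^ 2 + M.normal f 1 ξ ^ 2 = 1 := by
  have h := M.facetJac_sq f ξ
  have h2 := pow_ne_zero 2 hf
  rw [h] at h2
  rw [normal, normal, div_pow, div_pow, ← add_div, h]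
  simp only [Fin.sum_univ_two] at h2 ⊢
  exact div_self h2

/-- With `v` the cofactor matrix applied to the reference normal, the transposed Jacobian matrix
maps `v` to `J` times that normal, and Cauchy–Schwarz bounds `J`. The purpose is a lower bound for
the facet Jacobian. -/
theorem jac_sq_le (f : Fin 3) (ξ : Pt) :
    M.jac ξ ^ 2 ≤ (∑ a, ∑ b, M.metric a b ξ ^ 2) * M.facetJac f ξ ^ 2 := by
  rw [facetJac_sq]
  have hJ : ∀ b, ∑ d, M.metric d b ξ * (∑ c, M.cof d c ξ * refNormal f c)
      = M.jac ξ * refNormal f b := by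
    intro b
    simp only [Finset.mul_sum, ← mul_assoc]
    rw [Finset.sum_comm]
    simp only [← Finset.sum_mul, sum_metric_mul_cof]
    simp
  have h0 := hJ 0
  have h1 := hJ 1
  have hn := refNormal_sq f
  set v : Fin 2 → ℝ := fun d => ∑ c, M.cof d c ξ * refNormal f c with hv
  have e : M.jac ξ ^ 2 = (M.jac ξ * refNormal f 0) ^ 2 + (M.jac ξ * refNormal f 1) ^ 2 := by
    rw [mul_pow, mul_pow, ← mul_add, hn, mul_one]
  rw [e, ← h0, ← h1]
  change (∑ d, M.metric d 0 ξ * v d) ^ 2 + (∑ d, M.metric d 1 ξ * v d) ^ 2 ≤ _ * ∑ d, v d ^ 2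
  clear_value v
  simp only [Fin.sum_univ_two]
  nlinarith [sq_nonneg (M.metric 0 0 ξ * v 1 - M.metric 1 0 ξ * v 0),
    sq_nonneg (M.metric 0 1 ξ * v 1 - M.metric 1 1 ξ * v 0)]

theorem facetJac_pos {f : Fin 3} {ξ : Pt} (hJ : 0 < M.jac ξ) : 0 < M.facetJac f ξ := by
  refine lt_of_le_of_ne (Real.sqrt_nonneg _) fun h => ?_
  have := M.jac_sq_le f ξ
  rw [← h] at this
  nlinarith [pow_pos hJ 2]

/-! ### The stiffness matrix of a mapped element -/

variable {np nf : ℕ} (op : RefOperator np nf)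

/-- The integrated normal component `B N_d` at a facet node. -/
noncomputable def bn (f : Fin 3) (d : Fin 2) (l : Fin nf) : ℝ :=
  op.Bhat f l * ∑ b, M.cof d b (op.facetPt f l) * refNormal f b

variable {op} {p : ℕ}

theorem facetJac_mul_Bhat_mul_normal {f : Fin 3} {l : Fin nf}
    (hJ : 0 < M.jac (op.facetPt f l)) (d : Fin 2) :
    M.facetJac f (op.facetPt f l) * op.Bhat f l * M.normal f d (op.facetPt f l) = M.bn op f d l := by
  rw [bn, ← M.facetJac_mul_normal (M.facetJac_pos hJ).ne']; ring

theorem B_mulVec (f : Fin 3) (x : Fin nf → ℝ) (l : Fin nf) :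
    (M.B op f *ᵥ x) l = M.facetJac f (op.facetPt f l) * op.Bhat f l * x l := by
  rw [B, Matrix.mulVec_diagonal]

theorem N_mulVec (f : Fin 3) (d : Fin 2) (x : Fin nf → ℝ) (l : Fin nf) :
    (M.N op f d *ᵥ x) l = M.normal f d (op.facetPt f l) * x l := by
  rw [N, Matrix.mulVec_diagonal]

theorem dotProduct_E_mulVec (d : Fin 2) (x y : Fin np → ℝ) :
    x ⬝ᵥ (M.E op d *ᵥ y)
      = ∑ f, (op.R f *ᵥ x) ⬝ᵥ (M.B op f *ᵥ (M.N op f d *ᵥ (op.R f *ᵥ y))) := by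
  rw [E, Matrix.sum_mulVec, dotProduct_sum]
  refine Finset.sum_congr rfl fun f _ => ?_
  rw [← Matrix.mulVec_mulVec, ← Matrix.mulVec_mulVec, ← Matrix.mulVec_mulVec,
    Matrix.dotProduct_mulVec, Matrix.vecMul_transpose]

theorem dotProduct_E_mulVec' (hJ : ∀ ξ ∈ refTriangle, 0 < M.jac ξ) (hop : op.IsSBP p) (d : Fin 2)
    (x y : Fin np → ℝ) :
    x ⬝ᵥ (M.E op d *ᵥ y) = ∑ f, ∑ l, M.bn op f d l * (op.R f *ᵥ x) l * (op.R f *ᵥ y) l := by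
  rw [dotProduct_E_mulVec]
  refine Finset.sum_congr rfl fun f _ => ?_
  simp only [dotProduct, B_mulVec, N_mulVec]
  refine Finset.sum_congr rfl fun l _ => ?_
  rw [← M.facetJac_mul_Bhat_mul_normal (hJ _ (hop.facetPt_mem f l))]
  ring

/-- The stiffness matrix `H D` in direction `d`. -/
noncomputable def stiff (op : RefOperator np nf) (d : Fin 2) : Matrix (Fin np) (Fin np) ℝ :=
  M.S op d + (1 / 2 : ℝ) • M.E op d

theorem H_pos (hJ : ∀ ξ ∈ refTriangle, 0 < M.jac ξ) (hop : op.IsSBP p) (j : Fin np) :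
    0 < M.H op j := mul_pos (hJ _ (hop.node_mem j)) (hop.H_pos j)

theorem H_mul_D_mulVec (hJ : ∀ ξ ∈ refTriangle, 0 < M.jac ξ) (hop : op.IsSBP p) (d : Fin 2)
    (v : Fin np → ℝ) (j : Fin np) :
    M.H op j * (M.D op d *ᵥ v) j = (M.stiff op d *ᵥ v) j := by
  rw [D, ← Matrix.mulVec_mulVec, Matrix.mulVec_diagonal,
    mul_inv_cancel_left₀ (M.H_pos hJ hop j).ne', stiff]

/-- Summation by parts on the physical element. -/
theorem stiff_sum_by_parts (d : Fin 2) (x y : Fin np → ℝ) :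
    x ⬝ᵥ (M.stiff op d *ᵥ y) + (M.stiff op d *ᵥ x) ⬝ᵥ y = x ⬝ᵥ (M.E op d *ᵥ y) := by
  have hS : (M.S op d)ᵀ = -M.S op d := by
    simp only [S, Matrix.transpose_smul, Matrix.transpose_sum, Matrix.transpose_sub,
      Matrix.transpose_mul, Matrix.transpose_transpose, cofDiag, Matrix.diagonal_transpose]
    rw [← smul_neg, ← Finset.sum_neg_distrib]
    simp only [neg_sub]
  have hE : (M.E op d)ᵀ = M.E op d := by
    simp only [E, Matrix.transpose_sum, Matrix.transpose_mul, Matrix.transpose_transpose, B, N,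
      Matrix.diagonal_transpose, Matrix.mul_assoc]
    refine Finset.sum_congr rfl fun f _ => ?_
    rw [← Matrix.mul_assoc (Matrix.diagonal _) (Matrix.diagonal _),
      ← Matrix.mul_assoc (Matrix.diagonal _) (Matrix.diagonal _), Matrix.diagonal_mul_diagonal,
      Matrix.diagonal_mul_diagonal]
    simp only [mul_comm]
  have h1 : (M.stiff op d *ᵥ x) ⬝ᵥ y = x ⬝ᵥ ((M.stiff op d)ᵀ *ᵥ y) := by
    rw [Matrix.dotProduct_mulVec, Matrix.vecMul_transpose]
  rw [h1, ← dotProduct_add, ← Matrix.add_mulVec]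
  congr 2
  rw [stiff, Matrix.transpose_add, hS, Matrix.transpose_smul, hE]
  ext i j
  simp
  ring

/-- Summation by parts removes the transpose of `Q` from the skew-symmetric part. What appears is
the average of the advective form (cofactor times derivative) and the conservative form (derivative
of cofactor times function). The facet correction compares the exact metric times `R v` with the
extrapolation of metric times `v`. The accuracy and superconvergence of the mapped derivative start
from this formula. -/
theorem dotProduct_stiff_mulVec (hJ : ∀ ξ ∈ refTriangle, 0 < M.jac ξ) (hop : op.IsSBP p)
    (d : Fin 2) (x v : Fin np → ℝ) :
    x ⬝ᵥ (M.stiff op d *ᵥ v)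
      = (1 / 2) * ∑ b, ((fun j => M.cof d b (op.node j) * x j) ⬝ᵥ (op.Q b *ᵥ v)
          + x ⬝ᵥ (op.Q b *ᵥ fun j => M.cof d b (op.node j) * v j))
        + (1 / 2) * (∑ f, ∑ l, M.bn op f d l * (op.R f *ᵥ x) l * (op.R f *ᵥ v) l
          - ∑ f, ∑ l, op.Bhat f l * (op.R f *ᵥ x) l * ∑ b, refNormal f b *
            (op.R f *ᵥ fun j => M.cof d b (op.node j) * v j) l) := by
  have hC : ∀ (b : Fin 2) (y : Fin np → ℝ),
      M.cofDiag op d b *ᵥ y = fun j => M.cof d b (op.node j) * y j := by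
    intro b y
    funext j
    rw [cofDiag, Matrix.mulVec_diagonal]
  have h1 : ∀ b, x ⬝ᵥ ((M.cofDiag op d b * op.Q b - (op.Q b)ᵀ * M.cofDiag op d b) *ᵥ v)
      = (fun j => M.cof d b (op.node j) * x j) ⬝ᵥ (op.Q b *ᵥ v)
        + x ⬝ᵥ (op.Q b *ᵥ fun j => M.cof d b (op.node j) * v j)
        - ∑ f, ∑ l, op.Bhat f l * refNormal f b * (op.R f *ᵥ x) l *
          (op.R f *ᵥ fun j => M.cof d b (op.node j) * v j) l := by
    intro b
    rw [Matrix.sub_mulVec, dotProduct_sub, ← Matrix.mulVec_mulVec, ← Matrix.mulVec_mulVec, hC, hC,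
      ← hop.sum_by_parts b]
    have h2 : x ⬝ᵥ ((op.Q b)ᵀ *ᵥ fun j => M.cof d b (op.node j) * v j)
        = (op.Q b *ᵥ x) ⬝ᵥ fun j => M.cof d b (op.node j) * v j := by
      rw [Matrix.dotProduct_mulVec, Matrix.vecMul_transpose]
    rw [h2]
    have h3 : x ⬝ᵥ (fun j => M.cof d b (op.node j) * (op.Q b *ᵥ v) j)
        = (fun j => M.cof d b (op.node j) * x j) ⬝ᵥ (op.Q b *ᵥ v) :=
      Finset.sum_congr rfl fun j _ => by ring
    rw [h3]
    ring
  rw [stiff, Matrix.add_mulVec, dotProduct_add, Matrix.smul_mulVec, dotProduct_smul,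
    M.dotProduct_E_mulVec' hJ hop, S, Matrix.smul_mulVec, dotProduct_smul, Matrix.sum_mulVec,
    dotProduct_sum, Finset.sum_congr rfl fun b _ => h1 b, Finset.sum_sub_distrib]
  have h4 : ∑ b, ∑ f, ∑ l, op.Bhat f l * refNormal f b * (op.R f *ᵥ x) l *
          (op.R f *ᵥ fun j => M.cof d b (op.node j) * v j) l
      = ∑ f, ∑ l, op.Bhat f l * (op.R f *ᵥ x) l * ∑ b, refNormal f b *
            (op.R f *ᵥ fun j => M.cof d b (op.node j) * v j) l := by
    rw [Finset.sum_comm]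
    refine Finset.sum_congr rfl fun f _ => ?_
    rw [Finset.sum_comm]
    refine Finset.sum_congr rfl fun l _ => ?_
    rw [Finset.mul_sum]
    exact Finset.sum_congr rfl fun b _ => by ring
  rw [h4]
  simp only [smul_eq_mul]
  ring

end PolyMap

/-! ### Accuracy of the mapped operators -/

/-- A shape regular family of elements. -/
structure ElemFamily {ι : Type*} (h : ι → Set.Ioc (0 : ℝ) 1) (M : ι → PolyMap) : Prop where
  metric : ∀ N a b, Scaled h N 1 fun i => (M i).metric a b
  jac_lower : ∃ c : ℝ, 0 < c ∧ ∀ i, ∀ ξ ∈ refTriangle, c * (h i : ℝ) ^ 2 ≤ (M i).jac ξ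

/-- The functions `g` are the pullbacks of the physical partial derivatives of the function whose
pullback is `u`. -/
def IsGrad {ι : Type*} (M : ι → PolyMap) (u : ι → Pt → ℝ) (g : Fin 2 → ι → Pt → ℝ) : Prop :=
  ∀ i, ∀ ξ ∈ refTriangle, ∀ b,
    pd refTriangle (u i) b ξ = ∑ d, (M i).metric d b ξ * g d i ξ

theorem pd_mul {u v : Pt → ℝ} {ξ : Pt} (hu : DifferentiableWithinAt ℝ u refTriangle ξ)
    (hv : DifferentiableWithinAt ℝ v refTriangle ξ) (hξ : ξ ∈ refTriangle) (b : Fin 2) :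
    pd refTriangle (fun η => u η * v η) b ξ
      = u ξ * pd refTriangle v b ξ + v ξ * pd refTriangle u b ξ := by
  rw [pd, fderivWithin_fun_mul (uniqueDiffOn_refTriangle _ hξ) hu hv]
  simp [pd]

namespace ElemFamily

variable {ι : Type*} {h : ι → Set.Ioc (0 : ℝ) 1} {M : ι → PolyMap} {np nf p : ℕ}
  {op : RefOperator np nf} {e e₁ e₂ N : ℕ} {u q : ι → Pt → ℝ} {g : Fin 2 → ι → Pt → ℝ}

theorem jac_pos (hM : ElemFamily h M) (i : ι) : ∀ ξ ∈ refTriangle, 0 < (M i).jac ξ := by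
  obtain ⟨c, hc, hJ⟩ := hM.jac_lower
  intro ξ hξ
  exact (mul_pos hc (pow_pos (h i).2.1 2)).trans_le (hJ i ξ hξ)

theorem cof (hM : ElemFamily h M) (N : ℕ) (d b : Fin 2) :
    Scaled h N 1 fun i => (M i).cof d b := by
  fin_cases d <;> fin_cases b
  · exact (hM.metric N 1 1).congr fun i ξ _ => by simp [PolyMap.cof]
  · exact (hM.metric N 1 0).neg.congr fun i ξ _ => by simp [PolyMap.cof]
  · exact (hM.metric N 0 1).neg.congr fun i ξ _ => by simp [PolyMap.cof]
  · exact (hM.metric N 0 0).congr fun i ξ _ => by simp [PolyMap.cof]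

theorem jac (hM : ElemFamily h M) (N : ℕ) : Scaled h N 2 fun i => (M i).jac := by
  refine (((hM.metric N 0 0).mul (hM.metric N 1 1)).add
    (((hM.metric N 0 1).mul (hM.metric N 1 0)).neg)).congr fun i ξ _ => ?_
  rw [PolyMap.jac, sub_eq_add_neg]

theorem bigOh_H (hM : ElemFamily h M) (hop : op.IsSBP p) (j : Fin np) :
    BigOh h 2 fun i => (M i).H op j := by
  refine (((hM.jac 0).bigOh (hop.node_mem j)).const_mul (op.H j)).congr fun i => ?_
  rw [PolyMap.H, mul_comm]

/-- Division by `H` costs two orders, because the Jacobian is bounded below by a multiple of `h ^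
2`. -/
theorem bigOh_of_H_mul (hM : ElemFamily h M) (hop : op.IsSBP p) {j : Fin np} {X : ι → ℝ}
    (hX : BigOh h (e + 2) fun i => (M i).H op j * X i) : BigOh h e X := by
  obtain ⟨C, hC⟩ := hX
  obtain ⟨c, hc, hJ⟩ := hM.jac_lower
  have hH := hop.H_pos j
  refine ⟨C / (c * op.H j), fun i => ?_⟩
  have h1 := hC i
  have h2 := hJ i _ (hop.node_mem j)
  have h3 := pow_pos (h i).2.1 2
  rw [abs_mul, abs_of_pos ((M i).H_pos (hM.jac_pos i) hop j)] at h1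
  rw [div_mul_eq_mul_div, le_div_iff₀ (by positivity)]
  have h4 : c * (h i : ℝ) ^ 2 * op.H j * |X i| ≤ C * (h i : ℝ) ^ (e + 2) :=
    (mul_le_mul_of_nonneg_right (mul_le_mul_of_nonneg_right h2 hH.le) (abs_nonneg _)).trans h1
  rw [pow_add] at h4
  have h5 : (|X i| * (c * op.H j)) * (h i : ℝ) ^ 2 ≤ (C * (h i : ℝ) ^ e) * (h i : ℝ) ^ 2 := by
    linarith
  exact le_of_mul_le_mul_right h5 h3

theorem bigOh_bn (hM : ElemFamily h M) (hop : op.IsSBP p) (f : Fin 3) (d : Fin 2) (l : Fin nf) :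
    BigOh h 1 fun i => (M i).bn op f d l := by
  refine BigOh.const_mul _ (BigOh.sum fun b _ => ?_)
  exact (((hM.cof 0 d b).bigOh (hop.facetPt_mem f l)).const_mul (refNormal f b)).congr
    fun i => mul_comm _ _

theorem bigOh_dotProduct_stiff (hM : ElemFamily h M) (hop : op.IsSBP p) (d : Fin 2)
    {x v : ι → Fin np → ℝ} (hx : ∀ j, BigOh h e₁ fun i => x i j)
    (hv : ∀ j, BigOh h e₂ fun i => v i j) :
    BigOh h (e₁ + e₂ + 1) fun i => x i ⬝ᵥ ((M i).stiff op d *ᵥ v i) := by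
  have hCx : ∀ b j, BigOh h (1 + e₁) fun i => (M i).cof d b (op.node j) * x i j := fun b j =>
    ((hM.cof 0 d b).bigOh (hop.node_mem j)).mul (hx j)
  have hCv : ∀ b j, BigOh h (1 + e₂) fun i => (M i).cof d b (op.node j) * v i j := fun b j =>
    ((hM.cof 0 d b).bigOh (hop.node_mem j)).mul (hv j)
  have hRx := fun f l => BigOh.const_mulVec (op.R f) l hx
  have hRv := fun f l => BigOh.const_mulVec (op.R f) l hv
  refine BigOh.congr (BigOh.add (BigOh.const_mul (1 / 2) (BigOh.sum (s := Finset.univ)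
      fun b _ => ((BigOh.dotProduct (hCx b)
        (fun a => BigOh.const_mulVec (op.Q b) a hv)).mono ?_).add
        ((BigOh.dotProduct hx (fun a => BigOh.const_mulVec (op.Q b) a (hCv b))).mono ?_)))
    (BigOh.const_mul (1 / 2) (BigOh.sub
      (BigOh.sum (s := Finset.univ) fun f _ => BigOh.sum (s := Finset.univ) fun l _ =>
        (((hM.bigOh_bn hop f d l).mul (hRx f l)).mul (hRv f l)).mono ?_)
      (BigOh.sum (s := Finset.univ) fun f _ => BigOh.sum (s := Finset.univ) fun l _ =>
        (((hRx f l).const_mul (op.Bhat f l)).mul (BigOh.sum (s := Finset.univ) fun b _ =>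
          (BigOh.const_mulVec (op.R f) l (hCv b)).const_mul (refNormal f b))).mono ?_))))
    fun i => ((M i).dotProduct_stiff_mulVec (hM.jac_pos i) hop d (x i) (v i)).symm
  all_goals omega

theorem bigOh_stiff (hM : ElemFamily h M) (hop : op.IsSBP p) (d : Fin 2)
    {v : ι → Fin np → ℝ} (hv : ∀ j, BigOh h e fun i => v i j) (j : Fin np) :
    BigOh h (e + 1) fun i => ((M i).stiff op d *ᵥ v i) j := by
  have := hM.bigOh_dotProduct_stiff hop d (e₁ := 0) (x := fun _ => Pi.single j 1)
    (fun _ => BigOh.const _) hv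
  simpa using this

/-- The stiffness matrix gains one order and `H⁻¹` loses two. -/
theorem bigOh_D (hM : ElemFamily h M) (hop : op.IsSBP p) (d : Fin 2)
    {v : ι → Fin np → ℝ} (hv : ∀ j, BigOh h (e + 1) fun i => v i j) (j : Fin np) :
    BigOh h e fun i => ((M i).D op d *ᵥ v i) j :=
  hM.bigOh_of_H_mul hop ((hM.bigOh_stiff hop d hv j).congr fun i =>
    ((M i).H_mul_D_mulVec (hM.jac_pos i) hop d (v i) j).symm)

theorem bigOh_D_transpose (hM : ElemFamily h M) (hop : op.IsSBP p) (d : Fin 2)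
    {y : ι → Fin np → ℝ} (hy : ∀ j, BigOh h (e + 1) fun i => y i j) (a : Fin np) :
    BigOh h e fun i => (((M i).D op d)ᵀ *ᵥ y i) a := by
  simp only [Matrix.mulVec, dotProduct, Matrix.transpose_apply]
  refine BigOh.sum fun j _ => hM.bigOh_of_H_mul hop (j := j) ?_
  have h1 := hM.bigOh_stiff hop d (v := fun _ => Pi.single a 1) (fun _ => BigOh.const _) j
  refine ((h1.mul (hy j)).mono (e₂ := e + 2) (by omega)).congr fun i => ?_
  rw [← (M i).H_mul_D_mulVec (hM.jac_pos i) hop]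
  simp [mul_assoc]

/-- The cofactor matrix inverts the chain rule up to the factor `J`. This is the advective form of
the physical derivative. -/
theorem sum_cof_mul_pd (hg : IsGrad M u g) (d : Fin 2) (i : ι) {ξ : Pt}
    (hξ : ξ ∈ refTriangle) :
    ∑ b, (M i).cof d b ξ * pd refTriangle (u i) b ξ = (M i).jac ξ * g d i ξ := by
  simp only [hg i ξ hξ, Finset.mul_sum, ← mul_assoc]
  rw [Finset.sum_comm]
  simp only [← Finset.sum_mul, PolyMap.sum_cof_mul_metric]
  simp

/-- The conservative form of the physical derivative. -/
theorem sum_pd_cof_mul (hg : IsGrad M u g) (hu : ∀ i, DifferentiableOn ℝ (u i) refTriangle)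
    (d : Fin 2) (i : ι) {ξ : Pt} (hξ : ξ ∈ refTriangle) :
    ∑ b, pd refTriangle (fun η => (M i).cof d b η * u i η) b ξ = (M i).jac ξ * g d i ξ := by
  have hc : ∀ b, DifferentiableWithinAt ℝ ((M i).cof d b) refTriangle ξ := by
    intro b
    rw [PolyMap.cof_eq_polyEval]
    exact (hasFDerivAt_polyEval _ _).differentiableAt.differentiableWithinAt
  simp only [pd_mul (hc _) (hu i ξ hξ) hξ, Finset.sum_add_distrib, ← Finset.mul_sum,
    PolyMap.sum_pd_cof _ _ hξ, mul_zero, add_zero]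
  exact sum_cof_mul_pd hg d i hξ

theorem mul_cof (hM : ElemFamily h M) (hu : Scaled h N 0 u) (d b : Fin 2) :
    Scaled h N 1 fun i ξ => (M i).cof d b ξ * u i ξ := (hM.cof N d b).mul hu

/-- Accuracy of the physical derivative operators. -/
theorem D_approx (hM : ElemFamily h M) (hop : op.IsSBP p) (hu : Scaled h (p + 1) 0 u)
    (hg : IsGrad M u g) (d : Fin 2) (j : Fin np) :
    BigOh h p fun i => ((M i).D op d *ᵥ op.nodal (u i)) j - g d i (op.node j) := by
  -- Testing with the `j`-th unit vector splits `H (D u - g)` into errors of the advective and the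
  -- conservative reference derivative and two facet errors. Each has order `p + 2`: one power from
  -- the metric, `p + 1` from the reference operators.
  refine hM.bigOh_of_H_mul hop (j := j) ?_
  have hCu := hM.mul_cof hu d
  have h1 : ∀ b, BigOh h (p + 2) fun i => (M i).cof d b (op.node j) * (op.H j *
      ((op.D b *ᵥ op.nodal (u i)) j - pd refTriangle (u i) b (op.node j))) := fun b =>
    (((hM.cof 0 d b).bigOh (hop.node_mem j)).mul ((hop.D_approx hu b j).const_mul _)).mono
      (by omega)
  have h2 : ∀ b, BigOh h (p + 2) fun i => op.H j *
      ((op.D b *ᵥ op.nodal (fun ξ => (M i).cof d b ξ * u i ξ)) j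
        - pd refTriangle (fun ξ => (M i).cof d b ξ * u i ξ) b (op.node j)) := fun b =>
    ((hop.D_approx (hCu b) b j).const_mul _).mono (by omega)
  have h3 : ∀ f l, BigOh h (p + 2) fun i => (op.R f *ᵥ Pi.single j 1) l * ((M i).bn op f d l *
      ((op.R f *ᵥ op.nodal (u i)) l - u i (op.facetPt f l))) := fun f l =>
    BigOh.const_mul _ (((hM.bigOh_bn hop f d l).mul (hop.R_approx hu f l)).mono (by omega))
  have h4 : ∀ f l b, BigOh h (p + 2) fun i => op.Bhat f l * (op.R f *ᵥ Pi.single j 1) l *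
      (refNormal f b * ((op.R f *ᵥ op.nodal (fun ξ => (M i).cof d b ξ * u i ξ)) l
        - (M i).cof d b (op.facetPt f l) * u i (op.facetPt f l))) := fun f l b =>
    BigOh.const_mul _ (((hop.R_approx (hCu b) f l).const_mul _).mono (by omega))
  refine BigOh.congr (((BigOh.sum (s := Finset.univ) fun b _ => (h1 b).add (h2 b)).const_mul
    (1 / 2)).add ((BigOh.sum (s := Finset.univ) fun f _ => BigOh.sum (s := Finset.univ) fun l _ =>
      (h3 f l).sub (BigOh.sum (s := Finset.univ) fun b _ => h4 f l b)).const_mul (1 / 2)))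
    fun i => ?_
  have hdu : ∀ i, DifferentiableOn ℝ (u i) refTriangle := fun i =>
    (hu.contDiffOn i).differentiableOn (by norm_cast)
  have hn := hop.node_mem j
  have a1 := sum_cof_mul_pd hg d i hn
  have a2 := sum_pd_cof_mul hg hdu d i hn
  rw [mul_sub, (M i).H_mul_D_mulVec (hM.jac_pos i) hop]
  have a3 := (M i).dotProduct_stiff_mulVec (hM.jac_pos i) hop d (Pi.single j 1) (op.nodal (u i))
  rw [single_one_dotProduct] at a3
  rw [a3]
  have a4 : ∀ b, (fun k => (M i).cof d b (op.node k) * (Pi.single j 1 : Fin np → ℝ) k)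
      = Pi.single j ((M i).cof d b (op.node j)) := by
    intro b
    funext k
    by_cases hk : k = j
    · subst hk; simp
    · simp [Pi.single_eq_of_ne hk]
  have a5 : ∀ b, (fun k => (M i).cof d b (op.node k) * op.nodal (u i) k)
      = op.nodal fun ξ => (M i).cof d b ξ * u i ξ := fun b => rfl
  simp only [a4, a5, single_dotProduct, one_mul, hop.Q_mulVec]
  -- On exact facet values the two facet sums cancel, by the definition of `bn`, so extrapolated
  -- values may be replaced by extrapolation errors.
  have a6 : ∀ f, ∀ l, (op.R f *ᵥ Pi.single j 1) l * ((M i).bn op f d l *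
        ((op.R f *ᵥ op.nodal (u i)) l - u i (op.facetPt f l)))
      - ∑ b, op.Bhat f l * (op.R f *ᵥ Pi.single j 1) l *
        (refNormal f b * ((op.R f *ᵥ op.nodal (fun ξ => (M i).cof d b ξ * u i ξ)) l
        - (M i).cof d b (op.facetPt f l) * u i (op.facetPt f l)))
      = (M i).bn op f d l * (op.R f *ᵥ Pi.single j 1) l * (op.R f *ᵥ op.nodal (u i)) l
        - op.Bhat f l * (op.R f *ᵥ Pi.single j 1) l * ∑ b, refNormal f b *
          (op.R f *ᵥ op.nodal (fun ξ => (M i).cof d b ξ * u i ξ)) l := by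
    intro f l
    simp only [PolyMap.bn, Fin.sum_univ_two]
    ring
  simp only [a6, Finset.sum_sub_distrib]
  simp only [Fin.sum_univ_two] at a1 a2 ⊢
  rw [PolyMap.H]
  linear_combination (-op.H j / 2) * a1 + (-op.H j / 2) * a2

/-- Superconvergence of the physical derivative operators tested with smooth functions. -/
theorem D_superconvergence (hM : ElemFamily h M) (hop : op.IsSBP p)
    (hq : Scaled h (2 * p + 1) 0 q) (hu : Scaled h (2 * p + 1) 0 u) (hg : IsGrad M u g)
    (d : Fin 2) :
    BigOh h (2 * p + 2) fun i =>
      ∑ j, (M i).H op j * q i (op.node j) *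
        (((M i).D op d *ᵥ op.nodal (u i)) j - g d i (op.node j))
      - ∑ f, ∑ l, (M i).bn op f d l * q i (op.facetPt f l) *
        ((op.R f *ᵥ op.nodal (u i)) l - u i (op.facetPt f l)) := by
  have hCu := hM.mul_cof hu d
  have hCq := hM.mul_cof hq d
  have hu' : Scaled h (p + 1) 0 u := hu.of_le (by omega)
  have hq' : Scaled h (p + 1) 0 q := hq.of_le (by omega)
  -- The advective half pairs `cof * q` with `u`, the conservative half pairs `q` with `cof * u`. In
  -- both, the cofactor adds one power to the reference order `2 * p + 1`.
  have h1 : ∀ b, BigOh h (2 * p + 2) _ := fun b =>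
    (hop.Q_superconvergence ((hCq b).of_le (by omega)) hu b).mono (by omega)
  have h2 : ∀ b, BigOh h (2 * p + 2) _ := fun b =>
    (hop.Q_superconvergence hq' (hCu b) b).mono (by omega)
  have h3 : ∀ f l, BigOh h (2 * p + 2) fun i => (M i).bn op f d l *
      (((op.R f *ᵥ op.nodal (q i)) l - q i (op.facetPt f l)) *
        ((op.R f *ᵥ op.nodal (u i)) l - u i (op.facetPt f l))) := fun f l =>
    ((hM.bigOh_bn hop f d l).mul ((hop.R_approx hq' f l).mul (hop.R_approx hu' f l))).mono
      (by omega)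
  have h4 : ∀ f l b, BigOh h (2 * p + 2) fun i => op.Bhat f l * refNormal f b *
      (((op.R f *ᵥ op.nodal (q i)) l - q i (op.facetPt f l)) *
        ((op.R f *ᵥ op.nodal (fun ξ => (M i).cof d b ξ * u i ξ)) l
        - (M i).cof d b (op.facetPt f l) * u i (op.facetPt f l))) := fun f l b =>
    BigOh.const_mul _ (((hop.R_approx hq' f l).mul
      (hop.R_approx ((hCu b).of_le (by omega)) f l)).mono (by omega))
  refine BigOh.congr (((BigOh.sum (s := Finset.univ) fun b _ => (h1 b).add (h2 b)).const_mul
    (1 / 2)).add ((BigOh.sum (s := Finset.univ) fun f _ => BigOh.sum (s := Finset.univ) fun l _ =>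
      (h3 f l).sub (BigOh.sum (s := Finset.univ) fun b _ => h4 f l b)).const_mul (1 / 2)))
    fun i => ?_
  have hdu : ∀ i, DifferentiableOn ℝ (u i) refTriangle := fun i =>
    (hu.contDiffOn i).differentiableOn (by norm_cast)
  have a0 : ∑ j, (M i).H op j * q i (op.node j) *
        (((M i).D op d *ᵥ op.nodal (u i)) j - g d i (op.node j))
      = op.nodal (q i) ⬝ᵥ ((M i).stiff op d *ᵥ op.nodal (u i))
        - (1 / 2) * ∑ b, (∑ j, op.H j * ((M i).cof d b (op.node j) * q i (op.node j)) *
            pd refTriangle (u i) b (op.node j)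
          + ∑ j, op.H j * q i (op.node j) *
            pd refTriangle (fun ξ => (M i).cof d b ξ * u i ξ) b (op.node j)) := by
    rw [Finset.sum_add_distrib, Finset.sum_comm,
      Finset.sum_comm (f := fun b j => op.H j * q i (op.node j) *
            pd refTriangle (fun ξ => (M i).cof d b ξ * u i ξ) b (op.node j)),
      ← Finset.sum_add_distrib, Finset.mul_sum, dotProduct, ← Finset.sum_sub_distrib]
    refine Finset.sum_congr rfl fun j _ => ?_
    have a1 := sum_cof_mul_pd hg d i (hop.node_mem j)
    have a2 := sum_pd_cof_mul hg hdu d i (hop.node_mem j)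
    rw [← (M i).H_mul_D_mulVec (hM.jac_pos i) hop]
    simp only [Fin.sum_univ_two, RefOperator.nodal] at a1 a2 ⊢
    rw [PolyMap.H]
    linear_combination (op.H j / 2 * q i (op.node j)) * (a1 + a2)
  rw [a0, (M i).dotProduct_stiff_mulVec (hM.jac_pos i) hop]
  have a5 : ∀ b, (fun k => (M i).cof d b (op.node k) * op.nodal (u i) k)
      = op.nodal fun ξ => (M i).cof d b ξ * u i ξ := fun b => rfl
  have a6 : ∀ b, (fun k => (M i).cof d b (op.node k) * op.nodal (q i) k)
      = op.nodal fun ξ => (M i).cof d b ξ * q i ξ := fun b => rfl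
  simp only [a5, a6]
  -- The facet terms of the stiffness formula and of the two reference estimates combine: apart from
  -- the term `bn * q * (R u - u)` of the statement, only products of two extrapolation errors
  -- survive, which `h3` and `h4` bound.
  have key : ∑ f, ∑ l, ((M i).bn op f d l *
      (((op.R f *ᵥ op.nodal (q i)) l - q i (op.facetPt f l)) *
        ((op.R f *ᵥ op.nodal (u i)) l - u i (op.facetPt f l)))
      - ∑ b, op.Bhat f l * refNormal f b *
      (((op.R f *ᵥ op.nodal (q i)) l - q i (op.facetPt f l)) *
        ((op.R f *ᵥ op.nodal (fun ξ => (M i).cof d b ξ * u i ξ)) l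
        - (M i).cof d b (op.facetPt f l) * u i (op.facetPt f l))))
      = ∑ f, ∑ l, (M i).bn op f d l * (op.R f *ᵥ op.nodal (q i)) l * (op.R f *ᵥ op.nodal (u i)) l
        - ∑ f, ∑ l, op.Bhat f l * (op.R f *ᵥ op.nodal (q i)) l * ∑ b, refNormal f b *
          (op.R f *ᵥ op.nodal (fun ξ => (M i).cof d b ξ * u i ξ)) l
        - 2 * ∑ f, ∑ l, (M i).bn op f d l * q i (op.facetPt f l) *
          ((op.R f *ᵥ op.nodal (u i)) l - u i (op.facetPt f l))
        + ∑ b, ((∑ f, ∑ l, op.Bhat f l * refNormal f b *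
            ((M i).cof d b (op.facetPt f l) * q i (op.facetPt f l)) *
            ((op.R f *ᵥ op.nodal (u i)) l - u i (op.facetPt f l)))
          + ∑ f, ∑ l, op.Bhat f l * refNormal f b * q i (op.facetPt f l) *
            ((op.R f *ᵥ op.nodal (fun ξ => (M i).cof d b ξ * u i ξ)) l
              - (M i).cof d b (op.facetPt f l) * u i (op.facetPt f l))) := by
    simp only [Fin.sum_univ_two (f := fun b : Fin 2 => (∑ f, ∑ l, op.Bhat f l * refNormal f b *
            ((M i).cof d b (op.facetPt f l) * q i (op.facetPt f l)) *
            ((op.R f *ᵥ op.nodal (u i)) l - u i (op.facetPt f l)))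
          + ∑ f, ∑ l, op.Bhat f l * refNormal f b * q i (op.facetPt f l) *
            ((op.R f *ᵥ op.nodal (fun ξ => (M i).cof d b ξ * u i ξ)) l
              - (M i).cof d b (op.facetPt f l) * u i (op.facetPt f l)))]
    simp only [Finset.mul_sum (s := (Finset.univ : Finset (Fin 3))),
      Finset.mul_sum (s := (Finset.univ : Finset (Fin nf))),
      ← Finset.sum_sub_distrib, ← Finset.sum_add_distrib]
    refine Finset.sum_congr rfl fun f _ => Finset.sum_congr rfl fun l _ => ?_
    simp only [PolyMap.bn, Fin.sum_univ_two]
    ring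
  rw [key]
  simp only [Fin.sum_univ_two]
  ring

end ElemFamily

/-! ### Fluxes on the elements -/

namespace PolyMap

variable (M : PolyMap) {np nf : ℕ} (op : RefOperator np nf)
  (lam : Pt → Matrix (Fin 2) (Fin 2) ℝ)

theorem Lam_mulVec (a b : Fin 2) (v : Fin np → ℝ) :
    M.Lam op lam a b *ᵥ v = fun j => lam (M.pnode op j) a b * v j := by
  funext j
  rw [Lam, Matrix.mulVec_diagonal]

theorem Dn_mulVec (f : Fin 3) (v : Fin np → ℝ) (l : Fin nf) :
    (M.Dn op lam f *ᵥ v) l = ∑ a, ∑ b, M.normal f a (op.facetPt f l) *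
      (op.R f *ᵥ fun j => lam (M.pnode op j) a b * (M.D op b *ᵥ v) j) l := by
  simp only [Dn, Matrix.sum_mulVec, Finset.sum_apply, ← Matrix.mulVec_mulVec, N_mulVec, Lam_mulVec]

theorem D2_mulVec (v : Fin np → ℝ) (j : Fin np) :
    (M.D2 op lam *ᵥ v) j = ∑ a, ∑ b,
      (M.D op a *ᵥ fun j => lam (M.pnode op j) a b * (M.D op b *ᵥ v) j) j := by
  simp only [D2, Matrix.sum_mulVec, Finset.sum_apply, ← Matrix.mulVec_mulVec, Lam_mulVec]

/-- The discrete energy inner product `(D v)ᵀ H Λ D w`. -/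
noncomputable def energy (v w : Fin np → ℝ) : ℝ :=
  ∑ a, ∑ b, ∑ j, M.H op j * (M.D op a *ᵥ v) j * lam (M.pnode op j) a b * (M.D op b *ᵥ w) j

end PolyMap

/-- A family of smooth functions `u` with gradients `g`, fluxes `fl` and derivatives `dfl` of the
fluxes, pulled back to the reference triangle. -/
structure SmoothFamily {ι : Type*} (h : ι → Set.Ioc (0 : ℝ) 1) (M : ι → PolyMap)
    (lam : Pt → Matrix (Fin 2) (Fin 2) ℝ) (p : ℕ) (u : ι → Pt → ℝ) (g fl : Fin 2 → ι → Pt → ℝ)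
    (dfl : Fin 2 → Fin 2 → ι → Pt → ℝ) : Prop where
  scaled : Scaled h (2 * p + 1) 0 u
  scaled_flux : ∀ a, Scaled h (2 * p + 1) 0 (fl a)
  grad : IsGrad M u g
  flux_eq : ∀ a i, ∀ ξ ∈ refTriangle, fl a i ξ = ∑ b, lam ((M i).toFun ξ) a b * g b i ξ
  flux_grad : ∀ a, IsGrad M (fl a) (dfl a)

/-- A family of pulled back smooth symmetric tensors. -/
structure SmoothTensor {ι : Type*} (h : ι → Set.Ioc (0 : ℝ) 1) (M : ι → PolyMap)
    (lam : Pt → Matrix (Fin 2) (Fin 2) ℝ) (p : ℕ) : Prop where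
  scaled : ∀ a b, Scaled h (2 * p + 1) 0 fun i ξ => lam ((M i).toFun ξ) a b
  symm : ∀ i, ∀ ξ ∈ refTriangle, ∀ a b, lam ((M i).toFun ξ) a b = lam ((M i).toFun ξ) b a

namespace ElemFamily

variable {ι : Type*} {h : ι → Set.Ioc (0 : ℝ) 1} {M : ι → PolyMap} {np nf p : ℕ}
  {op : RefOperator np nf} {e e₁ e₂ N : ℕ} {lam : Pt → Matrix (Fin 2) (Fin 2) ℝ}
  {u ψ : ι → Pt → ℝ} {g fl gψ flψ : Fin 2 → ι → Pt → ℝ} {dfl dflψ : Fin 2 → Fin 2 → ι → Pt → ℝ}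

theorem bigOh_facetJac (hM : ElemFamily h M) {ξ : Pt} (hξ : ξ ∈ refTriangle) (f : Fin 3) :
    BigOh h 1 fun i => (M i).facetJac f ξ := by
  have h1 : ∀ d, BigOh h 1 fun i => ∑ b, (M i).cof d b ξ * refNormal f b := fun d =>
    BigOh.sum fun b _ => (((hM.cof 0 d b).bigOh hξ).const_mul (refNormal f b)).congr
      fun i => mul_comm _ _
  obtain ⟨C, hC⟩ := h1 0
  obtain ⟨C', hC'⟩ := h1 1
  refine ⟨C + C', fun i => ?_⟩
  have h2 := (M i).facetJac_sq f ξ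
  rw [Fin.sum_univ_two] at h2
  have h3 := hC i
  have h4 := hC' i
  have h5 : 0 ≤ (M i).facetJac f ξ := Real.sqrt_nonneg _
  rw [abs_of_nonneg h5, add_mul]
  refine le_trans ?_ (add_le_add h3 h4)
  refine abs_le_of_sq_le_sq' ?_ (by positivity) |>.2
  rw [h2, ← sq_abs (∑ b, (M i).cof 0 b ξ * refNormal f b),
    ← sq_abs (∑ b, (M i).cof 1 b ξ * refNormal f b)]
  nlinarith [mul_nonneg (abs_nonneg (∑ b, (M i).cof 0 b ξ * refNormal f b))
    (abs_nonneg (∑ b, (M i).cof 1 b ξ * refNormal f b))]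

/-- In `jac_sq_le` the Jacobian is at least of order `h ^ 2` and the metric at most of order `h`. -/
theorem facetJac_lower (hM : ElemFamily h M) :
    ∃ c : ℝ, 0 < c ∧ ∀ i, ∀ ξ ∈ refTriangle, ∀ f, c * (h i : ℝ) ≤ (M i).facetJac f ξ := by
  obtain ⟨c, hc, hJ⟩ := hM.jac_lower
  choose K hK0 hK using fun a b => (hM.metric 0 a b).exists_nonneg
  set S : ℝ := ∑ a, ∑ b, K a b ^ 2 + 1 with hS
  have hS0 : 0 < S := by positivity
  refine ⟨c / √S, by positivity, fun i ξ hξ f => ?_⟩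
  have hh := (h i).2.1
  have h1 := (M i).jac_sq_le f ξ
  have h2 : ∑ a, ∑ b, (M i).metric a b ξ ^ 2 ≤ S * (h i : ℝ) ^ 2 := by
    have : ∀ a b, (M i).metric a b ξ ^ 2 ≤ K a b ^ 2 * (h i : ℝ) ^ 2 := by
      intro a b
      have := hK a b i 0 le_rfl ξ hξ
      rw [norm_iteratedFDerivWithin_zero, add_zero, pow_one, Real.norm_eq_abs] at this
      rw [← mul_pow, ← sq_abs]
      exact pow_le_pow_left₀ (abs_nonneg _) this 2
    calc _ ≤ ∑ a, ∑ b, K a b ^ 2 * (h i : ℝ) ^ 2 :=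
          Finset.sum_le_sum fun a _ => Finset.sum_le_sum fun b _ => this a b
      _ = (∑ a, ∑ b, K a b ^ 2) * (h i : ℝ) ^ 2 := by simp only [Finset.sum_mul]
      _ ≤ _ := mul_le_mul_of_nonneg_right (by rw [hS]; linarith) (by positivity)
  have h3 : (c * (h i : ℝ) ^ 2) ^ 2 ≤ S * (h i : ℝ) ^ 2 * (M i).facetJac f ξ ^ 2 :=
    (pow_le_pow_left₀ (by positivity) (hJ i ξ hξ) 2).trans
      (h1.trans (mul_le_mul_of_nonneg_right h2 (by positivity)))
  have h4 : 0 ≤ (M i).facetJac f ξ := Real.sqrt_nonneg _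
  have h5 : (c * (h i : ℝ)) ^ 2 ≤ S * (M i).facetJac f ξ ^ 2 := by
    have : (c * (h i : ℝ)) ^ 2 * (h i : ℝ) ^ 2 ≤ S * (M i).facetJac f ξ ^ 2 * (h i : ℝ) ^ 2 := by
      nlinarith
    exact le_of_mul_le_mul_right this (by positivity)
  rw [div_mul_eq_mul_div, div_le_iff₀ (Real.sqrt_pos.2 hS0)]
  refine abs_le_of_sq_le_sq' ?_ (by positivity) |>.2
  rw [mul_pow _ (√S), Real.sq_sqrt hS0.le]
  linarith

theorem bigOh_normal (hM : ElemFamily h M) {ξ : Pt} (hξ : ξ ∈ refTriangle) (f : Fin 3)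
    (d : Fin 2) : BigOh h 0 fun i => (M i).normal f d ξ := by
  refine ⟨1, fun i => ?_⟩
  have h1 := (M i).normal_sq ((M i).facetJac_pos (f := f) (hM.jac_pos i ξ hξ)).ne'
  rw [pow_zero, mul_one, ← sq_le_one_iff_abs_le_one]
  fin_cases d
  · simp only [Fin.zero_eta]; nlinarith [sq_nonneg ((M i).normal f 1 ξ)]
  · simp only [Fin.mk_one]; nlinarith [sq_nonneg ((M i).normal f 0 ξ)]

theorem bigOh_B_mulVec (hM : ElemFamily h M) (hop : op.IsSBP p) (f : Fin 3)
    {x : ι → Fin nf → ℝ} (hx : ∀ l, BigOh h e fun i => x i l) (l : Fin nf) :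
    BigOh h (e + 1) fun i => ((M i).B op f *ᵥ x i) l := by
  refine ((((hM.bigOh_facetJac (hop.facetPt_mem f l) f).mul (hx l)).const_mul
    (op.Bhat f l)).mono (e₂ := e + 1) (by omega)).congr fun i => ?_
  rw [PolyMap.B_mulVec]
  ring

theorem bigOh_Dn_transpose (hM : ElemFamily h M) (hop : op.IsSBP p)
    (hlam : SmoothTensor h M lam p) (f : Fin 3) {y : ι → Fin nf → ℝ}
    (hy : ∀ l, BigOh h (e + 1) fun i => y i l) (j : Fin np) :
    BigOh h e fun i => (((M i).Dn op lam f)ᵀ *ᵥ y i) j := by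
  simp only [PolyMap.Dn, Matrix.transpose_sum, Matrix.sum_mulVec, Finset.sum_apply,
    Matrix.transpose_mul, ← Matrix.mulVec_mulVec]
  refine BigOh.sum fun a _ => BigOh.sum fun b _ => hM.bigOh_D_transpose hop b (fun k => ?_) j
  simp only [PolyMap.Lam, Matrix.diagonal_transpose, Matrix.mulVec_diagonal, PolyMap.N]
  have h1 := ((hlam.scaled a b).bigOh (hop.node_mem k)).mul
    (BigOh.const_mulVec (h := h) (op.R f)ᵀ k fun l => BigOh.congr
      ((hM.bigOh_normal (hop.facetPt_mem f l) f a).mul (hy l))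
      (Y := fun i => (diagonal (fun l => (M i).normal f a (op.facetPt f l)) *ᵥ y i) l)
      fun i => by rw [Matrix.mulVec_diagonal])
  exact h1.mono (by omega)

/-- The error splits into the extrapolation error of the exact flux, of order `p + 1`, and the error
of the discrete gradient, of order `p`, which the bounded normals, extrapolation and diffusivity
preserve. -/
theorem Dn_approx (hM : ElemFamily h M) (hop : op.IsSBP p) (hlam : SmoothTensor h M lam p)
    (hu : SmoothFamily h M lam p u g fl dfl) (hp : 1 ≤ p) (f : Fin 3) (l : Fin nf) :
    BigOh h p fun i => ((M i).Dn op lam f *ᵥ op.nodal (u i)) l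
      - ∑ a, (M i).normal f a (op.facetPt f l) * fl a i (op.facetPt f l) := by
  have h1 : ∀ a, BigOh h p fun i => (M i).normal f a (op.facetPt f l) *
      ((op.R f *ᵥ op.nodal (fl a i)) l - fl a i (op.facetPt f l)) := fun a =>
    ((hM.bigOh_normal (hop.facetPt_mem f l) f a).mul
      (hop.R_approx ((hu.scaled_flux a).of_le (by omega)) f l)).mono (by omega)
  have h2 : ∀ a b, BigOh h p fun i => (M i).normal f a (op.facetPt f l) *
      (op.R f *ᵥ fun j => lam ((M i).toFun (op.node j)) a b *
        (((M i).D op b *ᵥ op.nodal (u i)) j - g b i (op.node j))) l := fun a b =>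
    ((hM.bigOh_normal (hop.facetPt_mem f l) f a).mul (BigOh.const_mulVec (op.R f) l fun j =>
      ((hlam.scaled a b).bigOh (hop.node_mem j)).mul
        (hM.D_approx hop (hu.scaled.of_le (by omega)) hu.grad b j))).mono (by omega)
  refine BigOh.congr (BigOh.sum (s := Finset.univ) fun a _ => (h1 a).add
    (BigOh.sum (s := Finset.univ) fun b _ => h2 a b)) fun i => ?_
  rw [PolyMap.Dn_mulVec, ← Finset.sum_sub_distrib]
  refine Finset.sum_congr rfl fun a _ => ?_
  have h3 : op.nodal (fl a i) = ∑ b, fun j => lam ((M i).toFun (op.node j)) a b *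
      g b i (op.node j) := by
    funext j
    rw [Finset.sum_apply]
    exact hu.flux_eq a i _ (hop.node_mem j)
  rw [h3, Matrix.mulVec_sum, Finset.sum_apply, mul_sub, Finset.mul_sum, sub_add_eq_add_sub,
    ← Finset.sum_add_distrib]
  congr 1
  refine Finset.sum_congr rfl fun b _ => ?_
  rw [← mul_add, ← Pi.add_apply, ← Matrix.mulVec_add]
  congr 3
  funext j
  simp only [Pi.add_apply, PolyMap.pnode]
  ring

/-- The outer derivative is accurate on the exact flux, and it loses one order on the gradient error
of order `p`. -/
theorem D2_approx (hM : ElemFamily h M) (hop : op.IsSBP p) (hlam : SmoothTensor h M lam p)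
    (hu : SmoothFamily h M lam p u g fl dfl) (hp : 1 ≤ p) (j : Fin np) :
    BigOh h (p - 1) fun i => ((M i).D2 op lam *ᵥ op.nodal (u i)) j
      - ∑ a, dfl a a i (op.node j) := by
  have h1 : ∀ a, BigOh h (p - 1) fun i =>
      ((M i).D op a *ᵥ op.nodal (fl a i)) j - dfl a a i (op.node j) := fun a =>
    (hM.D_approx hop ((hu.scaled_flux a).of_le (by omega)) (hu.flux_grad a) a j).mono (by omega)
  have h2 : ∀ a b, BigOh h (p - 1) fun i => ((M i).D op a *ᵥ fun k =>
      lam ((M i).toFun (op.node k)) a b *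
        (((M i).D op b *ᵥ op.nodal (u i)) k - g b i (op.node k))) j := fun a b =>
    hM.bigOh_D hop a (fun k => (((hlam.scaled a b).bigOh (hop.node_mem k)).mul
        (hM.D_approx hop (hu.scaled.of_le (by omega)) hu.grad b k)).mono (by omega)) j
  refine BigOh.congr (BigOh.sum (s := Finset.univ) fun a _ => (h1 a).add
    (BigOh.sum (s := Finset.univ) fun b _ => h2 a b)) fun i => ?_
  rw [PolyMap.D2_mulVec, ← Finset.sum_sub_distrib]
  refine Finset.sum_congr rfl fun a _ => ?_
  have h3 : op.nodal (fl a i) = ∑ b, fun j => lam ((M i).toFun (op.node j)) a b *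
      g b i (op.node j) := by
    funext j
    rw [Finset.sum_apply]
    exact hu.flux_eq a i _ (hop.node_mem j)
  rw [h3, Matrix.mulVec_sum, Finset.sum_apply, sub_add_eq_add_sub, ← Finset.sum_add_distrib]
  congr 1
  refine Finset.sum_congr rfl fun b _ => ?_
  rw [← Pi.add_apply, ← Matrix.mulVec_add]
  congr 2
  funext j
  simp only [Pi.add_apply, PolyMap.pnode]
  ring

/-- The quadratures satisfy the divergence theorem on the physical elements, up to terms of order
`2p + 2`. -/
theorem div_approx (hM : ElemFamily h M) (hop : op.IsSBP p) {v : Fin 2 → ι → Pt → ℝ}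
    {dv : Fin 2 → Fin 2 → ι → Pt → ℝ} (hv : ∀ a, Scaled h (2 * p + 1) 0 (v a))
    (hdv : ∀ a, IsGrad M (v a) (dv a)) :
    BigOh h (2 * p + 2) fun i => ∑ j, (M i).H op j * ∑ a, dv a a i (op.node j)
      - ∑ f, ∑ l, ∑ a, (M i).bn op f a l * v a i (op.facetPt f l) := by
  refine BigOh.congr (BigOh.sum (s := Finset.univ) fun a _ => BigOh.sum (s := Finset.univ)
    fun b _ => (hop.div_approx (hM.mul_cof (hv a) a b) b).mono (e₂ := 2 * p + 2) (by omega))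
    fun i => ?_
  have h1 : ∀ a, DifferentiableOn ℝ (v a i) refTriangle := fun a =>
    ((hv a).contDiffOn i).differentiableOn (by norm_cast)
  have h2 : ∀ a, ∑ b, ∑ j, op.H j * pd refTriangle (fun ξ => (M i).cof a b ξ * v a i ξ) b
      (op.node j) = ∑ j, (M i).H op j * dv a a i (op.node j) := by
    intro a
    rw [Finset.sum_comm]
    refine Finset.sum_congr rfl fun j _ => ?_
    rw [← Finset.mul_sum, sum_pd_cof_mul (hdv a) (fun i =>
      ((hv a).contDiffOn i).differentiableOn (by norm_cast)) a i (hop.node_mem j), PolyMap.H]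
    ring
  simp only [Finset.sum_sub_distrib, h2]
  congr 1
  · rw [Finset.sum_comm]
    simp only [Finset.mul_sum]
  · have h3 : ∀ a, ∑ b, ∑ f, ∑ l, op.Bhat f l * refNormal f b *
        ((M i).cof a b (op.facetPt f l) * v a i (op.facetPt f l))
        = ∑ f, ∑ l, (M i).bn op f a l * v a i (op.facetPt f l) := by
      intro a
      rw [Finset.sum_comm]
      refine Finset.sum_congr rfl fun f _ => ?_
      rw [Finset.sum_comm]
      refine Finset.sum_congr rfl fun l _ => ?_
      rw [PolyMap.bn, Finset.mul_sum, Finset.sum_mul]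
      exact Finset.sum_congr rfl fun b _ => by ring
    simp only [h3]
    rw [Finset.sum_comm]
    refine Finset.sum_congr rfl fun f _ => ?_
    rw [Finset.sum_comm]

end ElemFamily

/-- Values of a function at the nodes of a reference facet. -/
noncomputable def RefOperator.facetNodal {np nf : ℕ} (op : RefOperator np nf) (f : Fin 3)
    (φ : Pt → ℝ) : Fin nf → ℝ := fun l => φ (op.facetPt f l)

/-- Normal component of a (pulled back) vector field at the nodes of a facet. -/
noncomputable def PolyMap.normalComp (M : PolyMap) {np nf : ℕ} (op : RefOperator np nf) (f : Fin 3)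
    (v : Fin 2 → Pt → ℝ) : Fin nf → ℝ :=
  fun l => ∑ a, M.normal f a (op.facetPt f l) * v a (op.facetPt f l)

theorem PolyMap.sum_bn_mul (M : PolyMap) {np nf p : ℕ} {op : RefOperator np nf}
    (hJ : ∀ ξ ∈ refTriangle, 0 < M.jac ξ) (hop : op.IsSBP p) (v : Fin 2 → Pt → ℝ)
    (x : Fin 3 → Fin nf → ℝ) :
    ∑ a, ∑ f, ∑ l, M.bn op f a l * v a (op.facetPt f l) * x f l
      = ∑ f, M.normalComp op f v ⬝ᵥ (M.B op f *ᵥ x f) := by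
  rw [Finset.sum_comm]
  refine Finset.sum_congr rfl fun f _ => ?_
  rw [Finset.sum_comm]
  refine Finset.sum_congr rfl fun l _ => ?_
  rw [B_mulVec, normalComp, Finset.sum_mul]
  refine Finset.sum_congr rfl fun a _ => ?_
  rw [← M.facetJac_mul_Bhat_mul_normal (hJ _ (hop.facetPt_mem f l))]
  ring

theorem IsGrad.mul {ι : Type*} {M : ι → PolyMap} {u v : ι → Pt → ℝ} {gu gv : Fin 2 → ι → Pt → ℝ}
    (hgu : IsGrad M u gu) (hgv : IsGrad M v gv) (hu : ∀ i, DifferentiableOn ℝ (u i) refTriangle)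
    (hv : ∀ i, DifferentiableOn ℝ (v i) refTriangle) :
    IsGrad M (fun i ξ => u i ξ * v i ξ) fun d i ξ => u i ξ * gv d i ξ + v i ξ * gu d i ξ := by
  intro i ξ hξ b
  rw [pd_mul (hu i ξ hξ) (hv i ξ hξ) hξ, hgu i ξ hξ, hgv i ξ hξ, Finset.mul_sum, Finset.mul_sum,
    ← Finset.sum_add_distrib]
  exact Finset.sum_congr rfl fun d _ => by ring

/-! ### Superconvergence of the discrete energy -/

namespace ElemFamily

variable {ι : Type*} {h : ι → Set.Ioc (0 : ℝ) 1} {M : ι → PolyMap} {np nf p : ℕ}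
  {op : RefOperator np nf} {lam : Pt → Matrix (Fin 2) (Fin 2) ℝ}
  {u ψ : ι → Pt → ℝ} {g fl gψ flψ : Fin 2 → ι → Pt → ℝ} {dfl dflψ : Fin 2 → Fin 2 → ι → Pt → ℝ}

/-- Superconvergence of the discrete energy inner product of two smooth functions. -/
theorem energy_approx (hM : ElemFamily h M) (hop : op.IsSBP p) (hlam : SmoothTensor h M lam p)
    (hu : SmoothFamily h M lam p u g fl dfl) (hψ : SmoothFamily h M lam p ψ gψ flψ dflψ)
    (hp : 1 ≤ p) :
    BigOh h (2 * p + 2) fun i => (M i).energy op lam (op.nodal (ψ i)) (op.nodal (u i))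
      + ∑ j, (M i).H op j * (ψ i (op.node j) * ∑ a, dfl a a i (op.node j))
      - ∑ f, (op.facetNodal f (ψ i) ⬝ᵥ ((M i).B op f *ᵥ (M i).normalComp op f fun a => fl a i)
        + ((M i).normalComp op f fun a => flψ a i) ⬝ᵥ ((M i).B op f *ᵥ
          (op.R f *ᵥ op.nodal (u i) - op.facetNodal f (u i)))
        + ((M i).normalComp op f fun a => fl a i) ⬝ᵥ ((M i).B op f *ᵥ
          (op.R f *ᵥ op.nodal (ψ i) - op.facetNodal f (ψ i)))) := by
  -- Each discrete gradient is the exact one plus an error of order `p`. The product of both errors,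
  -- weighted by `H`, has order `2 * p + 2`. The mixed terms pair an error with an exact flux (by
  -- symmetry of the tensor) and are superconvergent. The exact gradients, together with the added
  -- volume term, form the divergence of `ψ` times the flux of `u`.
  have hδu := fun b j => hM.D_approx hop (hu.scaled.of_le (by omega)) hu.grad b j
  have hδψ := fun b j => hM.D_approx hop (hψ.scaled.of_le (by omega)) hψ.grad b j
  have h1 : ∀ a b, BigOh h (2 * p + 2) fun i => ∑ j, (M i).H op j *
      ((((M i).D op a *ᵥ op.nodal (ψ i)) j - gψ a i (op.node j)) *
        (lam ((M i).toFun (op.node j)) a b *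
          (((M i).D op b *ᵥ op.nodal (u i)) j - g b i (op.node j)))) := fun a b =>
    BigOh.sum fun j _ => ((hM.bigOh_H hop j).mul ((hδψ a j).mul
      (((hlam.scaled a b).bigOh (hop.node_mem j)).mul (hδu b j)))).mono (by omega)
  have h2 := fun b => hM.D_superconvergence hop (hψ.scaled_flux b) hu.scaled hu.grad b
  have h3 := fun b => hM.D_superconvergence hop (hu.scaled_flux b) hψ.scaled hψ.grad b
  have hdu : ∀ i, DifferentiableOn ℝ (u i) refTriangle := fun i =>
    (hu.scaled.contDiffOn i).differentiableOn (by norm_cast)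
  have hdψ : ∀ i, DifferentiableOn ℝ (ψ i) refTriangle := fun i =>
    (hψ.scaled.contDiffOn i).differentiableOn (by norm_cast)
  have hdfl : ∀ a i, DifferentiableOn ℝ (fl a i) refTriangle := fun a i =>
    ((hu.scaled_flux a).contDiffOn i).differentiableOn (by norm_cast)
  have h4 := hM.div_approx hop (v := fun a i ξ => ψ i ξ * fl a i ξ)
    (fun a => hψ.scaled.mul (hu.scaled_flux a))
    (fun a => hψ.grad.mul (hu.flux_grad a) hdψ (hdfl a))
  refine BigOh.congr ((((BigOh.sum (s := Finset.univ) fun a _ => BigOh.sum (s := Finset.univ)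
    fun b _ => h1 a b).add (BigOh.sum (s := Finset.univ) fun b _ => h2 b)).add
    (BigOh.sum (s := Finset.univ) fun b _ => h3 b)).add h4) fun i => ?_
  have hJ := hM.jac_pos i
  have s1 := (M i).sum_bn_mul hJ hop (fun a => flψ a i)
    (fun f => op.R f *ᵥ op.nodal (u i) - op.facetNodal f (u i))
  have s2 := (M i).sum_bn_mul hJ hop (fun a => fl a i)
    (fun f => op.R f *ᵥ op.nodal (ψ i) - op.facetNodal f (ψ i))
  have s3 : ∑ f, ∑ l, ∑ a, (M i).bn op f a l * (ψ i (op.facetPt f l) * fl a i (op.facetPt f l))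
      = ∑ f, op.facetNodal f (ψ i) ⬝ᵥ ((M i).B op f *ᵥ (M i).normalComp op f fun a => fl a i) := by
    refine Finset.sum_congr rfl fun f _ => Finset.sum_congr rfl fun l _ => ?_
    rw [PolyMap.B_mulVec, PolyMap.normalComp, Finset.mul_sum, RefOperator.facetNodal,
      Finset.mul_sum]
    refine Finset.sum_congr rfl fun a _ => ?_
    rw [← (M i).facetJac_mul_Bhat_mul_normal (hJ _ (hop.facetPt_mem f l))]
    ring
  simp only [Pi.sub_apply, RefOperator.facetNodal] at s1 s2
  simp only [Finset.sum_sub_distrib (s := (Finset.univ : Finset (Fin 2))), s1, s2, s3]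
  simp only [Finset.sum_add_distrib (s := (Finset.univ : Finset (Fin 3)))]
  have key : (M i).energy op lam (op.nodal (ψ i)) (op.nodal (u i))
      + ∑ j, (M i).H op j * (ψ i (op.node j) * ∑ a, dfl a a i (op.node j))
      = ∑ a, ∑ b, ∑ j, (M i).H op j *
      ((((M i).D op a *ᵥ op.nodal (ψ i)) j - gψ a i (op.node j)) *
        (lam ((M i).toFun (op.node j)) a b *
          (((M i).D op b *ᵥ op.nodal (u i)) j - g b i (op.node j))))
      + ∑ b, ∑ j, (M i).H op j * flψ b i (op.node j) *
          (((M i).D op b *ᵥ op.nodal (u i)) j - g b i (op.node j))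
      + ∑ b, ∑ j, (M i).H op j * fl b i (op.node j) *
          (((M i).D op b *ᵥ op.nodal (ψ i)) j - gψ b i (op.node j))
      + ∑ j, (M i).H op j * ∑ a, (ψ i (op.node j) * dfl a a i (op.node j)
          + fl a i (op.node j) * gψ a i (op.node j)) := by
    simp only [PolyMap.energy, Fin.sum_univ_two, ← Finset.sum_add_distrib]
    refine Finset.sum_congr rfl fun j _ => ?_
    have c0 := hu.flux_eq 0 i _ (hop.node_mem j)
    have c1 := hu.flux_eq 1 i _ (hop.node_mem j)
    have c2 := hψ.flux_eq 0 i _ (hop.node_mem j)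
    have c3 := hψ.flux_eq 1 i _ (hop.node_mem j)
    have c4 := hlam.symm i _ (hop.node_mem j) 1 0
    simp only [Fin.sum_univ_two, c4] at c0 c1 c2 c3
    rw [c0, c1, c2, c3, PolyMap.pnode, c4]
    ring
  rw [key]
  ring

end ElemFamily

/-! ### Reversal of facet vectors -/

section Flip

variable {nf : ℕ}

theorem flip_flip (x : Fin nf → ℝ) : flip (flip x) = x := by
  funext i; simp [flip]

theorem flip_add (x y : Fin nf → ℝ) : flip (x + y) = flip x + flip y := rfl

theorem flip_sub (x y : Fin nf → ℝ) : flip (x - y) = flip x - flip y := rfl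

theorem flip_neg (x : Fin nf → ℝ) : flip (-x) = -flip x := rfl

theorem dotProduct_flip (x y : Fin nf → ℝ) : x ⬝ᵥ flip y = flip x ⬝ᵥ y := by
  simp only [dotProduct, flip]
  rw [← Equiv.sum_comp Fin.revPerm]
  simp

theorem flip_mulVec (A : Matrix (Fin nf) (Fin nf) ℝ) (x : Fin nf → ℝ) :
    flip (A *ᵥ x) = flipMat A *ᵥ flip x := by
  funext i
  simp only [flip, Matrix.mulVec, dotProduct, flipMat, Matrix.submatrix_apply]
  rw [← Equiv.sum_comp Fin.revPerm]
  simp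

theorem flipMat_flipMat (A : Matrix (Fin nf) (Fin nf) ℝ) : flipMat (flipMat A) = A := by
  ext i j; simp [flipMat]

theorem flipMat_add (A B : Matrix (Fin nf) (Fin nf) ℝ) :
    flipMat (A + B) = flipMat A + flipMat B := rfl

theorem flipMat_neg (A : Matrix (Fin nf) (Fin nf) ℝ) : flipMat (-A) = -flipMat A := rfl

end Flip

theorem _root_.Matrix.IsSymm.dotProduct_mulVec_comm {α : Type*} [Fintype α] {A : Matrix α α ℝ}
    (hA : A.IsSymm) (x y : α → ℝ) : x ⬝ᵥ (A *ᵥ y) = y ⬝ᵥ (A *ᵥ x) := by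
  rw [Matrix.dotProduct_mulVec, ← Matrix.mulVec_transpose, hA.eq, dotProduct_comm]

theorem dotProduct_transpose_mulVec {α β : Type*} [Fintype α] [Fintype β] (A : Matrix α β ℝ)
    (x : β → ℝ) (y : α → ℝ) : x ⬝ᵥ (Aᵀ *ᵥ y) = (A *ᵥ x) ⬝ᵥ y := by
  rw [Matrix.dotProduct_mulVec, Matrix.vecMul_transpose]

theorem PolyMap.B_isSymm (M : PolyMap) {np nf : ℕ} (op : RefOperator np nf) (f : Fin 3) :
    (M.B op f).IsSymm := by rw [PolyMap.B]; exact Matrix.isSymm_diagonal _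

/-! ### Sums over the facets of a mesh -/

namespace Mesh

variable {p : ℕ} (m : Mesh p)

/-- Sum over the interior facets, from both sides. -/
noncomputable def intSum (X : Fin m.ne → Fin 3 → Fin m.ne → Fin 3 → ℝ) : ℝ :=
  ∑ k, ∑ f, match m.kind k f with
    | .interior g f' => X k f g f'
    | _ => 0

/-- Sum over the Dirichlet facets. -/
noncomputable def dirSum (X : Fin m.ne → Fin 3 → ℝ) : ℝ :=
  ∑ k, ∑ f, match m.kind k f with
    | .dirichlet => X k f
    | _ => 0

/-- Sum over the Neumann facets. -/
noncomputable def neuSum (X : Fin m.ne → Fin 3 → ℝ) : ℝ :=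
  ∑ k, ∑ f, match m.kind k f with
    | .neumann => X k f
    | _ => 0

theorem intSum_congr {X Y : Fin m.ne → Fin 3 → Fin m.ne → Fin 3 → ℝ}
    (h : ∀ k f g f', m.kind k f = .interior g f' → X k f g f' = Y k f g f') :
    m.intSum X = m.intSum Y := by
  refine Finset.sum_congr rfl fun k _ => Finset.sum_congr rfl fun f _ => ?_
  rcases hk : m.kind k f with ⟨g, f'⟩ | _ | _
  · exact h k f g f' hk
  · rfl
  · rfl

theorem intSum_add (X Y : Fin m.ne → Fin 3 → Fin m.ne → Fin 3 → ℝ) :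
    m.intSum (fun k f g f' => X k f g f' + Y k f g f') = m.intSum X + m.intSum Y := by
  simp only [intSum, ← Finset.sum_add_distrib]
  refine Finset.sum_congr rfl fun k _ => Finset.sum_congr rfl fun f _ => ?_
  rcases m.kind k f with ⟨g, f'⟩ | _ | _ <;> simp

theorem intSum_neg (X : Fin m.ne → Fin 3 → Fin m.ne → Fin 3 → ℝ) :
    m.intSum (fun k f g f' => -X k f g f') = -m.intSum X := by
  simp only [intSum, ← Finset.sum_neg_distrib]
  refine Finset.sum_congr rfl fun k _ => Finset.sum_congr rfl fun f _ => ?_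
  rcases m.kind k f with ⟨g, f'⟩ | _ | _ <;> simp

/-- Written as a sum over pairs of (element, facet) indices that are neighbours, a relation
symmetric by `kind_symm`, the sum allows its two indices to be exchanged. -/
theorem intSum_swap (X : Fin m.ne → Fin 3 → Fin m.ne → Fin 3 → ℝ) :
    m.intSum X = m.intSum fun k f g f' => X g f' k f := by
  classical
  have h1 : ∀ X : Fin m.ne → Fin 3 → Fin m.ne → Fin 3 → ℝ, m.intSum X
      = ∑ a : Fin m.ne × Fin 3, ∑ b : Fin m.ne × Fin 3,
        if m.kind a.1 a.2 = .interior b.1 b.2 then X a.1 a.2 b.1 b.2 else 0 := by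
    intro X
    rw [intSum, Fintype.sum_prod_type]
    refine Finset.sum_congr rfl fun k _ => Finset.sum_congr rfl fun f _ => ?_
    rcases hk : m.kind k f with ⟨g, f'⟩ | _ | _
    · rw [Finset.sum_eq_single (g, f')]
      · simp
      · intro b _ hb
        rw [if_neg]
        intro h
        injection h with h1 h2
        exact hb (Prod.ext h1.symm h2.symm)
      · simp
    · simp
    · simp
  rw [h1, h1, Finset.sum_comm]
  refine Finset.sum_congr rfl fun a _ => Finset.sum_congr rfl fun b _ => ?_
  have h2 : m.kind b.1 b.2 = .interior a.1 a.2 ↔ m.kind a.1 a.2 = .interior b.1 b.2 :=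
    ⟨m.kind_symm _ _ _ _, m.kind_symm _ _ _ _⟩
  simp only [h2]

/-- Averaging the two sides of each facet is the device by which the coefficient relations, which
couple both sides, enter. -/
theorem intSum_eq_half (X : Fin m.ne → Fin 3 → Fin m.ne → Fin 3 → ℝ) :
    m.intSum X = (1 / 2) * m.intSum fun k f g f' => X k f g f' + X g f' k f := by
  rw [intSum_add, ← intSum_swap]
  ring

theorem sum_facets (X : Fin m.ne → Fin 3 → ℝ) :
    ∑ k, ∑ f, X k f = m.intSum (fun k f _ _ => X k f) + m.dirSum X + m.neuSum X := by
  simp only [intSum, dirSum, neuSum, ← Finset.sum_add_distrib]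
  refine Finset.sum_congr rfl fun k _ => Finset.sum_congr rfl fun f _ => ?_
  rcases m.kind k f with ⟨g, f'⟩ | _ | _ <;> simp

theorem dirSum_add (X Y : Fin m.ne → Fin 3 → ℝ) :
    m.dirSum (fun k f => X k f + Y k f) = m.dirSum X + m.dirSum Y := by
  simp only [dirSum, ← Finset.sum_add_distrib]
  refine Finset.sum_congr rfl fun k _ => Finset.sum_congr rfl fun f _ => ?_
  rcases m.kind k f with ⟨g, f'⟩ | _ | _ <;> simp

theorem dirSum_neg (X : Fin m.ne → Fin 3 → ℝ) :
    m.dirSum (fun k f => -X k f) = -m.dirSum X := by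
  simp only [dirSum, ← Finset.sum_neg_distrib]
  refine Finset.sum_congr rfl fun k _ => Finset.sum_congr rfl fun f _ => ?_
  rcases m.kind k f with ⟨g, f'⟩ | _ | _ <;> simp

theorem neuSum_add (X Y : Fin m.ne → Fin 3 → ℝ) :
    m.neuSum (fun k f => X k f + Y k f) = m.neuSum X + m.neuSum Y := by
  simp only [neuSum, ← Finset.sum_add_distrib]
  refine Finset.sum_congr rfl fun k _ => Finset.sum_congr rfl fun f _ => ?_
  rcases m.kind k f with ⟨g, f'⟩ | _ | _ <;> simp

theorem neuSum_neg (X : Fin m.ne → Fin 3 → ℝ) :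
    m.neuSum (fun k f => -X k f) = -m.neuSum X := by
  simp only [neuSum, ← Finset.sum_neg_distrib]
  refine Finset.sum_congr rfl fun k _ => Finset.sum_congr rfl fun f _ => ?_
  rcases m.kind k f with ⟨g, f'⟩ | _ | _ <;> simp

end Mesh

/-! ### The bilinear form of the discretization -/

/-- Discrete first Green identity, obtained from summation by parts in the outer derivative alone.
-/
theorem PolyMap.dotProduct_H_D2 (M : PolyMap) {np nf p : ℕ} {op : RefOperator np nf}
    (hJ : ∀ ξ ∈ refTriangle, 0 < M.jac ξ) (hop : op.IsSBP p)
    (lam : Pt → Matrix (Fin 2) (Fin 2) ℝ) (v w : Fin np → ℝ) :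
    ∑ j, v j * (M.H op j * (M.D2 op lam *ᵥ w) j)
      = ∑ f, (op.R f *ᵥ v) ⬝ᵥ (M.B op f *ᵥ (M.Dn op lam f *ᵥ w)) - M.energy op lam v w := by
  have h1 : ∀ a (y : Fin np → ℝ), ∑ j, v j * (M.H op j * (M.D op a *ᵥ y) j)
      = ∑ f, (op.R f *ᵥ v) ⬝ᵥ (M.B op f *ᵥ (M.N op f a *ᵥ (op.R f *ᵥ y)))
        - ∑ j, M.H op j * (M.D op a *ᵥ v) j * y j := by
    intro a y
    have h2 := M.stiff_sum_by_parts a (op := op) v y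
    rw [M.dotProduct_E_mulVec] at h2
    simp only [M.H_mul_D_mulVec hJ hop]
    rw [← h2]
    simp only [dotProduct]
    ring
  have h3 : ∀ j, v j * (M.H op j * (M.D2 op lam *ᵥ w) j) = ∑ a, ∑ b, v j * (M.H op j *
      (M.D op a *ᵥ fun j => lam (M.pnode op j) a b * (M.D op b *ᵥ w) j) j) := by
    intro j
    rw [M.D2_mulVec]
    simp only [Finset.mul_sum]
  simp only [h3]
  rw [Finset.sum_comm]
  have h4 : ∀ f, (op.R f *ᵥ v) ⬝ᵥ (M.B op f *ᵥ (M.Dn op lam f *ᵥ w)) = ∑ a, ∑ b,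
      (op.R f *ᵥ v) ⬝ᵥ (M.B op f *ᵥ (M.N op f a *ᵥ (op.R f *ᵥ
        fun j => lam (M.pnode op j) a b * (M.D op b *ᵥ w) j))) := by
    intro f
    simp only [Dn, Matrix.sum_mulVec, ← Matrix.mulVec_mulVec, M.Lam_mulVec, Matrix.mulVec_sum,
      dotProduct_sum]
  simp only [h4]
  unfold PolyMap.energy
  refine Eq.trans ?_ (congrArg₂ (· - ·) Finset.sum_comm rfl)
  rw [← Finset.sum_sub_distrib]
  refine Finset.sum_congr rfl fun a _ => ?_
  rw [Finset.sum_comm]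
  refine Eq.trans ?_ (congrArg₂ (· - ·) Finset.sum_comm rfl)
  rw [← Finset.sum_sub_distrib]
  refine Finset.sum_congr rfl fun b _ => ?_
  rw [h1]
  congr 1
  exact Finset.sum_congr rfl fun j _ => by ring

theorem PolyMap.energy_comm (M : PolyMap) {np nf : ℕ} {op : RefOperator np nf}
    {lam : Pt → Matrix (Fin 2) (Fin 2) ℝ}
    (hs : ∀ j a b, lam (M.pnode op j) a b = lam (M.pnode op j) b a) (v w : Fin np → ℝ) :
    M.energy op lam v w = M.energy op lam w v := by
  rw [energy, Finset.sum_comm]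
  refine Finset.sum_congr rfl fun a _ => Finset.sum_congr rfl fun b _ =>
    Finset.sum_congr rfl fun j _ => ?_
  rw [hs j b a]
  ring

section Form

variable {p np nf : ℕ} (op : RefOperator np nf) (Ω : Set Pt)
  (lam : Pt → Matrix (Fin 2) (Fin 2) ℝ) (m : Mesh p) (T : SATCoeffs m.ne nf)

/-- Sum of the conormal derivatives from the two sides of an interior facet. -/
noncomputable def dsum (v : m.GridFun np) (k : Fin m.ne) (f : Fin 3) (g : Fin m.ne) (f' : Fin 3) :
    Fin nf → ℝ := dn op lam m v k f + flip (dn op lam m v g f')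

/-- The contribution of an interior facet to the bilinear form. -/
noncomputable def facetForm (v w : m.GridFun np) (k : Fin m.ne) (f : Fin 3) (g : Fin m.ne)
    (f' : Fin 3) : ℝ :=
  jump op m v k f ⬝ᵥ (T.T1 k f *ᵥ jump op m w k f)
    + jump op m v k f ⬝ᵥ (T.T3 k f *ᵥ dsum op lam m w k f g f')
    + dsum op lam m v k f g f' ⬝ᵥ (T.T2 k f *ᵥ jump op m w k f)
    + dsum op lam m v k f g f' ⬝ᵥ (T.T4 k f *ᵥ dsum op lam m w k f g f')
    - jump op m v k f ⬝ᵥ ((m.map k).B op f *ᵥ dn op lam m w k f)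
    + flip (dn op lam m v g f') ⬝ᵥ ((m.map k).B op f *ᵥ jump op m w k f)

/-- The wide-stencil contribution of an element to the bilinear form. -/
noncomputable def wideForm (v w : m.GridFun np) (k : Fin m.ne) (f : Fin 3) : ℝ :=
  ∑ e ∈ Finset.univ.erase f, jump op m v k f ⬝ᵥ (T.T5 k f e *ᵥ jump op m w k e)

/-- The bilinear form of the discretization. -/
noncomputable def discreteForm (v w : m.GridFun np) : ℝ :=
  ∑ k, (m.map k).energy op lam (v k) (w k)
    + (1 / 2) * m.intSum (facetForm op lam m T v w)
    + ∑ k, ∑ f, wideForm op m T v w k f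
    + m.dirSum fun k f => tr op m v k f ⬝ᵥ (T.TD k f *ᵥ tr op m w k f)
      - tr op m v k f ⬝ᵥ ((m.map k).B op f *ᵥ dn op lam m w k f)
      - dn op lam m v k f ⬝ᵥ ((m.map k).B op f *ᵥ tr op m w k f)

/-- The linear form of the boundary data of the function `U`. -/
noncomputable def dataForm (U : Pt → ℝ) (v : m.GridFun np) : ℝ :=
  (m.dirSum fun k f => tr op m v k f ⬝ᵥ (T.TD k f *ᵥ m.facetRestrict op U k f)
      - dn op lam m v k f ⬝ᵥ ((m.map k).B op f *ᵥ m.facetRestrict op U k f))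
    + m.neuSum fun k f => tr op m v k f ⬝ᵥ ((m.map k).B op f *ᵥ m.fluxRestrict op Ω lam U k f)

variable {op lam m T}

theorem jump_eq {k : Fin m.ne} {f : Fin 3} {g : Fin m.ne} {f' : Fin 3}
    (hk : m.kind k f = .interior g f') (v : m.GridFun np) :
    jump op m v k f = tr op m v k f - flip (tr op m v g f') := by
  rw [jump, hk]

theorem jump_symm {k : Fin m.ne} {f : Fin 3} {g : Fin m.ne} {f' : Fin 3}
    (hk : m.kind k f = .interior g f') (v : m.GridFun np) :
    jump op m v g f' = -flip (jump op m v k f) := by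
  rw [jump_eq hk, jump_eq (m.kind_symm _ _ _ _ hk), flip_sub, flip_flip, neg_sub]

theorem flip_dsum (v : m.GridFun np) (k : Fin m.ne) (f : Fin 3) (g : Fin m.ne) (f' : Fin 3) :
    flip (dsum op lam m v k f g f') = dsum op lam m v g f' k f := by
  rw [dsum, dsum, flip_add, flip_flip, add_comm]

/-- The left side of the `T3` relation is invariant under exchange of the two elements, so equality
of the two weight matrices can be read off without any geometry. -/
theorem flipMat_B_eq (hT : T.IsAdjointConsistent op m) {k : Fin m.ne} {f : Fin 3} {g : Fin m.ne}
    {f' : Fin 3} (hk : m.kind k f = .interior g f') :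
    flipMat ((m.map g).B op f') = (m.map k).B op f := by
  rw [← hT.T3_add k f g f' hk, ← hT.T3_add g f' k f (m.kind_symm _ _ _ _ hk), flipMat_add,
    flipMat_flipMat, add_comm]

theorem dotProduct_mulVec_flip (A : Matrix (Fin nf) (Fin nf) ℝ) (x y : Fin nf → ℝ) :
    x ⬝ᵥ (A *ᵥ y) = flip x ⬝ᵥ (flipMat A *ᵥ flip y) := by
  rw [← flip_mulVec, dotProduct_flip, flip_flip]

theorem dotProduct_satI (v w : m.GridFun np) :
    ∑ k, v k ⬝ᵥ satI op lam m T w k = m.intSum fun k f g f' =>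
      (tr op m v k f ⬝ᵥ (T.T1 k f *ᵥ jump op m w k f)
        + tr op m v k f ⬝ᵥ (T.T3 k f *ᵥ dsum op lam m w k f g f')
        + dn op lam m v k f ⬝ᵥ (T.T2 k f *ᵥ jump op m w k f)
        + dn op lam m v k f ⬝ᵥ (T.T4 k f *ᵥ dsum op lam m w k f g f'))
      + (∑ e ∈ Finset.univ.erase f, tr op m v k f ⬝ᵥ (T.T5 k f e *ᵥ jump op m w k e)
        + ∑ d ∈ Finset.univ.erase f', flip (tr op m v k f) ⬝ᵥ (T.T6 g f' d *ᵥ jump op m w g d)) := by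
  refine Finset.sum_congr rfl fun k _ => ?_
  rw [satI, dotProduct_sum]
  refine Finset.sum_congr rfl fun f _ => ?_
  rcases hk : m.kind k f with ⟨g, f'⟩ | _ | _
  · simp only [dotProduct_add, dotProduct_sum, dotProduct_transpose_mulVec, dotProduct_flip, dsum]
    simp only [tr, dn]
    ring
  · simp
  · simp

/-- `T6 = -T5` merges the two one-sided traces into a jump, so the adjoint has the same wide-stencil
coupling as the primal scheme. -/
theorem wideAdjoint_eq (hT : T.IsAdjointConsistent op m) (v : m.GridFun np) (k : Fin m.ne)
    (f e : Fin 3) : wideAdjoint op m T v k f e = T.T5 k f e *ᵥ jump op m v k e := by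
  rw [wideAdjoint, jump]
  rcases hk : m.kind k e with ⟨g, e'⟩ | _ | _
  · have h6 : T.T6 k f e = -T.T5 k f e := by rw [hT.T5_eq, neg_neg]
    simp only [h6, Matrix.neg_mulVec]
    rw [Matrix.mulVec_sub, sub_eq_add_neg]
  · simp
  · simp

theorem dotProduct_adjSatI (hT : T.IsAdjointConsistent op m) (v w : m.GridFun np) :
    ∑ k, w k ⬝ᵥ adjSatI op lam m T v k = m.intSum fun k f g f' =>
      (tr op m w k f ⬝ᵥ (T.T1 k f *ᵥ jump op m v k f)
        + tr op m w k f ⬝ᵥ ((T.T2 k f + (m.map k).B op f) *ᵥ dsum op lam m v k f g f')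
        + dn op lam m w k f ⬝ᵥ ((T.T3 k f - (m.map k).B op f) *ᵥ jump op m v k f)
        + dn op lam m w k f ⬝ᵥ (T.T4 k f *ᵥ dsum op lam m v k f g f'))
      + (∑ e ∈ Finset.univ.erase f, tr op m w k f ⬝ᵥ (T.T5 k f e *ᵥ jump op m v k e)
        - ∑ d ∈ Finset.univ.erase f', flip (tr op m w k f) ⬝ᵥ (T.T5 g f' d *ᵥ jump op m v g d)) := by
  refine Finset.sum_congr rfl fun k _ => ?_
  rw [adjSatI, dotProduct_sum]
  refine Finset.sum_congr rfl fun f _ => ?_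
  rcases hk : m.kind k f with ⟨g, f'⟩ | _ | _
  · have t1 : flipMat (T.T1 g f') = T.T1 k f := (hT.T1_eq k f g f' hk).symm
    have t2 : flipMat (T.T2 g f') = -(T.T2 k f + (m.map k).B op f) := by
      rw [neg_add_rev, ← hT.T2_add k f g f' hk]; abel
    have t3 : flipMat (T.T3 g f') = -(T.T3 k f - (m.map k).B op f) := by
      rw [← hT.T3_add k f g f' hk]; abel
    have t4 : flipMat (T.T4 g f') = T.T4 k f := (hT.T4_eq k f g f' hk).symm
    simp only [flip_mulVec, t1, t2, t3, t4, wideAdjoint_eq hT, jump_eq hk, dsum,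
      Matrix.mulVec_sub, Matrix.mulVec_add, Matrix.neg_mulVec, dotProduct_add, dotProduct_sub,
      dotProduct_neg, dotProduct_sum, dotProduct_transpose_mulVec]
    have h5 : ∀ d, (op.R f *ᵥ w k) ⬝ᵥ (flipMat (T.T5 g f' d) *ᵥ flip (jump op m v g d))
        = flip (op.R f *ᵥ w k) ⬝ᵥ (T.T5 g f' d *ᵥ jump op m v g d) := by
      intro d
      rw [← flip_mulVec, dotProduct_flip]
    simp only [h5, tr, dn]
    ring
  · simp
  · simp

/-- After exchange of the two sides, the terms coming from the neighbour's facets supply the other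
half of the jump of `v`. Boundary facets drop out because the jump is zero there. -/
theorem wide_sum (v w : m.GridFun np) :
    (m.intSum fun k f g f' =>
      ∑ e ∈ Finset.univ.erase f, tr op m v k f ⬝ᵥ (T.T5 k f e *ᵥ jump op m w k e)
        - ∑ d ∈ Finset.univ.erase f', flip (tr op m v k f) ⬝ᵥ (T.T5 g f' d *ᵥ jump op m w g d))
      = ∑ k, ∑ f, wideForm op m T v w k f := by
  simp only [sub_eq_add_neg]
  rw [Mesh.intSum_add, Mesh.intSum_swap m fun k f g f' => -∑ d ∈ Finset.univ.erase f', _,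
    ← Mesh.intSum_add]
  refine Finset.sum_congr rfl fun k _ => Finset.sum_congr rfl fun f _ => ?_
  rw [wideForm]
  rcases hk : m.kind k f with ⟨g, f'⟩ | _ | _
  · simp only [jump_eq hk, sub_dotProduct, Finset.sum_sub_distrib]
    rw [sub_eq_add_neg]
  · simp [jump, hk]
  · simp [jump, hk]

theorem wideForm_symm (hs : T.IsSymmetric) (v w : m.GridFun np) (k : Fin m.ne) :
    ∑ f, wideForm op m T v w k f = ∑ f, wideForm op m T w v k f := by
  have h1 : ∀ v w : m.GridFun np, ∑ f, wideForm op m T v w k f = ∑ f, ∑ e,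
      if e = f then 0 else jump op m v k f ⬝ᵥ (T.T5 k f e *ᵥ jump op m w k e) := by
    intro v w
    refine Finset.sum_congr rfl fun f _ => ?_
    refine Eq.trans ?_ (Finset.sum_erase (a := f) Finset.univ (by simp))
    refine Finset.sum_congr rfl fun e he => ?_
    rw [if_neg (Finset.ne_of_mem_erase he)]
  rw [h1, h1, Finset.sum_comm]
  refine Finset.sum_congr rfl fun f _ => Finset.sum_congr rfl fun e _ => ?_
  by_cases hef : e = f
  · simp [hef]
  · rw [if_neg hef, if_neg (Ne.symm hef), hs.T5_symm k e f, dotProduct_transpose_mulVec,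
      dotProduct_comm]

/-- The subtracted term is the facet term of Green's identity. Both sides share the same `dsum` and
have opposite jumps, and the coefficients of side `g` are expressible through those of side `k`;
one-sided values then combine into jumps and flux sums, with the contributions of `B` collected in
the last two terms of `facetForm`. -/
theorem primal_facet_sum (hT : T.IsAdjointConsistent op m) (v w : m.GridFun np) :
    (m.intSum fun k f g f' => (tr op m v k f ⬝ᵥ (T.T1 k f *ᵥ jump op m w k f)
        + tr op m v k f ⬝ᵥ (T.T3 k f *ᵥ dsum op lam m w k f g f')
        + dn op lam m v k f ⬝ᵥ (T.T2 k f *ᵥ jump op m w k f)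
        + dn op lam m v k f ⬝ᵥ (T.T4 k f *ᵥ dsum op lam m w k f g f'))
        - tr op m v k f ⬝ᵥ ((m.map k).B op f *ᵥ dn op lam m w k f))
      = (1 / 2) * m.intSum (facetForm op lam m T v w) := by
  rw [Mesh.intSum_eq_half]
  congr 1
  refine m.intSum_congr fun k f g f' hk => ?_
  have t1 : flipMat (T.T1 g f') = T.T1 k f := (hT.T1_eq k f g f' hk).symm
  have t2 : flipMat (T.T2 g f') = -(T.T2 k f + (m.map k).B op f) := by
    rw [neg_add_rev, ← hT.T2_add k f g f' hk]; abel
  have t3 : flipMat (T.T3 g f') = -(T.T3 k f - (m.map k).B op f) := by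
    rw [← hT.T3_add k f g f' hk]; abel
  have t4 : flipMat (T.T4 g f') = T.T4 k f := (hT.T4_eq k f g f' hk).symm
  have tB := flipMat_B_eq hT hk
  rw [dotProduct_mulVec_flip (T.T1 g f'), dotProduct_mulVec_flip (T.T2 g f'),
    dotProduct_mulVec_flip (T.T3 g f'), dotProduct_mulVec_flip (T.T4 g f'),
    dotProduct_mulVec_flip ((m.map g).B op f'), t1, t2, t3, t4, tB]
  simp only [facetForm, flip_dsum, jump_symm hk, flip_neg, flip_flip]
  simp only [jump_eq hk, dsum, sub_dotProduct, add_dotProduct, Matrix.mulVec_add,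
    Matrix.mulVec_sub, Matrix.mulVec_neg, Matrix.neg_mulVec, Matrix.add_mulVec, Matrix.sub_mulVec,
    dotProduct_add, dotProduct_sub, dotProduct_neg]
  ring

/-- The adjoint operator acts on `v` here, yet the same form with `v` in its first slot results.
This is the adjoint consistency of the compact interface terms; symmetry of the coefficient blocks
exchanges the roles of `v` and `w`. -/
theorem adjoint_facet_sum (hT : T.IsAdjointConsistent op m) (hs : T.IsSymmetric)
    (v w : m.GridFun np) :
    (m.intSum fun k f g f' => (tr op m w k f ⬝ᵥ (T.T1 k f *ᵥ jump op m v k f)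
        + tr op m w k f ⬝ᵥ ((T.T2 k f + (m.map k).B op f) *ᵥ dsum op lam m v k f g f')
        + dn op lam m w k f ⬝ᵥ ((T.T3 k f - (m.map k).B op f) *ᵥ jump op m v k f)
        + dn op lam m w k f ⬝ᵥ (T.T4 k f *ᵥ dsum op lam m v k f g f'))
        - tr op m w k f ⬝ᵥ ((m.map k).B op f *ᵥ dn op lam m v k f))
      = (1 / 2) * m.intSum (facetForm op lam m T v w) := by
  rw [Mesh.intSum_eq_half]
  congr 1
  refine m.intSum_congr fun k f g f' hk => ?_
  have tB := flipMat_B_eq hT hk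
  have t1 : flipMat (T.T1 g f') = T.T1 k f := (hT.T1_eq k f g f' hk).symm
  have t2 : flipMat (T.T2 g f' + (m.map g).B op f') = -T.T2 k f := by
    have : flipMat (T.T2 g f') = -(T.T2 k f + (m.map k).B op f) := by
      rw [neg_add_rev, ← hT.T2_add k f g f' hk]; abel
    rw [flipMat_add, this, tB]; abel
  have t3 : flipMat (T.T3 g f' - (m.map g).B op f') = -T.T3 k f := by
    have : flipMat (T.T3 g f') = -(T.T3 k f - (m.map k).B op f) := by
      rw [← hT.T3_add k f g f' hk]; abel
    rw [sub_eq_add_neg, flipMat_add, flipMat_neg, this, tB]; abel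
  have t4 : flipMat (T.T4 g f') = T.T4 k f := (hT.T4_eq k f g f' hk).symm
  rw [dotProduct_mulVec_flip (T.T1 g f'), dotProduct_mulVec_flip (T.T2 g f' + _),
    dotProduct_mulVec_flip (T.T3 g f' - _), dotProduct_mulVec_flip (T.T4 g f'),
    dotProduct_mulVec_flip ((m.map g).B op f'), t1, t2, t3, t4, tB]
  simp only [facetForm, flip_dsum, jump_symm hk, flip_neg, flip_flip]
  rw [(hs.T1_symm k f).dotProduct_mulVec_comm (jump op m v k f) (jump op m w k f),
    (hs.T3_symm k f).dotProduct_mulVec_comm (jump op m v k f) (dsum op lam m w k f g f'),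
    (hs.T2_symm k f).dotProduct_mulVec_comm (dsum op lam m v k f g f') (jump op m w k f),
    (hs.T4_symm k f).dotProduct_mulVec_comm (dsum op lam m v k f g f') (dsum op lam m w k f g f'),
    ((m.map k).B_isSymm op f).dotProduct_mulVec_comm (jump op m v k f) (dn op lam m w k f),
    ((m.map k).B_isSymm op f).dotProduct_mulVec_comm (flip (dn op lam m v g f'))
      (jump op m w k f)]
  simp only [jump_eq hk, dsum, sub_dotProduct, add_dotProduct, Matrix.mulVec_add,
    Matrix.mulVec_sub, Matrix.mulVec_neg, Matrix.neg_mulVec, Matrix.add_mulVec, Matrix.sub_mulVec,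
    dotProduct_add, dotProduct_sub, dotProduct_neg]
  ring

theorem dotProduct_satB (U : Pt → ℝ) (v w : m.GridFun np) :
    ∑ k, v k ⬝ᵥ satB op Ω lam m T U w k
      = (m.dirSum fun k f => tr op m v k f ⬝ᵥ (T.TD k f *ᵥ tr op m w k f)
        - dn op lam m v k f ⬝ᵥ ((m.map k).B op f *ᵥ tr op m w k f))
      + (m.neuSum fun k f => tr op m v k f ⬝ᵥ ((m.map k).B op f *ᵥ dn op lam m w k f))
      - dataForm op Ω lam m T U v := by
  rw [dataForm, sub_eq_add_neg, neg_add, ← Mesh.dirSum_neg, ← Mesh.neuSum_neg, add_add_add_comm,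
    ← Mesh.dirSum_add, ← Mesh.neuSum_add]
  simp only [Mesh.dirSum, Mesh.neuSum, ← Finset.sum_add_distrib]
  refine Finset.sum_congr rfl fun k _ => ?_
  rw [satB, dotProduct_sum]
  refine Finset.sum_congr rfl fun f _ => ?_
  rcases hk : m.kind k f with ⟨g, f'⟩ | _ | _
  · simp
  · simp only [dotProduct_sub, dotProduct_transpose_mulVec, Matrix.mulVec_sub, tr, dn]
    ring
  · simp only [dotProduct_sub, dotProduct_transpose_mulVec, Matrix.mulVec_sub, tr, dn]
    ring

theorem sum_H_mul_inv (hop : op.IsSBP p) (v x y : m.GridFun np) :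
    ∑ k, ∑ j, v k j * ((m.map k).H op j *
        (-x k + diagonal (fun i => ((m.map k).H op i)⁻¹) *ᵥ y k) j)
      = -(∑ k, ∑ j, v k j * ((m.map k).H op j * x k j)) + ∑ k, v k ⬝ᵥ y k := by
  simp only [dotProduct, ← Finset.sum_neg_distrib, ← Finset.sum_add_distrib]
  refine Finset.sum_congr rfl fun k _ => Finset.sum_congr rfl fun j _ => ?_
  have hH := ((m.map k).H_pos (m.jac_pos k) hop j).ne'
  rw [Pi.add_apply, Pi.neg_apply, Matrix.mulVec_diagonal]
  field_simp

/-- The primal operator tested with a grid function. -/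
theorem primalOp_test (hop : op.IsSBP p) (hT : T.IsAdjointConsistent op m) (U : Pt → ℝ)
    (v w : m.GridFun np) :
    ∑ k, ∑ j, v k j * ((m.map k).H op j * primalOp op Ω lam m T U w k j)
      = discreteForm op lam m T v w - dataForm op Ω lam m T U v := by
  simp only [primalOp]
  rw [sum_H_mul_inv hop v (fun k => (m.map k).D2 op lam *ᵥ w k)]
  simp only [(m.map _).dotProduct_H_D2 (m.jac_pos _) hop, dotProduct_add, Finset.sum_add_distrib,
    Finset.sum_sub_distrib]
  -- The facet terms of Green's identity are distributed by kind: the interior ones enter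
  -- `facetForm`, the Dirichlet ones stay in the bilinear form, and the Neumann ones cancel against
  -- the Neumann SAT.
  have e1 := m.sum_facets fun k f => (op.R f *ᵥ v k) ⬝ᵥ ((m.map k).B op f *ᵥ
    ((m.map k).Dn op lam f *ᵥ w k))
  have e2 := primal_facet_sum (lam := lam) hT v w
  have e3 := wide_sum (op := op) (T := T) v w
  have h6 : ∀ k f e, T.T6 k f e = -T.T5 k f e := fun k f e => by rw [hT.T5_eq, neg_neg]
  have e4 := dotProduct_satI (op := op) (lam := lam) (T := T) v w
  simp only [h6, Matrix.neg_mulVec, dotProduct_neg, Finset.sum_neg_distrib, ← sub_eq_add_neg] at e4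
  rw [Mesh.intSum_add, e3] at e4
  have e5 : (fun k f g f' => (tr op m v k f ⬝ᵥ (T.T1 k f *ᵥ jump op m w k f)
        + tr op m v k f ⬝ᵥ (T.T3 k f *ᵥ dsum op lam m w k f g f')
        + dn op lam m v k f ⬝ᵥ (T.T2 k f *ᵥ jump op m w k f)
        + dn op lam m v k f ⬝ᵥ (T.T4 k f *ᵥ dsum op lam m w k f g f'))
        - tr op m v k f ⬝ᵥ ((m.map k).B op f *ᵥ dn op lam m w k f))
      = fun k f g f' => (tr op m v k f ⬝ᵥ (T.T1 k f *ᵥ jump op m w k f)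
        + tr op m v k f ⬝ᵥ (T.T3 k f *ᵥ dsum op lam m w k f g f')
        + dn op lam m v k f ⬝ᵥ (T.T2 k f *ᵥ jump op m w k f)
        + dn op lam m v k f ⬝ᵥ (T.T4 k f *ᵥ dsum op lam m w k f g f'))
        + -(tr op m v k f ⬝ᵥ ((m.map k).B op f *ᵥ dn op lam m w k f)) := by
    funext k f g f'; ring
  rw [e5, Mesh.intSum_add, Mesh.intSum_neg] at e2
  have e6 := dotProduct_satB (op := op) Ω (lam := lam) (T := T) U v w
  have e7 : (m.dirSum fun k f => tr op m v k f ⬝ᵥ (T.TD k f *ᵥ tr op m w k f)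
      - tr op m v k f ⬝ᵥ ((m.map k).B op f *ᵥ dn op lam m w k f)
      - dn op lam m v k f ⬝ᵥ ((m.map k).B op f *ᵥ tr op m w k f))
      = (m.dirSum fun k f => tr op m v k f ⬝ᵥ (T.TD k f *ᵥ tr op m w k f)
        - dn op lam m v k f ⬝ᵥ ((m.map k).B op f *ᵥ tr op m w k f))
      - m.dirSum fun k f => tr op m v k f ⬝ᵥ ((m.map k).B op f *ᵥ dn op lam m w k f) := by
    rw [sub_eq_add_neg (m.dirSum _), ← Mesh.dirSum_neg, ← Mesh.dirSum_add]
    congr 1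
    funext k f; ring
  rw [discreteForm, e7, e4, e6, e1]
  simp only [tr, dn] at e2 ⊢
  linarith

/-- The adjoint operator tested with a grid function. -/
theorem adjointOp_test (hop : op.IsSBP p) (hT : T.IsAdjointConsistent op m)
    (hs : T.IsSymmetric)
    (hlam : ∀ k j a b, lam ((m.map k).pnode op j) a b = lam ((m.map k).pnode op j) b a)
    (ψ : Pt → ℝ) (v w : m.GridFun np) :
    ∑ k, ∑ j, w k j * ((m.map k).H op j * adjointOp op Ω lam m T ψ v k j)
      = discreteForm op lam m T v w - dataForm op Ω lam m T ψ w := by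
  simp only [adjointOp]
  rw [sum_H_mul_inv hop w (fun k => (m.map k).D2 op lam *ᵥ v k)]
  simp only [(m.map _).dotProduct_H_D2 (m.jac_pos _) hop, dotProduct_add, Finset.sum_add_distrib,
    Finset.sum_sub_distrib]
  have e1 := m.sum_facets fun k f => (op.R f *ᵥ w k) ⬝ᵥ ((m.map k).B op f *ᵥ
    ((m.map k).Dn op lam f *ᵥ v k))
  have e2 := adjoint_facet_sum (lam := lam) hT hs v w
  have e3 := wide_sum (op := op) (T := T) w v
  have e4 := dotProduct_adjSatI (op := op) (lam := lam) (T := T) hT v w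
  rw [Mesh.intSum_add, e3] at e4
  have e5 : (fun k f g f' => (tr op m w k f ⬝ᵥ (T.T1 k f *ᵥ jump op m v k f)
        + tr op m w k f ⬝ᵥ ((T.T2 k f + (m.map k).B op f) *ᵥ dsum op lam m v k f g f')
        + dn op lam m w k f ⬝ᵥ ((T.T3 k f - (m.map k).B op f) *ᵥ jump op m v k f)
        + dn op lam m w k f ⬝ᵥ (T.T4 k f *ᵥ dsum op lam m v k f g f'))
        - tr op m w k f ⬝ᵥ ((m.map k).B op f *ᵥ dn op lam m v k f))
      = fun k f g f' => (tr op m w k f ⬝ᵥ (T.T1 k f *ᵥ jump op m v k f)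
        + tr op m w k f ⬝ᵥ ((T.T2 k f + (m.map k).B op f) *ᵥ dsum op lam m v k f g f')
        + dn op lam m w k f ⬝ᵥ ((T.T3 k f - (m.map k).B op f) *ᵥ jump op m v k f)
        + dn op lam m w k f ⬝ᵥ (T.T4 k f *ᵥ dsum op lam m v k f g f'))
        + -(tr op m w k f ⬝ᵥ ((m.map k).B op f *ᵥ dn op lam m v k f)) := by
    funext k f g f'; ring
  rw [e5, Mesh.intSum_add, Mesh.intSum_neg] at e2
  have e6 := dotProduct_satB (op := op) Ω (lam := lam) (T := T) ψ w v
  have e7 : (m.dirSum fun k f => tr op m v k f ⬝ᵥ (T.TD k f *ᵥ tr op m w k f)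
      - tr op m v k f ⬝ᵥ ((m.map k).B op f *ᵥ dn op lam m w k f)
      - dn op lam m v k f ⬝ᵥ ((m.map k).B op f *ᵥ tr op m w k f))
      = (m.dirSum fun k f => tr op m w k f ⬝ᵥ (T.TD k f *ᵥ tr op m v k f)
        - dn op lam m w k f ⬝ᵥ ((m.map k).B op f *ᵥ tr op m v k f))
      - m.dirSum fun k f => tr op m w k f ⬝ᵥ ((m.map k).B op f *ᵥ dn op lam m v k f) := by
    rw [sub_eq_add_neg (m.dirSum _), ← Mesh.dirSum_neg, ← Mesh.dirSum_add]
    congr 1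
    funext k f
    rw [(hs.TD_symm k f).dotProduct_mulVec_comm (tr op m v k f),
      ((m.map k).B_isSymm op f).dotProduct_mulVec_comm (tr op m v k f),
      ((m.map k).B_isSymm op f).dotProduct_mulVec_comm (dn op lam m v k f)]
    ring
  have e8 : ∑ k, ∑ f, wideForm op m T v w k f = ∑ k, ∑ f, wideForm op m T w v k f :=
    Finset.sum_congr rfl fun k _ => wideForm_symm hs v w k
  have e9 : ∑ k, (m.map k).energy op lam (v k) (w k) = ∑ k, (m.map k).energy op lam (w k) (v k) :=
    Finset.sum_congr rfl fun k _ => (m.map k).energy_comm (hlam k) _ _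
  rw [discreteForm, e7, e4, e6, e1, e8, e9]
  simp only [tr, dn] at e2 ⊢
  linarith

end Form

/-! ### Facet curves -/

theorem facetParam_eq (f : Fin 3) (s : ℝ) :
    facetParam f s = facetParam f 0 + s • (refHalfLength f • WithLp.toLp 2 (refTangent f) : Pt) := by
  have h2 : √2 ≠ 0 := by positivity
  ext a
  fin_cases f <;> fin_cases a <;> simp [facetParam, refHalfLength, refTangent]
  all_goals field_simp

theorem hasDerivAt_facetParam (f : Fin 3) (s : ℝ) :
    HasDerivAt (facetParam f) (refHalfLength f • WithLp.toLp 2 (refTangent f) : Pt) s := by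
  have h1 : facetParam f = fun s =>
      facetParam f 0 + s • (refHalfLength f • WithLp.toLp 2 (refTangent f) : Pt) :=
    funext (facetParam_eq f)
  rw [h1]
  simpa using ((hasDerivAt_id s).smul_const
    (refHalfLength f • WithLp.toLp 2 (refTangent f) : Pt)).const_add (facetParam f 0)

theorem refHalfLength_pos (f : Fin 3) : 0 < refHalfLength f := by
  fin_cases f <;> simp [refHalfLength]

namespace PolyMap

variable (M : PolyMap)

theorem contDiff_toFun {n : WithTop ℕ∞} : ContDiff ℝ n M.toFun := by
  rw [contDiff_euclidean]
  intro a
  fin_cases a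
  · exact contDiff_polyEval (M 0)
  · exact contDiff_polyEval (M 1)

theorem toFun_apply (ξ : Pt) (a : Fin 2) : M.toFun ξ a = polyEval (M a) ξ := by
  fin_cases a <;> rfl

theorem fderiv_toFun_apply (ξ v : Pt) (a : Fin 2) :
    (fderiv ℝ M.toFun ξ v) a = ∑ b, M.metric a b ξ * v b := by
  have h1 : HasFDerivAt M.toFun (fderiv ℝ M.toFun ξ) ξ :=
    ((M.contDiff_toFun (n := 1)).differentiable one_ne_zero ξ).hasFDerivAt
  have h2 : HasFDerivAt (fun x => M.toFun x a)
      ((EuclideanSpace.proj (𝕜 := ℝ) (ι := Fin 2) a : Pt →L[ℝ] ℝ).comp (fderiv ℝ M.toFun ξ)) ξ :=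
    (EuclideanSpace.proj (𝕜 := ℝ) (ι := Fin 2) a : Pt →L[ℝ] ℝ).hasFDerivAt.comp ξ h1
  simp only [M.toFun_apply] at h2
  have h3 := congrArg (fun L : Pt →L[ℝ] ℝ => L v) (h2.unique (hasFDerivAt_polyEval (M a) ξ))
  simpa [metric, Fin.sum_univ_two] using h3

theorem det_fderiv_toFun (ξ : Pt) : (fderiv ℝ M.toFun ξ).det = M.jac ξ := by
  rw [ContinuousLinearMap.det, ← LinearMap.det_toMatrix (EuclideanSpace.basisFun (Fin 2) ℝ).toBasis,
    Matrix.det_fin_two]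
  simp [LinearMap.toMatrix_apply, fderiv_toFun_apply, jac]

/-- Tangent vector of the physical facet, with respect to the reference arc length. -/
noncomputable def tangent (f : Fin 3) (a : Fin 2) (ξ : Pt) : ℝ :=
  ∑ b, M.metric a b ξ * refTangent f b

/-- Parametrization of the physical facet. -/
noncomputable def facetCurve (f : Fin 3) (s : ℝ) : Pt := M.toFun (facetParam f s)

theorem hasDerivAt_facetCurve (f : Fin 3) (s : ℝ) :
    HasDerivAt (M.facetCurve f)
      (refHalfLength f • WithLp.toLp 2 fun a => M.tangent f a (facetParam f s) : Pt) s := by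
  have h1 := ((M.contDiff_toFun (n := 1)).differentiable one_ne_zero
    (facetParam f s)).hasFDerivAt.comp_hasDerivAt s (hasDerivAt_facetParam f s)
  have h2 : (refHalfLength f • WithLp.toLp 2 fun a => M.tangent f a (facetParam f s) : Pt)
      = fderiv ℝ M.toFun (facetParam f s) (refHalfLength f • WithLp.toLp 2 (refTangent f)) := by
    ext a
    simp [fderiv_toFun_apply, tangent, Fin.sum_univ_two]
  rw [h2]
  exact h1

theorem facetJac_eq (f : Fin 3) (ξ : Pt) :
    M.facetJac f ξ = ‖(WithLp.toLp 2 fun a => M.tangent f a ξ : Pt)‖ := by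
  rw [EuclideanSpace.norm_eq]
  simp [facetJac, tangent]

theorem normal_zero (f : Fin 3) (ξ : Pt) :
    M.normal f 0 ξ = M.tangent f 1 ξ / M.facetJac f ξ := by
  simp [normal, tangent, cof, refNormal_zero, refNormal_one, Fin.sum_univ_two, add_comm]

theorem normal_one (f : Fin 3) (ξ : Pt) :
    M.normal f 1 ξ = -M.tangent f 0 ξ / M.facetJac f ξ := by
  simp [normal, tangent, cof, refNormal_zero, refNormal_one, Fin.sum_univ_two]

end PolyMap

namespace Mesh

variable {p : ℕ} {m : Mesh p} {k g : Fin m.ne} {f f' : Fin 3}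

/-- Differentiating the matching condition, where the neighbour's parameter is `-s`, reverses the
tangent. Derivatives within the closed interval include the end points. -/
theorem tangent_match (hk : m.kind k f = .interior g f') {s : ℝ} (hs : s ∈ Set.Icc (-1 : ℝ) 1)
    (a : Fin 2) :
    refHalfLength f * (m.map k).tangent f a (facetParam f s)
      = -(refHalfLength f' * (m.map g).tangent f' a (facetParam f' (-s))) := by
  have h1 := ((m.map k).hasDerivAt_facetCurve f s).hasDerivWithinAt (s := Set.Icc (-1 : ℝ) 1)
  have h2 := (((m.map g).hasDerivAt_facetCurve f' (-s)).scomp s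
    (hasDerivAt_neg s)).hasDerivWithinAt (s := Set.Icc (-1 : ℝ) 1)
  have h3 : HasDerivWithinAt ((m.map k).facetCurve f) _ (Set.Icc (-1 : ℝ) 1) s :=
    h2.congr (fun t ht => m.facet_match k f g f' hk t ht) (m.facet_match k f g f' hk s hs)
  have h4 := (uniqueDiffOn_Icc (by norm_num : (-1 : ℝ) < 1) s hs).eq_deriv _ h1 h3
  have h5 := congrArg (fun v : Pt => v a) h4
  simpa using h5

theorem facetJac_match (hk : m.kind k f = .interior g f') {s : ℝ} (hs : s ∈ Set.Icc (-1 : ℝ) 1) :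
    refHalfLength f * (m.map k).facetJac f (facetParam f s)
      = refHalfLength f' * (m.map g).facetJac f' (facetParam f' (-s)) := by
  have h1 : ∀ (f : Fin 3) (v : Pt), refHalfLength f * ‖v‖ = ‖refHalfLength f • v‖ := by
    intro f v
    rw [norm_smul, Real.norm_of_nonneg (refHalfLength_pos f).le]
  rw [PolyMap.facetJac_eq, PolyMap.facetJac_eq, h1, h1, ← norm_neg]
  congr 1
  ext a
  have h2 := tangent_match hk hs a
  simp only [PiLp.neg_apply, PiLp.smul_apply, smul_eq_mul]
  linarith

/-- The normal is the tangent turned by a right angle and divided by its length, so opposite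
tangents give opposite normals. -/
theorem normal_match (hk : m.kind k f = .interior g f') {s : ℝ} (hs : s ∈ Set.Icc (-1 : ℝ) 1)
    (d : Fin 2) :
    (m.map g).normal f' d (facetParam f' (-s)) = -(m.map k).normal f d (facetParam f s) := by
  have hs' : -s ∈ Set.Icc (-1 : ℝ) 1 := ⟨by linarith [hs.2], by linarith [hs.1]⟩
  have hJ := ((m.map k).facetJac_pos (f := f) (m.jac_pos k _ (facetParam_mem_refTriangle f hs))).ne'
  have hJ' := ((m.map g).facetJac_pos (f := f')
    (m.jac_pos g _ (facetParam_mem_refTriangle f' hs'))).ne'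
  have h0 := (refHalfLength_pos f).ne'
  have h0' := (refHalfLength_pos f').ne'
  have h1 := facetJac_match hk hs
  have h2 := tangent_match hk hs
  have key : ∀ a, (m.map g).tangent f' a (facetParam f' (-s))
        / (m.map g).facetJac f' (facetParam f' (-s))
      = -((m.map k).tangent f a (facetParam f s) / (m.map k).facetJac f (facetParam f s)) := by
    intro a
    have e1 := h2 a
    rw [← mul_div_mul_left ((m.map k).tangent f a (facetParam f s)) _ h0, h1, e1, neg_div, neg_neg,
      mul_div_mul_left _ _ h0']
  fin_cases d
  · simp only [Fin.zero_eta, PolyMap.normal_zero]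
    exact key 1
  · simp only [Fin.mk_one, PolyMap.normal_one, neg_div]
    rw [key 0]

variable {np nf : ℕ} {op : RefOperator np nf}

theorem facetPt_rev (hop : op.IsSBP p) (f : Fin 3) (l : Fin nf) :
    op.facetPt f l.rev = facetParam f (-op.facetNode l) := by
  rw [RefOperator.facetPt, hop.facetNode_rev]

theorem pfacet_match (hop : op.IsSBP p) (hk : m.kind k f = .interior g f') (l : Fin nf) :
    (m.map g).pfacet op f' l.rev = (m.map k).pfacet op f l := by
  rw [PolyMap.pfacet, facetPt_rev hop]
  exact (m.facet_match k f g f' hk _ (hop.facetNode_mem l)).symm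

theorem flip_facetRestrict (hop : op.IsSBP p) (hk : m.kind k f = .interior g f') (u : Pt → ℝ) :
    flip (m.facetRestrict op u g f') = m.facetRestrict op u k f := by
  funext l
  simp only [flip, facetRestrict, pfacet_match hop hk]

theorem flip_fluxRestrict (hop : op.IsSBP p) (hk : m.kind k f = .interior g f') (Ω : Set Pt)
    (lam : Pt → Matrix (Fin 2) (Fin 2) ℝ) (u : Pt → ℝ) :
    flip (m.fluxRestrict op Ω lam u g f') = -m.fluxRestrict op Ω lam u k f := by
  funext l
  simp only [flip, fluxRestrict, pfacet_match hop hk, Pi.neg_apply, normalFlux, facetPt_rev hop,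
    normal_match hk (hop.facetNode_mem l)]
  simp [Fin.sum_univ_two, RefOperator.facetPt]
  ring

end Mesh

/-! ### Pullbacks of smooth functions -/

section Tessellation

variable {p : ℕ} {Ω ΓD ΓN : Set Pt} {m : Mesh p}

theorem PolyMap.hasFDerivWithinAt_toFun (M : PolyMap) (s : Set Pt) (ξ : Pt) :
    HasFDerivWithinAt M.toFun (fderiv ℝ M.toFun ξ) s ξ :=
  ((M.contDiff_toFun (n := 1)).differentiable one_ne_zero ξ).hasFDerivAt.hasFDerivWithinAt

theorem Mesh.IsTessellation.mapsTo (ht : m.IsTessellation Ω ΓD ΓN) (k : Fin m.ne) :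
    Set.MapsTo (m.map k).toFun refTriangle Ω := by
  intro ξ hξ
  rw [← ht.volume_eq]
  exact Set.mem_iUnion.2 ⟨k, Set.mem_image_of_mem _ hξ⟩

/-- Every point of `Ω` lies in an element, and the image of the triangle under a map with invertible
derivative inherits unique differentiability. Thus derivatives within `Ω` are meaningful up to the
boundary. -/
theorem Mesh.IsTessellation.uniqueDiffOn (ht : m.IsTessellation Ω ΓD ΓN) : UniqueDiffOn ℝ Ω := by
  intro x hx
  have hx' := hx
  rw [← ht.volume_eq] at hx'
  obtain ⟨k, ξ, hξ, rfl⟩ := Set.mem_iUnion.1 hx'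
  have h1 := ((m.map k).hasFDerivWithinAt_toFun refTriangle ξ).uniqueDiffWithinAt
    (uniqueDiffOn_refTriangle ξ hξ) ?_
  · exact h1.mono (Set.image_subset_iff.2 (ht.mapsTo k))
  · refine Function.Surjective.denseRange ?_
    have h2 : (fderiv ℝ (m.map k).toFun ξ).det ≠ 0 := by
      rw [PolyMap.det_fderiv_toFun]
      exact (m.jac_pos k ξ hξ).ne'
    exact (LinearMap.equivOfDetNeZero (fderiv ℝ (m.map k).toFun ξ).toLinearMap h2).surjective

theorem Mesh.IsTessellation.isCompact (ht : m.IsTessellation Ω ΓD ΓN) : IsCompact Ω := by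
  rw [← ht.volume_eq]
  exact isCompact_iUnion fun k =>
    isCompact_refTriangle.image ((m.map k).contDiff_toFun (n := 0)).continuous

/-- Pullback of a partial derivative. -/
theorem PolyMap.pd_comp_toFun (M : PolyMap) (hΩ : Set.MapsTo M.toFun refTriangle Ω) {u : Pt → ℝ}
    (hu : DifferentiableOn ℝ u Ω) {ξ : Pt} (hξ : ξ ∈ refTriangle) (b : Fin 2) :
    pd refTriangle (fun η => u (M.toFun η)) b ξ
      = ∑ d, M.metric d b ξ * pd Ω u d (M.toFun ξ) := by
  have h1 := (M.hasFDerivWithinAt_toFun refTriangle ξ).fderivWithin (uniqueDiffOn_refTriangle ξ hξ)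
  have h2 := fderivWithin_comp ξ (hu _ (hΩ hξ))
    (M.hasFDerivWithinAt_toFun refTriangle ξ).differentiableWithinAt hΩ
    (uniqueDiffOn_refTriangle ξ hξ)
  have h3 : fderiv ℝ M.toFun ξ (EuclideanSpace.single b 1)
      = ∑ d, M.metric d b ξ • (EuclideanSpace.single d 1 : Pt) := by
    ext a
    rw [fderiv_toFun_apply]
    fin_cases a <;> simp [Fin.sum_univ_two]
  have h4 : (fun η => u (M.toFun η)) = u ∘ M.toFun := rfl
  rw [pd, h4, h2, h1, ContinuousLinearMap.comp_apply, h3, map_sum]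
  simp [pd]

theorem contDiffOn_pd (hΩ : UniqueDiffOn ℝ Ω) {N : ℕ} {u : Pt → ℝ}
    (hu : ContDiffOn ℝ (N + 1 : ℕ) u Ω) (a : Fin 2) : ContDiffOn ℝ N (pd Ω u a) Ω := by
  have h1 : ContDiffOn ℝ N (fderivWithin ℝ u Ω) Ω := hu.fderivWithin hΩ (by norm_cast)
  exact h1.clm_apply contDiffOn_const

theorem contDiffOn_flux (hΩ : UniqueDiffOn ℝ Ω) {N : ℕ} {lam : Pt → Matrix (Fin 2) (Fin 2) ℝ}
    (hlam : ∀ a b, ContDiffOn ℝ N (fun x => lam x a b) Ω) {u : Pt → ℝ}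
    (hu : ContDiffOn ℝ (N + 1 : ℕ) u Ω) (a : Fin 2) : ContDiffOn ℝ N (flux Ω lam u a) Ω :=
  ContDiffOn.sum fun b _ => (hlam a b).mul (contDiffOn_pd hΩ hu b)

variable {ι : Type*} {h : ι → Set.Ioc (0 : ℝ) 1} {M : ι → PolyMap}

/-- Pullbacks of a smooth function under mappings with scaled derivatives. -/
theorem Scaled.comp_toFun {N : ℕ} (hΩ : UniqueDiffOn ℝ Ω) (hc : IsCompact Ω)
    (hM : ∀ i, Set.MapsTo (M i).toFun refTriangle Ω)
    (hD : ∃ C : ℝ, ∀ i, ∀ ξ ∈ refTriangle, ∀ j : ℕ, 1 ≤ j →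
      ‖iteratedFDeriv ℝ j (M i).toFun ξ‖ ≤ C * (h i : ℝ) ^ j)
    {u : Pt → ℝ} (hu : ContDiffOn ℝ N u Ω) :
    Scaled h N 0 fun i ξ => u ((M i).toFun ξ) := by
  obtain ⟨C, hC⟩ := hD
  choose! B hB using fun j (hj : j ≤ N) => hc.exists_bound_of_continuousOn
    (hu.continuousOn_iteratedFDerivWithin (by exact_mod_cast hj) hΩ)
  set A : ℝ := ∑ j ∈ Finset.range (N + 1), |B j|
  have hA : ∀ j ≤ N, ∀ x ∈ Ω, ‖iteratedFDerivWithin ℝ j u Ω x‖ ≤ A := fun j hj x hx =>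
    ((hB j hj x hx).trans (le_abs_self _)).trans (Finset.single_le_sum (f := fun j => |B j|)
      (fun _ _ => abs_nonneg _) (Finset.mem_range.2 (by omega)))
  have hA0 : 0 ≤ A := Finset.sum_nonneg fun _ _ => abs_nonneg _
  -- The bound for derivatives of a composition wants the derivative of order `l` of the inner map
  -- below `(D * h) ^ l`; taking `D ≥ 1` gives `C ≤ D ^ l` for all `l ≥ 1`.
  set D : ℝ := max C 1
  have hD1 : 1 ≤ D := le_max_right _ _
  refine ⟨fun i => hu.comp ((M i).contDiff_toFun).contDiffOn (hM i), N.factorial * A * D ^ N,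
    fun i j hj ξ hξ => ?_⟩
  have hh := (h i).2.1
  have h1 := norm_iteratedFDerivWithin_comp_le (n := j) (C := A) (D := D * h i) hu
    ((M i).contDiff_toFun (n := N)).contDiffOn (by exact_mod_cast hj) hΩ uniqueDiffOn_refTriangle
    (hM i) hξ (fun l hl => hA l (hl.trans hj) _ (hM i hξ)) (fun l hl _ => by
      rw [iteratedFDerivWithin_eq_iteratedFDeriv uniqueDiffOn_refTriangle
        ((M i).contDiff_toFun).contDiffAt hξ, mul_pow]
      refine (hC i ξ hξ l hl).trans ?_
      have : C ≤ D ^ l := (le_max_left C 1).trans (le_self_pow₀ hD1 (by omega))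
      gcongr)
  refine h1.trans ?_
  rw [mul_pow, zero_add, ← mul_assoc]
  have := Nat.factorial_le hj
  gcongr

theorem elemFamily_of_bounds
    (hD : ∃ C : ℝ, ∀ i, ∀ ξ ∈ refTriangle, ∀ j : ℕ, 1 ≤ j →
      ‖iteratedFDeriv ℝ j (M i).toFun ξ‖ ≤ C * (h i : ℝ) ^ j)
    (hJ : ∃ c : ℝ, 0 < c ∧ ∀ i, ∀ ξ ∈ refTriangle, c * (h i : ℝ) ^ 2 ≤ (M i).jac ξ) :
    ElemFamily h M := by
  refine ⟨fun N a b => ⟨fun i => (contDiff_polyEval _).contDiffOn, ?_⟩, hJ⟩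
  obtain ⟨C, hC⟩ := hD
  let L : (Pt →L[ℝ] Pt) →L[ℝ] ℝ :=
    (EuclideanSpace.proj (𝕜 := ℝ) (ι := Fin 2) a : Pt →L[ℝ] ℝ).comp
      (ContinuousLinearMap.apply ℝ Pt (EuclideanSpace.single b (1 : ℝ)))
  refine ⟨‖L‖ * C, fun i j _ ξ hξ => ?_⟩
  have h1 : (M i).metric a b = L ∘ fderiv ℝ (M i).toFun := by
    funext η
    simp only [L, Function.comp_apply, ContinuousLinearMap.comp_apply,
      ContinuousLinearMap.apply_apply, PiLp.proj_apply, PolyMap.fderiv_toFun_apply]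
    fin_cases b <;> simp
  have h2 : ContDiff ℝ j ((M i).metric a b) := contDiff_polyEval _
  have h3 : ContDiff ℝ j (fderiv ℝ (M i).toFun) :=
    ((M i).contDiff_toFun (n := (j + 1 : ℕ))).fderiv_right (by norm_cast)
  rw [iteratedFDerivWithin_eq_iteratedFDeriv uniqueDiffOn_refTriangle h2.contDiffAt hξ, h1]
  refine (L.norm_iteratedFDeriv_comp_left h3.contDiffAt le_rfl).trans ?_
  rw [norm_iteratedFDeriv_fderiv, mul_assoc, add_comm 1 j]
  exact mul_le_mul_of_nonneg_left (hC i ξ hξ (j + 1) (by omega)) (norm_nonneg _)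

/-- The pullbacks of a smooth function with its gradient and flux. -/
theorem smoothFamily_of_contDiffOn (hΩ : UniqueDiffOn ℝ Ω) (hc : IsCompact Ω)
    (hM : ∀ i, Set.MapsTo (M i).toFun refTriangle Ω)
    (hD : ∃ C : ℝ, ∀ i, ∀ ξ ∈ refTriangle, ∀ j : ℕ, 1 ≤ j →
      ‖iteratedFDeriv ℝ j (M i).toFun ξ‖ ≤ C * (h i : ℝ) ^ j)
    {lam : Pt → Matrix (Fin 2) (Fin 2) ℝ}
    (hlam : ∀ a b, ContDiffOn ℝ (2 * p + 1 : ℕ) (fun x => lam x a b) Ω) {u : Pt → ℝ}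
    (hu : ContDiffOn ℝ (2 * p + 2 : ℕ) u Ω) :
    SmoothFamily h M lam p (fun i ξ => u ((M i).toFun ξ))
      (fun a i ξ => pd Ω u a ((M i).toFun ξ)) (fun a i ξ => flux Ω lam u a ((M i).toFun ξ))
      (fun a b i ξ => pd Ω (flux Ω lam u a) b ((M i).toFun ξ)) where
  scaled := Scaled.comp_toFun hΩ hc hM hD (hu.of_le (by norm_cast; omega))
  scaled_flux a := Scaled.comp_toFun hΩ hc hM hD (contDiffOn_flux hΩ hlam hu a)
  grad i _ hξ b := (M i).pd_comp_toFun (hM i) (hu.differentiableOn (by norm_cast)) hξ b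
  flux_eq _ _ _ _ := rfl
  flux_grad a i _ hξ b := (M i).pd_comp_toFun (hM i)
    ((contDiffOn_flux hΩ hlam hu a).differentiableOn (by norm_cast)) hξ b

end Tessellation

/-! ### Arc length as a Hausdorff measure -/

section Curve

variable {E : Type*} [NormedAddCommGroup E] [NormedSpace ℝ E] [MeasurableSpace E] [BorelSpace E]
  {γ γ' : ℝ → E} {a b s t K : ℝ}

omit [NormedSpace ℝ E] in
-- The distance to `γ s` is 1-Lipschitz, hence does not increase the measure, and it maps the
-- connected arc onto a set that contains `[0, ‖γ t - γ s‖]`.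
theorem ofReal_norm_sub_le_hausdorffMeasure (hγ : Continuous γ) (hst : s ≤ t) :
    ENNReal.ofReal ‖γ t - γ s‖ ≤ μH[1] (γ '' Set.Icc s t) := by
  have hd : LipschitzWith 1 fun x : E => dist x (γ s) := LipschitzWith.dist_left (γ s)
  have h1 := (hd.lipschitzOnWith (s := γ '' Set.Icc s t)).hausdorffMeasure_image_le zero_le_one
  simp only [ENNReal.coe_one, ENNReal.one_rpow, one_mul] at h1
  refine le_trans ?_ h1
  have h2 : IsPreconnected ((fun x : E => dist x (γ s)) '' (γ '' Set.Icc s t)) :=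
    (isPreconnected_Icc.image γ hγ.continuousOn).image _ hd.continuous.continuousOn
  have h3 : Set.Icc 0 ‖γ t - γ s‖ ⊆ (fun x : E => dist x (γ s)) '' (γ '' Set.Icc s t) := by
    refine h2.Icc_subset ⟨γ s, ⟨s, Set.left_mem_Icc.2 hst, rfl⟩, dist_self _⟩
      ⟨γ t, ⟨t, Set.right_mem_Icc.2 hst, rfl⟩, dist_eq_norm _ _⟩
  refine le_trans (le_of_eq ?_) (measure_mono h3)
  rw [hausdorffMeasure_real, Real.volume_Icc, sub_zero]

theorem hausdorffMeasure_image_Icc_le (hγ : ∀ x, HasDerivAt γ (γ' x) x) (hst : s ≤ t)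
    (hK : ∀ x ∈ Set.Icc s t, ‖γ' x‖ ≤ K) :
    μH[1] (γ '' Set.Icc s t) ≤ ENNReal.ofReal (K * (t - s)) := by
  have hK0 : 0 ≤ K := (norm_nonneg _).trans (hK s (Set.left_mem_Icc.2 hst))
  have h1 := (convex_Icc s t).lipschitzOnWith_of_nnnorm_hasDerivWithin_le
    (C := ⟨K, hK0⟩) (fun x _ => (hγ x).hasDerivWithinAt) fun x hx => hK x hx
  refine (h1.hausdorffMeasure_image_le zero_le_one).trans (le_of_eq ?_)
  rw [hausdorffMeasure_real, Real.volume_Icc, ENNReal.rpow_one, ENNReal.ofReal_mul hK0]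
  congr 1
  exact (ENNReal.ofReal_eq_coe_nnreal hK0).symm

/-- The measure of the arc is additive in the parameter, since by injectivity consecutive arcs meet
in one point. A short arc measures at least its chord and at most its parameter length times the
maximal speed, so the right derivative is the speed, and the fundamental theorem applies. -/
theorem hausdorffMeasure_image_Icc (hγ : ∀ x, HasDerivAt γ (γ' x) x)
    (hγ' : Continuous γ') (hinj : Set.InjOn γ (Set.Icc a b)) (ht : t ∈ Set.Icc a b) :
    (μH[1] (γ '' Set.Icc a t)).toReal = ∫ x in a..t, ‖γ' x‖ := by
  have hc : Continuous γ := continuous_iff_continuousAt.2 fun x => (hγ x).continuousAt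
  have : NullSingletonClass (μH[1] : Measure E) :=
    Measure.nullSingletonClass_hausdorff E one_pos
  set m : ℝ → ℝ := fun t => (μH[1] (γ '' Set.Icc a t)).toReal with hm
  have hfin : ∀ s t, μH[1] (γ '' Set.Icc s t) ≠ ⊤ := by
    intro s t
    rcases le_or_gt s t with hst | hst
    · obtain ⟨K, hK⟩ := isCompact_Icc.exists_bound_of_continuousOn
        (s := Set.Icc s t) hγ'.continuousOn
      exact ((hausdorffMeasure_image_Icc_le hγ hst hK).trans_lt ENNReal.ofReal_lt_top).ne
    · simp [Set.Icc_eq_empty_of_lt hst]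
  have hsub : ∀ s ∈ Set.Icc a b, ∀ t ∈ Set.Icc a b, s ≤ t →
      m t - m s = (μH[1] (γ '' Set.Icc s t)).toReal := by
    intro s hs t ht hst
    have h1 : γ '' Set.Icc a t = γ '' Set.Icc a s ∪ γ '' Set.Icc s t := by
      rw [← Set.image_union, Set.Icc_union_Icc_eq_Icc hs.1 hst]
    have h2 : AEDisjoint μH[1] (γ '' Set.Icc a s) (γ '' Set.Icc s t) := by
      refine measure_mono_null (t := {γ s}) ?_ (measure_singleton _)
      rintro x ⟨⟨y, hy, rfl⟩, z, hz, hzy⟩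
      have h3 := hinj ⟨hs.1.trans hz.1, hz.2.trans ht.2⟩ ⟨hy.1, hy.2.trans hs.2⟩ hzy
      have h4 : y = s := le_antisymm hy.2 (h3 ▸ hz.1)
      rw [h4]; rfl
    have h5 := measure_union₀ ((isCompact_Icc.image hc).measurableSet.nullMeasurableSet) h2
    simp only [hm]
    rw [h1, h5, ENNReal.toReal_add (hfin _ _) (hfin _ _)]
    ring
  have hlow : ∀ s ∈ Set.Icc a b, ∀ t ∈ Set.Icc a b, s ≤ t → ‖γ t - γ s‖ ≤ m t - m s := by
    intro s hs t ht hst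
    rw [hsub s hs t ht hst]
    exact (ENNReal.ofReal_le_iff_le_toReal (hfin _ _)).1
      (ofReal_norm_sub_le_hausdorffMeasure hc hst)
  have hup : ∀ K, ∀ s ∈ Set.Icc a b, ∀ t ∈ Set.Icc a b, s ≤ t →
      (∀ x ∈ Set.Icc s t, ‖γ' x‖ ≤ K) → m t - m s ≤ K * (t - s) := by
    intro K s hs t ht hst hK
    rw [hsub s hs t ht hst]
    have hK0 : 0 ≤ K := (norm_nonneg _).trans (hK s (Set.left_mem_Icc.2 hst))
    exact ENNReal.toReal_le_of_le_ofReal (mul_nonneg hK0 (sub_nonneg.2 hst))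
      (hausdorffMeasure_image_Icc_le hγ hst hK)
  have hma : m a = 0 := by simp [hm]
  obtain ⟨K, hK⟩ := isCompact_Icc.exists_bound_of_continuousOn (s := Set.Icc a b) hγ'.continuousOn
  have hcont : ContinuousOn m (Set.Icc a b) := by
    have hlip : ∀ s ∈ Set.Icc a b, ∀ t ∈ Set.Icc a b, s ≤ t → |m t - m s| ≤ K * (t - s) := by
      intro s hs t ht hst
      rw [abs_of_nonneg ((norm_nonneg _).trans (hlow s hs t ht hst))]
      exact hup K s hs t ht hst fun x hx => hK x ⟨hs.1.trans hx.1, hx.2.trans ht.2⟩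
    refine LipschitzOnWith.continuousOn (K := K.toNNReal)
      (LipschitzOnWith.of_dist_le_mul fun s hs t ht => ?_)
    rw [Real.coe_toNNReal K ((norm_nonneg _).trans (hK s hs)), Real.dist_eq, Real.dist_eq]
    rcases le_total s t with hst | hst
    · rw [abs_sub_comm, abs_sub_comm s t, abs_of_nonneg (sub_nonneg.2 hst)]
      exact hlip s hs t ht hst
    · rw [abs_of_nonneg (sub_nonneg.2 hst)]
      exact hlip t ht s hs hst
  have hderiv : ∀ s ∈ Set.Ico a b, HasDerivWithinAt m ‖γ' s‖ (Set.Ioi s) s := by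
    intro s hs
    rw [hasDerivWithinAt_iff_tendsto_slope' (by simp)]
    have hs' : s ∈ Set.Icc a b := ⟨hs.1, hs.2.le⟩
    have hnear : ∀ᶠ t in 𝓝[>] s, t ∈ Set.Ioo s b := Ioo_mem_nhdsGT hs.2
    have h1 : Tendsto (fun t => ‖slope γ s t‖) (𝓝[>] s) (𝓝 ‖γ' s‖) :=
      ((hasDerivWithinAt_iff_tendsto_slope' (by simp)).1 (hγ s).hasDerivWithinAt).norm
    rw [tendsto_order]
    constructor
    · intro c hcl
      filter_upwards [(tendsto_order.1 h1).1 c hcl, hnear] with t ht htn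
      refine ht.trans_le ?_
      have hpos : 0 < t - s := sub_pos.2 htn.1
      rw [slope_def_module, slope_def_field, norm_smul, Real.norm_of_nonneg (by positivity),
        div_eq_inv_mul]
      exact mul_le_mul_of_nonneg_left (hlow s hs' t ⟨hs.1.trans htn.1.le, htn.2.le⟩ htn.1.le)
        (by positivity)
    · intro c hcl
      obtain ⟨c', hc1, hc2⟩ := exists_between hcl
      have h2 : ∀ᶠ x in 𝓝 s, ‖γ' x‖ < c' := hγ'.norm.continuousAt.eventually_lt_const hc1
      obtain ⟨δ, hδ, hball⟩ := Metric.eventually_nhds_iff.1 h2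
      have h3 : ∀ᶠ t in 𝓝[>] s, t ∈ Set.Ioo s (s + δ) := Ioo_mem_nhdsGT (by linarith)
      filter_upwards [h3, hnear] with t ht htn
      have hpos : 0 < t - s := sub_pos.2 htn.1
      rw [slope_def_field, div_lt_iff₀ hpos]
      refine (hup c' s hs' t ⟨hs.1.trans htn.1.le, htn.2.le⟩ htn.1.le fun x hx =>
        (hball ?_).le).trans_lt (mul_lt_mul_of_pos_right hc2 hpos)
      rw [Real.dist_eq, abs_of_nonneg (sub_nonneg.2 hx.1)]
      linarith [hx.2, ht.2]
  have h := intervalIntegral.integral_eq_sub_of_hasDeriv_right (f := m) (f' := fun x => ‖γ' x‖)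
    (a := a) (b := t) (by
      rw [Set.uIcc_of_le ht.1]
      exact hcont.mono (Set.Icc_subset_Icc_right ht.2)) (fun x hx => by
      rw [min_eq_left ht.1, max_eq_right ht.1] at hx
      exact hderiv x ⟨hx.1.le, hx.2.trans_le ht.2⟩) (hγ'.norm.intervalIntegrable _ _)
  rw [h, hma, sub_zero]

/-- The measure on the parameter interval that corresponds to arc length. -/
theorem map_comap_hausdorffMeasure (hγ : ∀ x, HasDerivAt γ (γ' x) x)
    (hγ' : Continuous γ') (hinj : Set.InjOn γ (Set.Icc a b)) :
    Measure.map Subtype.val (Measure.comap (fun x : Set.Icc a b => γ x) μH[1])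
      = (volume.restrict (Set.Icc a b)).withDensity fun x => ENNReal.ofReal ‖γ' x‖ := by
  have hc : Continuous γ := continuous_iff_continuousAt.2 fun x => (hγ x).continuousAt
  have he : MeasurableEmbedding fun x : Set.Icc a b => γ x :=
    ((hc.comp continuous_subtype_val).isClosedEmbedding
      (fun x y hxy => Subtype.ext (hinj x.2 y.2 hxy))).measurableEmbedding
  have hval : MeasurableEmbedding (Subtype.val : Set.Icc a b → ℝ) :=
    MeasurableEmbedding.subtype_coe measurableSet_Icc
  have hL : ∀ A, Measure.map Subtype.val (Measure.comap (fun x : Set.Icc a b => γ x) μH[1]) A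
      = μH[1] (γ '' (Set.Icc a b ∩ A)) := by
    intro A
    rw [hval.map_apply, he.comap_apply]
    congr 1
    ext x
    simp only [Set.mem_image, Set.mem_preimage, Subtype.exists, Set.mem_inter_iff]
    constructor
    · rintro ⟨y, hy, hyA, rfl⟩
      exact ⟨y, ⟨hy, hyA⟩, rfl⟩
    · rintro ⟨y, ⟨hy, hyA⟩, rfl⟩
      exact ⟨y, hy, hyA, rfl⟩
  have hI : ∀ t ∈ Set.Icc a b, μH[1] (γ '' Set.Icc a t)
      = ∫⁻ x in Set.Icc a t, ENNReal.ofReal ‖γ' x‖ := by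
    intro t ht
    have h1 := hausdorffMeasure_image_Icc hγ hγ' hinj ht
    rw [intervalIntegral.integral_of_le ht.1, ← integral_Icc_eq_integral_Ioc] at h1
    rw [← ofReal_integral_eq_lintegral_ofReal hγ'.norm.continuousOn.integrableOn_Icc
      (Eventually.of_forall fun _ => norm_nonneg _), ← h1, ENNReal.ofReal_toReal]
    obtain ⟨K, hK⟩ := isCompact_Icc.exists_bound_of_continuousOn
      (s := Set.Icc a t) hγ'.continuousOn
    exact ((hausdorffMeasure_image_Icc_le hγ ht.1 hK).trans_lt ENNReal.ofReal_lt_top).ne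
  have : IsFiniteMeasure (Measure.map Subtype.val
      (Measure.comap (fun x : Set.Icc a b => γ x) μH[1])) := by
    refine ⟨?_⟩
    rw [hL, Set.inter_univ]
    rcases le_or_gt a b with hab | hab
    · obtain ⟨K, hK⟩ := isCompact_Icc.exists_bound_of_continuousOn
        (s := Set.Icc a b) hγ'.continuousOn
      exact (hausdorffMeasure_image_Icc_le hγ hab hK).trans_lt ENNReal.ofReal_lt_top
    · simp [Set.Icc_eq_empty_of_lt hab]
  -- A finite measure on the line is determined by half-lines, on which the arc length formula
  -- applies.
  refine Measure.ext_of_Iic _ _ fun t => ?_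
  rw [hL, withDensity_apply _ measurableSet_Iic, Measure.restrict_restrict measurableSet_Iic,
    Set.inter_comm (Set.Iic t)]
  have h2 : Set.Icc a b ∩ Set.Iic t = Set.Icc a (min b t) := by
    ext x; simp [and_assoc]
  rw [h2]
  rcases le_or_gt a (min b t) with hat | hat
  · exact hI _ ⟨hat, min_le_left _ _⟩
  · simp [Set.Icc_eq_empty_of_lt hat]

/-- Integration along a curve with respect to arc length. -/
theorem integral_image_hausdorffMeasure (hγ : ∀ x, HasDerivAt γ (γ' x) x)
    (hγ' : Continuous γ') (hinj : Set.InjOn γ (Set.Icc a b)) (hab : a ≤ b) {g : E → ℝ} {F : ℝ → ℝ}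
    (hF : ContinuousOn F (Set.Icc a b))
    (hg : ∀ᵐ x ∂μH[1].restrict (γ '' Set.Icc a b), ∀ s ∈ Set.Icc a b, γ s = x → g x = F s) :
    IntegrableOn g (γ '' Set.Icc a b) μH[1] ∧
      ∫ x in γ '' Set.Icc a b, g x ∂μH[1] = ∫ s in a..b, ‖γ' s‖ * F s := by
  have hc : Continuous γ := continuous_iff_continuousAt.2 fun x => (hγ x).continuousAt
  have he : MeasurableEmbedding fun x : Set.Icc a b => γ x :=
    ((hc.comp continuous_subtype_val).isClosedEmbedding
      (fun x y hxy => Subtype.ext (hinj x.2 y.2 hxy))).measurableEmbedding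
  have hval : MeasurableEmbedding (Subtype.val : Set.Icc a b → ℝ) :=
    MeasurableEmbedding.subtype_coe measurableSet_Icc
  -- `g` is known only almost everywhere on the arc; `G` is a representative that follows `F` at
  -- every point of the parametrization.
  set G : E → ℝ := fun x => F (Function.invFunOn γ (Set.Icc a b) x) with hG
  have hinv : ∀ s ∈ Set.Icc a b, G (γ s) = F s := fun s hs => by
    rw [hG]
    exact congrArg F (hinj.leftInvOn_invFunOn hs)
  have hgG : g =ᵐ[μH[1].restrict (γ '' Set.Icc a b)] G := by
    have hmem := ae_restrict_mem (μ := (μH[1] : Measure E))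
      (isCompact_Icc.image hc : IsCompact (γ '' Set.Icc a b)).measurableSet
    filter_upwards [hg, hmem] with x hx hxm
    obtain ⟨s, hs, rfl⟩ := hxm
    rw [hx s hs rfl, hinv s hs]
  have hrange : Set.range (fun x : Set.Icc a b => γ x) = γ '' Set.Icc a b := by
    rw [← Set.image_eq_range]
  have hmeas : Measurable fun x => ENNReal.ofReal ‖γ' x‖ :=
    (hγ'.norm.measurable).ennreal_ofReal
  have h1 : μH[1].restrict (γ '' Set.Icc a b)
      = Measure.map (fun x : Set.Icc a b => γ x) (Measure.comap (fun x : Set.Icc a b => γ x) μH[1]) := by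
    rw [he.map_comap, hrange]
  have h2 : (G ∘ fun x : Set.Icc a b => γ x) = F ∘ Subtype.val :=
    funext fun x => hinv x x.2
  constructor
  · refine Integrable.congr ?_ hgG.symm
    rw [h1, he.integrable_map_iff, h2, ← hval.integrable_map_iff,
      map_comap_hausdorffMeasure hγ hγ' hinj, integrable_withDensity_iff_integrable_smul' hmeas
        (Eventually.of_forall fun _ => ENNReal.ofReal_lt_top)]
    refine ContinuousOn.integrableOn_Icc ?_
    simp only [ENNReal.toReal_ofReal (norm_nonneg _)]
    exact hγ'.norm.continuousOn.smul hF
  · rw [integral_congr_ae hgG, h1, he.integral_map]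
    have h3 : (fun x : Set.Icc a b => G (γ x)) = fun x : Set.Icc a b => F x := h2
    rw [h3, ← hval.integral_map F, map_comap_hausdorffMeasure hγ hγ' hinj,
      integral_withDensity_eq_integral_toReal_smul hmeas
        (Eventually.of_forall fun _ => ENNReal.ofReal_lt_top),
      intervalIntegral.integral_of_le hab, integral_Icc_eq_integral_Ioc]
    simp only [ENNReal.toReal_ofReal (norm_nonneg _), smul_eq_mul]

end Curve

/-! ### The facets of the reference triangle -/

/-- The linear functional given by the outward normal of a reference facet. -/
noncomputable def facetFun (f : Fin 3) : Pt →L[ℝ] ℝ :=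
  ∑ d, refNormal f d • (EuclideanSpace.proj (𝕜 := ℝ) d : Pt →L[ℝ] ℝ)

theorem facetFun_apply (f : Fin 3) (ξ : Pt) : facetFun f ξ = ∑ d, refNormal f d * ξ d := by
  simp [facetFun, Fin.sum_univ_two]

/-- Half-plane description: crossing a facet is seen by a single linear functional. -/
theorem mem_refTriangle_iff (ξ : Pt) :
    ξ ∈ refTriangle ↔ ∀ f, facetFun f ξ ≤ facetFun f (facetParam f 0) := by
  have h2 : 0 < √2 := by positivity
  have h3 : (√2)⁻¹ * ξ 0 + (√2)⁻¹ * ξ 1 ≤ 0 ↔ ξ 0 + ξ 1 ≤ 0 := by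
    rw [← mul_add, mul_nonpos_iff_pos_imp_nonpos]
    constructor
    · exact fun h => h.1 (by positivity)
    · exact fun h => ⟨fun _ => h, fun _ => by positivity⟩
  simp only [refTriangle, Set.mem_ofPred_eq, Fin.forall_fin_succ, facetFun_apply, Fin.sum_univ_two]
  simp [refNormal, facetParam, h3]
  constructor
  · rintro ⟨h1, h2, h3⟩
    exact ⟨h3, by linarith, by linarith⟩
  · rintro ⟨h1, h2, h3⟩
    exact ⟨by linarith, by linarith, h1⟩

theorem facetFun_facetParam (f : Fin 3) (s : ℝ) :
    facetFun f (facetParam f s) = facetFun f (facetParam f 0) := by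
  simp only [facetFun_apply, Fin.sum_univ_two]
  fin_cases f <;> simp [refNormal, facetParam]

theorem facetFun_facetParam_lt {f f' : Fin 3} (hf : f' ≠ f) {s : ℝ} (hs : s ∈ Set.Ioo (-1 : ℝ) 1) :
    facetFun f' (facetParam f s) < facetFun f' (facetParam f' 0) := by
  have h2 : 0 < √2 := by positivity
  obtain ⟨h3, h4⟩ := hs
  have h5 : (√2)⁻¹ * s < (√2)⁻¹ := mul_lt_of_lt_one_right (by positivity) h4
  have h6 : -(√2)⁻¹ < (√2)⁻¹ * s := by
    rw [neg_eq_neg_one_mul, mul_comm]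
    exact mul_lt_mul_of_pos_left h3 (by positivity)
  simp only [facetFun_apply, Fin.sum_univ_two]
  fin_cases f <;> fin_cases f' <;> simp [refNormal, facetParam] at hf ⊢ <;> linarith

theorem facetParam_injective (f : Fin 3) : Function.Injective (facetParam f) := by
  intro s t hst
  have h0 := congrArg (fun v : Pt => v 0) hst
  have h1 := congrArg (fun v : Pt => v 1) hst
  fin_cases f <;> simp [facetParam] at h0 h1 <;> linarith

theorem facetParam_mem_refVertices {f : Fin 3} {s : ℝ} (hs : s = -1 ∨ s = 1) :
    facetParam f s ∈ refVertices := by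
  rcases hs with rfl | rfl <;> fin_cases f <;> simp [facetParam, refVertices]

theorem mem_refVertices_of_facetParam_eq {f f' : Fin 3} (hf : f ≠ f') {s s' : ℝ}
    (hs : s ∈ Set.Icc (-1 : ℝ) 1) (h : facetParam f s = facetParam f' s') :
    facetParam f s ∈ refVertices := by
  rcases eq_or_lt_of_le hs.1 with h1 | h1
  · exact facetParam_mem_refVertices (Or.inl h1.symm)
  rcases eq_or_lt_of_le hs.2 with h2 | h2
  · exact facetParam_mem_refVertices (Or.inr h2)
  have h3 := facetFun_facetParam_lt hf.symm ⟨h1, h2⟩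
  rw [h, facetFun_facetParam] at h3
  exact absurd h3 (lt_irrefl _)

theorem finite_refVertices : refVertices.Finite := by
  rw [refVertices]
  exact Set.toFinite _

theorem facetParam_notMem_interior (f : Fin 3) (s : ℝ) :
    facetParam f s ∉ interior refTriangle := by
  intro h
  set n : Pt := WithLp.toLp 2 (refNormal f) with hn
  have h1 : Tendsto (fun t : ℝ => facetParam f s + t • n) (𝓝[>] 0) (𝓝 (facetParam f s)) := by
    have : Continuous fun t : ℝ => facetParam f s + t • n := by fun_prop
    simpa using (this.tendsto 0).mono_left nhdsWithin_le_nhds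
  obtain ⟨t, ht, ht0⟩ := ((h1.eventually (mem_interior_iff_mem_nhds.1 h)).and
    self_mem_nhdsWithin).exists
  have h2 := (mem_refTriangle_iff _).1 ht f
  rw [map_add, facetFun_facetParam, map_smul] at h2
  have h3 : facetFun f n = 1 := by
    rw [facetFun_apply, Fin.sum_univ_two, ← refNormal_sq f]
    simp [hn]
    ring
  rw [h3, smul_eq_mul, mul_one] at h2
  have h4 : (0 : ℝ) < t := ht0
  linarith

namespace PolyMap

variable (M : PolyMap)

/-- The transposed derivative carries the physical normal to a positive multiple of the reference
normal wherever `J > 0`, so inward directions correspond under the mapping. -/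
theorem sum_fderiv_mul_normal {f : Fin 3} {ξ : Pt} (hf : M.facetJac f ξ ≠ 0) (w : Pt) :
    M.facetJac f ξ * ∑ d, (fderiv ℝ M.toFun ξ w) d * M.normal f d ξ = M.jac ξ * facetFun f w := by
  have h1 : ∀ d, M.facetJac f ξ * ((fderiv ℝ M.toFun ξ w) d * M.normal f d ξ)
      = ∑ b, ∑ c, w b * refNormal f c * (M.metric d b ξ * M.cof d c ξ) := by
    intro d
    rw [mul_left_comm, M.facetJac_mul_normal hf, fderiv_toFun_apply, Finset.sum_mul_sum]
    exact Finset.sum_congr rfl fun b _ => Finset.sum_congr rfl fun c _ => by ring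
  rw [Finset.mul_sum]
  simp only [h1]
  rw [Finset.sum_comm]
  simp only [Finset.sum_comm (s := (Finset.univ : Finset (Fin 2))) (t := Finset.univ)
    (f := fun d c => _ * (M.metric d _ ξ * M.cof d c ξ))]
  simp only [← Finset.mul_sum, sum_metric_mul_cof, facetFun_apply]
  simp [Fin.sum_univ_two]
  ring

/-- Short segments from a facet point in inward directions stay inside the element. -/
theorem eventually_mem_image {f : Fin 3} {s : ℝ} (hs : s ∈ Set.Ioo (-1 : ℝ) 1)
    (hJ : 0 < M.jac (facetParam f s)) {v : Pt}
    (hv : ∑ d, v d * M.normal f d (facetParam f s) < 0) :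
    ∀ᶠ t in 𝓝[>] (0 : ℝ), M.facetCurve f s + t • v ∈ M.toFun '' refTriangle := by
  set ξ := facetParam f s with hξ
  have hdet : (fderiv ℝ M.toFun ξ).det ≠ 0 := by rw [det_fderiv_toFun]; exact hJ.ne'
  set A := (fderiv ℝ M.toFun ξ).toContinuousLinearEquivOfDetNeZero hdet with hA
  have hAc : (A : Pt →L[ℝ] Pt) = fderiv ℝ M.toFun ξ :=
    ContinuousLinearMap.coe_toContinuousLinearEquivOfDetNeZero _ _
  have hstrict : HasStrictFDerivAt M.toFun (A : Pt →L[ℝ] Pt) ξ := by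
    rw [hAc]
    exact ((M.contDiff_toFun (n := 1)).contDiffAt).hasStrictFDerivAt one_ne_zero
  set g := hstrict.localInverse M.toFun A ξ with hg
  have hg0 : g (M.toFun ξ) = ξ := hstrict.localInverse_apply_image
  set w := A.symm v with hw
  have hAw : fderiv ℝ M.toFun ξ w = v := by
    rw [← hAc]; exact A.apply_symm_apply v
  have hfJ : 0 < M.facetJac f ξ := M.facetJac_pos hJ
  have hwneg : facetFun f w < 0 := by
    have h1 := M.sum_fderiv_mul_normal hfJ.ne' w
    rw [hAw] at h1
    by_contra hcon
    have h2 : 0 ≤ M.jac ξ * facetFun f w := mul_nonneg hJ.le (not_lt.1 hcon)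
    rw [← h1] at h2
    exact absurd h2 (not_le.2 (mul_neg_of_pos_of_neg hfJ hv))
  have hline : HasDerivAt (fun t : ℝ => M.toFun ξ + t • v) v 0 := by
    simpa using ((hasDerivAt_id (0 : ℝ)).smul_const v).const_add (M.toFun ξ)
  have hc : HasDerivAt (fun t : ℝ => g (M.toFun ξ + t • v)) w 0 := by
    have h1 : HasFDerivAt g (A.symm : Pt →L[ℝ] Pt) (M.toFun ξ + (0 : ℝ) • v) := by
      rw [zero_smul, add_zero]
      exact hstrict.to_localInverse.hasFDerivAt
    exact h1.comp_hasDerivAt (0 : ℝ) hline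
  have hφ : ∀ f', HasDerivAt (fun t : ℝ => facetFun f' (g (M.toFun ξ + t • v)))
      (facetFun f' w) 0 := fun f' => (facetFun f').hasFDerivAt.comp_hasDerivAt (0 : ℝ) hc
  have hφ0 : ∀ f', facetFun f' (g (M.toFun ξ + (0 : ℝ) • v)) = facetFun f' ξ := by
    intro f'
    rw [zero_smul, add_zero, hg0]
  -- The segment is pulled back by the local inverse. The constraint of facet `f` is active at `ξ`
  -- and has negative derivative along `w`; the other two are strict, because `s` is not an end
  -- point, and persist by continuity.
  have hin : ∀ f', ∀ᶠ t in 𝓝[>] (0 : ℝ),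
      facetFun f' (g (M.toFun ξ + t • v)) ≤ facetFun f' (facetParam f' 0) := by
    intro f'
    by_cases hff : f' = f
    · subst hff
      have h1 := (hasDerivWithinAt_iff_tendsto_slope' (by simp)).1
        ((hφ f').hasDerivWithinAt (s := Set.Ioi 0))
      filter_upwards [h1.eventually_lt_const hwneg, self_mem_nhdsWithin] with t ht ht0
      rw [slope_def_field, hφ0, sub_zero, div_lt_iff₀ (ht0 : (0 : ℝ) < t), zero_mul, hξ,
        facetFun_facetParam] at ht
      linarith
    · have h1 := (hφ f').continuousAt.eventually_lt_const
        (u := facetFun f' (facetParam f' 0)) (by beta_reduce; rw [hφ0]; exact facetFun_facetParam_lt hff hs)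
      exact (h1.filter_mono nhdsWithin_le_nhds).mono fun t ht => ht.le
  have hinv : ∀ᶠ t in 𝓝[>] (0 : ℝ), M.toFun (g (M.toFun ξ + t • v)) = M.toFun ξ + t • v := by
    have h1 : Tendsto (fun t : ℝ => M.toFun ξ + t • v) (𝓝[>] 0) (𝓝 (M.toFun ξ)) := by
      simpa using hline.continuousAt.tendsto.mono_left nhdsWithin_le_nhds
    exact h1.eventually hstrict.eventually_right_inverse
  filter_upwards [eventually_all.2 hin, hinv] with t ht hti
  exact ⟨_, (mem_refTriangle_iff _).2 ht, hti⟩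

/-- The outward unit normal of the domain at a facet point is that of the element. -/
theorem eq_normal_of_isOutwardUnitNormal {Ω : Set Pt} (hΩ : M.toFun '' refTriangle ⊆ Ω) {f : Fin 3}
    {s : ℝ} (hs : s ∈ Set.Ioo (-1 : ℝ) 1) (hJ : 0 < M.jac (facetParam f s)) {n : Pt}
    (hn : IsOutwardUnitNormal Ω (M.facetCurve f s) n) :
    n = WithLp.toLp 2 fun d => M.normal f d (facetParam f s) := by
  set nk : Pt := WithLp.toLp 2 fun d => M.normal f d (facetParam f s) with hnk
  have hin : ∀ v : Pt, inner ℝ v nk = ∑ d, v d * M.normal f d (facetParam f s) := by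
    intro v
    simp [PiLp.inner_apply, hnk, mul_comm]
  have hnk1 : ‖nk‖ = 1 := by
    rw [EuclideanSpace.norm_eq, Fin.sum_univ_two, Real.sqrt_eq_one]
    simp only [Real.norm_eq_abs, sq_abs]
    exact M.normal_sq (M.facetJac_pos hJ).ne'
  -- Strictly inward directions of the element remain in `Ω` for a short time, so they cannot point
  -- out of `Ω`.
  have key : ∀ v : Pt, inner ℝ v nk < 0 → inner ℝ v n ≤ 0 := by
    intro v hv
    by_contra hcon
    rw [hin] at hv
    obtain ⟨t, h1, h2⟩ := ((M.eventually_mem_image hs hJ hv).and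
      ((hn.2 v).2 (not_le.1 hcon))).exists
    exact h2 (hΩ h1)
  by_contra hne
  have hlt : inner ℝ n nk < (1 : ℝ) := by
    refine lt_of_le_of_ne ?_ fun h => hne ((inner_eq_one_iff_of_norm_eq_one hn.1 hnk1).1 h)
    simpa [hn.1, hnk1] using real_inner_le_norm n nk
  -- For distinct unit vectors, `n - nk` has negative product with `nk` and positive product with
  -- `n`.
  have h1 := key (n - nk) (by
    rw [inner_sub_left, real_inner_self_eq_norm_sq, hnk1]
    linarith)
  rw [inner_sub_left, real_inner_self_eq_norm_sq, hn.1, real_inner_comm] at h1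
  linarith

theorem continuous_tangent (f : Fin 3) (a : Fin 2) : Continuous (M.tangent f a) :=
  continuous_finsetSum _ fun _ _ => ((contDiff_polyEval _ (n := 0)).continuous).mul
    continuous_const

theorem continuous_facetParam (f : Fin 3) : Continuous (facetParam f) :=
  continuous_iff_continuousAt.2 fun s => (hasDerivAt_facetParam f s).continuousAt

theorem continuous_facetCurve (f : Fin 3) : Continuous (M.facetCurve f) :=
  continuous_iff_continuousAt.2 fun s => (M.hasDerivAt_facetCurve f s).continuousAt

theorem injOn_facetCurve (hM : Set.InjOn M.toFun refTriangle) (f : Fin 3) :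
    Set.InjOn (M.facetCurve f) (Set.Icc (-1) 1) := fun _ hs _ ht hst =>
  facetParam_injective f (hM (facetParam_mem_refTriangle f hs) (facetParam_mem_refTriangle f ht) hst)

/-- Integration over a physical facet. -/
theorem integral_facet (hM : Set.InjOn M.toFun refTriangle) (f : Fin 3) {g : Pt → ℝ} {F : ℝ → ℝ}
    (hF : ContinuousOn F (Set.Icc (-1) 1))
    (hg : ∀ᵐ x ∂μH[1].restrict (M.facetCurve f '' Set.Icc (-1) 1), ∀ s ∈ Set.Icc (-1 : ℝ) 1,
      M.facetCurve f s = x → g x = F s) :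
    IntegrableOn g (M.facetCurve f '' Set.Icc (-1) 1) μH[1] ∧
      ∫ x in M.facetCurve f '' Set.Icc (-1) 1, g x ∂μH[1]
        = ∫ s in (-1 : ℝ)..1, refHalfLength f * M.facetJac f (facetParam f s) * F s := by
  have hγ' : Continuous fun s =>
      (refHalfLength f • WithLp.toLp 2 fun a => M.tangent f a (facetParam f s) : Pt) := by
    have h1 : Continuous fun s a => M.tangent f a (facetParam f s) :=
      continuous_pi fun a => (M.continuous_tangent f a).comp (continuous_facetParam f)
    exact ((PiLp.continuous_toLp 2 fun _ : Fin 2 => ℝ).comp h1).const_smul (refHalfLength f)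
  have h1 := integral_image_hausdorffMeasure (M.hasDerivAt_facetCurve f) hγ'
    (M.injOn_facetCurve hM f) (by norm_num) hF hg
  refine ⟨h1.1, h1.2.trans ?_⟩
  refine intervalIntegral.integral_congr fun s _ => ?_
  simp only [norm_smul, Real.norm_of_nonneg (refHalfLength_pos f).le, facetJac_eq]

end PolyMap

/-! ### Integrals over the boundary parts -/

namespace Mesh

variable {p : ℕ} {m : Mesh p}

/-- Within one element, injectivity reduces the claim to facets of the triangle. Between two
elements, conformity leaves either vertices or a common interior facet, which differs from the given
boundary facet and meets it in a vertex. -/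
theorem facetSet_inter_subset {k k' : Fin m.ne} {f f' : Fin 3} {κ : FacetKind m.ne}
    (hκ : ∀ v g, κ ≠ .interior v g) (hk : m.kind k f = κ) (hne : (k, f) ≠ (k', f')) :
    m.facetSet k f ∩ m.facetSet k' f' ⊆ (m.map k).toFun '' refVertices := by
  rintro x ⟨⟨s, hs, rfl⟩, s', hs', hss⟩
  refine ⟨facetParam f s, ?_, rfl⟩
  by_cases hkk : k = k'
  · subst hkk
    have hff : f ≠ f' := fun h => hne (by rw [h])
    exact mem_refVertices_of_facetParam_eq hff hs (m.injOn k (facetParam_mem_refTriangle f hs)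
      (facetParam_mem_refTriangle f' hs') hss.symm)
  · rcases m.conforming k k' hkk _ (facetParam_mem_refTriangle f hs) _
      (facetParam_mem_refTriangle f' hs') hss.symm with h | ⟨f₁, f₂, t, h1, _, h3, _⟩
    · exact h.1
    · refine mem_refVertices_of_facetParam_eq (f' := f₁) (s' := t) ?_ hs h3
      rintro rfl
      exact hκ _ _ (hk.symm.trans h1)

open Classical in
theorem integral_boundary {κ : FacetKind m.ne} (hκ : ∀ v g, κ ≠ .interior v g) {Γ : Set Pt}
    (hΓ : ⋃ k, ⋃ f, ⋃ _ : m.kind k f = κ, m.facetSet k f = Γ) {g : Pt → ℝ}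
    {F : Fin m.ne → Fin 3 → ℝ → ℝ} (hF : ∀ k f, ContinuousOn (F k f) (Set.Icc (-1) 1))
    (hg : ∀ k f, m.kind k f = κ → ∀ᵐ x ∂μH[1].restrict (m.facetSet k f),
      ∀ s ∈ Set.Icc (-1 : ℝ) 1, (m.map k).facetCurve f s = x → g x = F k f s) :
    ∫ x in Γ, g x ∂μH[1] = ∑ k, ∑ f, if m.kind k f = κ then ∫ s in (-1 : ℝ)..1,
      refHalfLength f * (m.map k).facetJac f (facetParam f s) * F k f s else 0 := by
  have : NullSingletonClass (μH[1] : Measure Pt) :=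
    Measure.nullSingletonClass_hausdorff Pt one_pos
  let I := {a : Fin m.ne × Fin 3 // m.kind a.1 a.2 = κ}
  have hint := fun a : I => (m.map a.1.1).integral_facet (m.injOn a.1.1) a.1.2 (hF a.1.1 a.1.2)
    (hg a.1.1 a.1.2 a.2)
  have hΓ' : Γ = ⋃ a : I, m.facetSet a.1.1 a.1.2 := by
    rw [← hΓ]
    ext x
    simp [I]
  have hmeas : ∀ a : I, NullMeasurableSet (m.facetSet a.1.1 a.1.2) μH[1] := fun a =>
    (isCompact_Icc.image
      ((m.map a.1.1).continuous_facetCurve a.1.2)).measurableSet.nullMeasurableSet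
  have hdisj : Pairwise (Function.onFun (AEDisjoint μH[1])
      fun a : I => m.facetSet a.1.1 a.1.2) := by
    intro a b hab
    refine measure_mono_null (facetSet_inter_subset hκ a.2 fun h => hab (Subtype.ext h)) ?_
    exact (finite_refVertices.image _).measure_zero _
  rw [hΓ', integral_iUnion_ae hmeas hdisj (integrableOn_finite_iUnion.2 fun a => (hint a).1),
    tsum_fintype, ← Fintype.sum_prod_type', ← Finset.sum_filter]
  rw [Finset.sum_subtype (p := fun a : Fin m.ne × Fin 3 => m.kind a.1 a.2 = κ) _ (by simp)]
  exact Finset.sum_congr rfl fun a _ => (hint a).2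

/-- The two end points are discarded as a null set, because the comparison of normals needs an
interior parameter. -/
theorem ae_facetSet_normal {Ω : Set Pt} {ν : Pt → Pt} {k : Fin m.ne} {f : Fin 3}
    (hΩ : (m.map k).toFun '' refTriangle ⊆ Ω)
    (hν : ∀ᵐ x ∂(μH[1] : Measure Pt).restrict (m.facetSet k f), IsOutwardUnitNormal Ω x (ν x)) :
    ∀ᵐ x ∂(μH[1] : Measure Pt).restrict (m.facetSet k f), ∀ s ∈ Set.Icc (-1 : ℝ) 1,
      (m.map k).facetCurve f s = x →
        ν x = WithLp.toLp 2 fun d => (m.map k).normal f d (facetParam f s) := by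
  have : NullSingletonClass (μH[1] : Measure Pt) :=
    Measure.nullSingletonClass_hausdorff Pt one_pos
  have h1 : ∀ y : Pt, ∀ᵐ x ∂(μH[1] : Measure Pt).restrict (m.facetSet k f), x ≠ y := fun y =>
    ae_restrict_of_ae (Measure.ae_ne _ y)
  filter_upwards [hν, h1 ((m.map k).facetCurve f (-1)), h1 ((m.map k).facetCurve f 1)]
    with x hx hx1 hx2 s hs hsx
  subst hsx
  refine (m.map k).eq_normal_of_isOutwardUnitNormal hΩ ⟨?_, ?_⟩
    (m.jac_pos k _ (facetParam_mem_refTriangle f hs)) hx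
  · exact lt_of_le_of_ne hs.1 fun h => hx1 (by rw [h])
  · exact lt_of_le_of_ne hs.2 fun h => hx2 (by rw [h])

end Mesh

/-! ### Exactness of the reference quadrature rules -/

theorem exists_pderiv_eq (q : MvPolynomial (Fin 2) ℝ) :
    ∃ Q : MvPolynomial (Fin 2) ℝ, Q.totalDegree ≤ q.totalDegree + 1 ∧
      MvPolynomial.pderiv 1 Q = q := by
  refine ⟨∑ s ∈ q.support, MvPolynomial.monomial (s + Finsupp.single 1 1)
    (q.coeff s / (s 1 + 1)), ?_, ?_⟩
  · refine MvPolynomial.totalDegree_finsetSum_le fun s hs => ?_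
    refine (MvPolynomial.totalDegree_monomial_le _ _).trans ?_
    have h1 := MvPolynomial.le_totalDegree hs
    rw [Finsupp.sum_add_index' (fun _ => rfl) (fun _ _ _ => rfl), Finsupp.sum_single_index rfl]
    exact Nat.add_le_add_right h1 1
  · conv_rhs => rw [q.as_sum]
    rw [map_sum]
    refine Finset.sum_congr rfl fun s _ => ?_
    have h1 : (s 1 : ℝ) + 1 ≠ 0 := by positivity
    rw [MvPolynomial.pderiv_monomial, add_tsub_cancel_right]
    congr 1
    simp [h1]

theorem exists_polynomial_facetParam (q : MvPolynomial (Fin 2) ℝ) (f : Fin 3) :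
    ∃ P : Polynomial ℝ, P.natDegree ≤ q.totalDegree ∧
      ∀ s, P.eval s = polyEval q (facetParam f s) := by
  set φ : Fin 2 → Polynomial ℝ := fun i =>
    Polynomial.C (facetParam f 0 i) + Polynomial.C (facetParam f 1 i - facetParam f 0 i) *
      Polynomial.X with hφ
  have hev : ∀ s i, (φ i).eval s = facetParam f s i := by
    intro s i
    fin_cases f <;> fin_cases i <;> simp [hφ, facetParam]
  refine ⟨MvPolynomial.aeval φ q, ?_, fun s => ?_⟩
  · refine (MvPolynomial.aeval_natDegree_le q le_rfl φ (n := 1) fun i => ?_).trans (by simp)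
    simp only [hφ]
    rw [add_comm]
    exact Polynomial.natDegree_linear_le
  · have h1 := MvPolynomial.comp_aeval_apply (f := φ) (Polynomial.aeval (R := ℝ) s) q
    rw [Polynomial.coe_aeval_eq_eval] at h1
    rw [h1, polyEval, MvPolynomial.aeval_eq_eval]
    simp only [hev]

theorem RefOperator.IsSBP.facet_polyEval {np nf p : ℕ} {op : RefOperator np nf} (hop : op.IsSBP p)
    (f : Fin 3) {q : MvPolynomial (Fin 2) ℝ} (hq : q.totalDegree ≤ 2 * p) :
    ∑ l, op.facetWeight l * polyEval q (op.facetPt f l)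
      = ∫ s in (-1 : ℝ)..1, polyEval q (facetParam f s) := by
  obtain ⟨P, hP, hPe⟩ := exists_polynomial_facetParam q f
  have h1 := hop.facet_exact P (hP.trans hq)
  simp only [hPe] at h1
  exact h1

theorem integral_refTriangle {g : Pt → ℝ} (hg : Continuous g) :
    ∫ ξ in refTriangle, g ξ = ∫ x in (-1 : ℝ)..1, ∫ y in (-1 : ℝ)..(-x), g !₂[x, y] := by
  let e : Pt ≃ᵐ ℝ × ℝ := (MeasurableEquiv.toLp 2 (Fin 2 → ℝ)).symm.trans MeasurableEquiv.finTwoArrow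
  have he : MeasurePreserving e volume volume :=
    (volume_preserving_finTwoArrow ℝ).comp
      (EuclideanSpace.volume_preserving_symm_measurableEquiv_toLp (Fin 2))
  have hes : ∀ z : ℝ × ℝ, e.symm z = !₂[z.1, z.2] := fun z => rfl
  have hm : MeasurableSet refTriangle := isCompact_refTriangle.measurableSet
  have hint : Integrable (refTriangle.indicator g) :=
    (hg.continuousOn.integrableOn_compact isCompact_refTriangle).integrable_indicator hm
  have h1 : ∫ ξ in refTriangle, g ξ = ∫ z : ℝ × ℝ, refTriangle.indicator g (e.symm z) := by
    rw [← integral_indicator hm, ← he.symm.integral_comp e.symm.measurableEmbedding]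
  have h2 : Integrable (fun z : ℝ × ℝ => refTriangle.indicator g (e.symm z)) (volume.prod volume) :=
    (he.symm.integrable_comp_emb e.symm.measurableEmbedding).2 hint
  rw [h1, Measure.volume_eq_prod, integral_prod _ h2,
    intervalIntegral.integral_of_le (by norm_num), ← integral_Icc_eq_integral_Ioc,
    ← integral_indicator measurableSet_Icc]
  refine integral_congr_ae (Eventually.of_forall fun x => ?_)
  simp only [hes]
  by_cases hx : x ∈ Set.Icc (-1 : ℝ) 1
  · rw [Set.indicator_of_mem hx, intervalIntegral.integral_of_le (by linarith [hx.2]),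
      ← integral_Icc_eq_integral_Ioc, ← integral_indicator measurableSet_Icc]
    congr 1
    funext y
    by_cases hy : y ∈ Set.Icc (-1) (-x)
    · rw [Set.indicator_of_mem hy, Set.indicator_of_mem]
      exact ⟨by simpa using hx.1, by simpa using hy.1, by simpa using by linarith [hy.2]⟩
    · rw [Set.indicator_of_notMem hy, Set.indicator_of_notMem]
      rintro ⟨_, h4, h5⟩
      refine hy ⟨by simpa using h4, ?_⟩
      have : x + y ≤ 0 := by simpa using h5
      linarith
  · rw [Set.indicator_of_notMem hx]
    refine integral_eq_zero_of_ae (Eventually.of_forall fun y => Set.indicator_of_notMem ?_ _)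
    rintro ⟨h3, h4, h5⟩
    have h3' : -1 ≤ x := by simpa using h3
    have h4' : -1 ≤ y := by simpa using h4
    have h5' : x + y ≤ 0 := by simpa using h5
    exact hx ⟨h3', by linarith⟩

theorem integral_pderiv_one (Q : MvPolynomial (Fin 2) ℝ) :
    ∫ ξ in refTriangle, polyEval (MvPolynomial.pderiv 1 Q) ξ
      = (∫ s in (-1 : ℝ)..1, polyEval Q (facetParam 0 s))
        - ∫ s in (-1 : ℝ)..1, polyEval Q (facetParam 2 s) := by
  have hc : ∀ q : MvPolynomial (Fin 2) ℝ, Continuous (polyEval q) := fun q =>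
    (contDiff_polyEval q (n := 0)).continuous
  rw [integral_refTriangle (hc _)]
  have h1 : ∀ x : ℝ, ∫ y in (-1 : ℝ)..(-x), polyEval (MvPolynomial.pderiv 1 Q) !₂[x, y]
      = polyEval Q !₂[x, -x] - polyEval Q !₂[x, -1] := by
    intro x
    have hline : ∀ y : ℝ, HasDerivAt (fun y : ℝ => (!₂[x, y] : Pt)) (EuclideanSpace.single 1 1) y := by
      intro y
      have h2 : (fun y : ℝ => (!₂[x, y] : Pt))
          = fun y => (!₂[x, 0] : Pt) + y • (EuclideanSpace.single 1 1 : Pt) := by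
        funext y
        ext a
        fin_cases a <;> simp
      rw [h2]
      simpa using ((hasDerivAt_id y).smul_const (EuclideanSpace.single 1 1 : Pt)).const_add (!₂[x, 0] : Pt)
    have hder : ∀ y : ℝ, HasDerivAt (fun y : ℝ => polyEval Q !₂[x, y])
        (polyEval (MvPolynomial.pderiv 1 Q) !₂[x, y]) y := by
      intro y
      rw [← fderiv_polyEval_single]
      exact ((contDiff_polyEval Q (n := 1)).differentiable one_ne_zero
        _).hasFDerivAt.comp_hasDerivAt y (hline y)
    refine intervalIntegral.integral_eq_sub_of_hasDerivAt (fun y _ => hder y)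
      (Continuous.intervalIntegrable ?_ _ _)
    exact (hc _).comp (continuous_iff_continuousAt.2 fun y => (hline y).continuousAt)
  simp only [h1]
  have hc0 : Continuous fun s : ℝ => polyEval Q !₂[s, -s] := by
    refine ((hc Q).comp ((PolyMap.continuous_facetParam 0).comp continuous_neg)).congr fun s => ?_
    simp [facetParam]
  have hc2 : Continuous fun s : ℝ => polyEval Q !₂[s, -1] :=
    (hc Q).comp (PolyMap.continuous_facetParam 2)
  rw [intervalIntegral.integral_sub (hc0.intervalIntegrable _ _) (hc2.intervalIntegrable _ _)]
  congr 1
  have h3 := intervalIntegral.integral_comp_neg (a := (-1 : ℝ)) (b := 1)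
    fun s => polyEval Q !₂[s, -s]
  simp only [neg_neg] at h3
  exact h3.symm

/-- Degree `2 * p - 1` of the volume rule is a consequence of the SBP property. Write `q` as the
second partial derivative of some `Q` of degree at most `2 * p`: the discrete and the continuous
divergence theorem both reduce to facet terms of `Q`, where the facet rule is exact. The left facet
drops out, its normal having no second component, and on the hypotenuse the half length `√2` cancels
`1 / √2`. -/
theorem RefOperator.IsSBP.volume_polyEval {np nf p : ℕ} {op : RefOperator np nf} (hop : op.IsSBP p)
    {q : MvPolynomial (Fin 2) ℝ} (hq : q.totalDegree + 1 ≤ 2 * p) :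
    ∑ j, op.H j * polyEval q (op.node j) = ∫ ξ in refTriangle, polyEval q ξ := by
  obtain ⟨Q, hQ, rfl⟩ := exists_pderiv_eq q
  rw [hop.div_exact 1 (hQ.trans hq), integral_pderiv_one, ← hop.facet_polyEval 0 (hQ.trans hq),
    ← hop.facet_polyEval 2 (hQ.trans hq)]
  have h2 : √2 ≠ 0 := by positivity
  simp [Fin.sum_univ_three, RefOperator.Bhat, refHalfLength, refNormal, Finset.sum_neg_distrib,
    sub_eq_add_neg]
  refine Finset.sum_congr rfl fun l _ => ?_
  field_simp

/-! ### Quadrature errors of scaled families -/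

section Families

variable {ι : Type*} {h : ι → Set.Ioc (0 : ℝ) 1} {np nf p e : ℕ} {op : RefOperator np nf}
  {φ : ι → Pt → ℝ}

/-- Approximation of degree `2 * p - 1` needs only `2 * p` derivatives, all that the source `G`
offers. For the physical integral the Jacobian contributes `e = 2`. -/
theorem RefOperator.IsSBP.volume_quadrature (hop : op.IsSBP p) (hp : 1 ≤ p)
    (hφ : Scaled h (2 * p) e φ) :
    BigOh h (e + 2 * p) fun i => ∑ j, op.H j * φ i (op.node j) - ∫ ξ in refTriangle, φ i ξ := by
  obtain ⟨q, hq, hqs, ⟨K, hK⟩, -⟩ := hφ.exists_polynomial (m := 2 * p - 1) (by omega)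
  have he : e + (2 * p - 1) + 1 = e + 2 * p := by omega
  rw [he] at hK
  have h1 : BigOh h (e + 2 * p) fun i =>
      ∑ j, op.H j * (φ i (op.node j) - polyEval (q i) (op.node j)) :=
    BigOh.sum fun j _ => BigOh.const_mul _ ⟨K, fun i => hK i _ (hop.node_mem j)⟩
  have h2 : BigOh h (e + 2 * p) fun i => ∫ ξ in refTriangle, (φ i ξ - polyEval (q i) ξ) := by
    refine ⟨K * (volume refTriangle).toReal, fun i => ?_⟩
    have := norm_setIntegral_le_of_norm_le_const (μ := volume)
      isCompact_refTriangle.measure_lt_top fun ξ hξ => (Real.norm_eq_abs _).trans_le (hK i ξ hξ)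
    rw [Real.norm_eq_abs] at this
    refine this.trans (le_of_eq ?_)
    rw [Measure.real]
    ring
  refine (h1.sub h2).congr fun i => ?_
  have hT := isCompact_refTriangle
  rw [integral_sub ((hφ.contDiffOn i).continuousOn.integrableOn_compact hT)
    ((contDiff_polyEval (q i) (n := 0)).continuous.continuousOn.integrableOn_compact hT),
    ← hop.volume_polyEval (q := q i) (by have := hq i; omega)]
  simp only [mul_sub, Finset.sum_sub_distrib]
  ring

theorem Scaled.continuousOn_facetParam {N : ℕ} (hφ : Scaled h N e φ) (i : ι) (f : Fin 3) :
    ContinuousOn (fun s => φ i (facetParam f s)) (Set.Icc (-1) 1) :=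
  (hφ.contDiffOn i).continuousOn.comp (PolyMap.continuous_facetParam f).continuousOn
    fun _ hs => facetParam_mem_refTriangle f hs

theorem RefOperator.IsSBP.facet_quadrature (hop : op.IsSBP p) (hφ : Scaled h (2 * p + 1) e φ)
    (f : Fin 3) :
    BigOh h (e + 2 * p + 1) fun i => ∑ l, op.facetWeight l * φ i (op.facetPt f l)
      - ∫ s in (-1 : ℝ)..1, φ i (facetParam f s) := by
  obtain ⟨q, hq, hqs, ⟨K, hK⟩, -⟩ := hφ.exists_polynomial (m := 2 * p) le_rfl
  have h1 : BigOh h (e + 2 * p + 1) fun i =>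
      ∑ l, op.facetWeight l * (φ i (op.facetPt f l) - polyEval (q i) (op.facetPt f l)) :=
    BigOh.sum fun l _ => BigOh.const_mul _ ⟨K, fun i => hK i _ (hop.facetPt_mem f l)⟩
  have h2 : BigOh h (e + 2 * p + 1) fun i =>
      ∫ s in (-1 : ℝ)..1, (φ i (facetParam f s) - polyEval (q i) (facetParam f s)) := by
    refine ⟨K * |1 - (-1)|, fun i => ?_⟩
    have := intervalIntegral.norm_integral_le_of_norm_le_const (a := (-1 : ℝ)) (b := 1)
      (f := fun s => φ i (facetParam f s) - polyEval (q i) (facetParam f s))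
      (C := K * (h i : ℝ) ^ (e + 2 * p + 1)) fun s hs => by
        rw [Set.uIoc_of_le (by norm_num)] at hs
        exact hK i _ (facetParam_mem_refTriangle f ⟨hs.1.le, hs.2⟩)
    rw [Real.norm_eq_abs] at this
    refine this.trans (le_of_eq ?_)
    ring
  refine (h1.sub h2).congr fun i => ?_
  have hi1 : IntervalIntegrable (fun s => φ i (facetParam f s)) volume (-1) 1 :=
    ContinuousOn.intervalIntegrable_of_Icc (by norm_num) (hφ.continuousOn_facetParam i f)
  have hi2 : IntervalIntegrable (fun s => polyEval (q i) (facetParam f s)) volume (-1) 1 :=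
    (((contDiff_polyEval (q i) (n := 0)).continuous).comp
      (PolyMap.continuous_facetParam f)).intervalIntegrable _ _
  rw [intervalIntegral.integral_sub hi1 hi2, ← hop.facet_polyEval f (hq i)]
  simp only [mul_sub, Finset.sum_sub_distrib]
  ring

namespace ElemFamily

variable {M : ι → PolyMap}

theorem volume_quadrature (hM : ElemFamily h M) (hop : op.IsSBP p) (hp : 1 ≤ p)
    (hφ : Scaled h (2 * p) 0 φ) :
    BigOh h (2 * p + 2) fun i => ∑ j, (M i).H op j * φ i (op.node j)
      - ∫ ξ in refTriangle, (M i).jac ξ * φ i ξ := by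
  have h1 := hop.volume_quadrature hp ((hM.jac (2 * p)).mul hφ)
  rw [show 2 + 0 + 2 * p = 2 * p + 2 by ring] at h1
  refine h1.congr fun i => ?_
  refine congrArg₂ (· - ·) (Finset.sum_congr rfl fun j _ => ?_) rfl
  rw [PolyMap.H]
  ring

theorem facet_quadrature (hM : ElemFamily h M) (hop : op.IsSBP p) {v : Fin 2 → ι → Pt → ℝ}
    (hv : ∀ a, Scaled h (2 * p + 1) 0 (v a)) (hφ : Scaled h (2 * p + 1) 0 φ) (f : Fin 3) :
    BigOh h (2 * p + 2) fun i =>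
      ((M i).normalComp op f fun a => v a i) ⬝ᵥ ((M i).B op f *ᵥ op.facetNodal f (φ i))
      - ∫ s in (-1 : ℝ)..1, refHalfLength f * (M i).facetJac f (facetParam f s) *
          ((∑ a, v a i (facetParam f s) * (M i).normal f a (facetParam f s)) *
            φ i (facetParam f s)) := by
  -- The facet Jacobian is a square root, but its product with the normal is the polynomial cofactor
  -- combination, which is scaled of order 1.
  have h0 : Scaled h (2 * p + 1) 1 fun i ξ =>
      (∑ a, (∑ b, refNormal f b * (M i).cof a b ξ) * v a i ξ) * φ i ξ :=
    (Scaled.sum fun a _ => (Scaled.sum fun b _ =>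
      (hM.cof (2 * p + 1) a b).const_mul _).mul (hv a)).mul hφ
  have h1 := (hop.facet_quadrature h0 f).const_mul (refHalfLength f)
  rw [show 1 + 2 * p + 1 = 2 * p + 2 by ring] at h1
  have key : ∀ i, ∀ ξ ∈ refTriangle, (M i).facetJac f ξ *
      ((∑ a, v a i ξ * (M i).normal f a ξ) * φ i ξ)
      = (∑ a, (∑ b, refNormal f b * (M i).cof a b ξ) * v a i ξ) * φ i ξ := by
    intro i ξ hξ
    have hJ := ((M i).facetJac_pos (f := f) (hM.jac_pos i ξ hξ)).ne'
    have h2 : ∀ a, ∑ b, refNormal f b * (M i).cof a b ξ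
        = (M i).facetJac f ξ * (M i).normal f a ξ := by
      intro a
      rw [(M i).facetJac_mul_normal hJ]
      exact Finset.sum_congr rfl fun b _ => mul_comm _ _
    simp only [h2]
    rw [← mul_assoc, Finset.mul_sum]
    congr 1
    exact Finset.sum_congr rfl fun a _ => by ring
  refine h1.congr fun i => ?_
  rw [mul_sub, ← intervalIntegral.integral_const_mul]
  congr 1
  · rw [Finset.mul_sum, dotProduct]
    refine Finset.sum_congr rfl fun l _ => ?_
    rw [PolyMap.B_mulVec, ← key i _ (hop.facetPt_mem f l), RefOperator.Bhat]
    simp only [PolyMap.normalComp, RefOperator.facetNodal, Finset.sum_mul, Finset.mul_sum]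
    exact Finset.sum_congr rfl fun a _ => by ring
  · refine intervalIntegral.integral_congr fun s hs => ?_
    rw [Set.uIcc_of_le (by norm_num)] at hs
    rw [← key i _ (facetParam_mem_refTriangle f hs), mul_assoc]

end ElemFamily

end Families

/-! ### Integrals over the domain -/

namespace Mesh.IsTessellation

variable {p : ℕ} {Ω ΓD ΓN : Set Pt} {m : Mesh p}

theorem image_subset (ht : m.IsTessellation Ω ΓD ΓN) (k : Fin m.ne) :
    (m.map k).toFun '' refTriangle ⊆ Ω := Set.image_subset_iff.2 (ht.mapsTo k)

/-- Elements overlap only in images of the boundary of the triangle, which are null sets; on each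
element this is the change of variables formula. -/
theorem integral_eq_sum (ht : m.IsTessellation Ω ΓD ΓN) {g : Pt → ℝ} (hg : ContinuousOn g Ω) :
    ∫ x in Ω, g x = ∑ k, ∫ ξ in refTriangle, (m.map k).jac ξ * g ((m.map k).toFun ξ) := by
  have hcomp : ∀ k, IsCompact ((m.map k).toFun '' refTriangle) := fun k =>
    isCompact_refTriangle.image ((m.map k).contDiff_toFun (n := 0)).continuous
  have hnull : ∀ k, volume ((m.map k).toFun '' frontier refTriangle) = 0 := fun k =>
    addHaar_image_eq_zero_of_differentiableOn_of_addHaar_eq_zero volume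
      ((m.map k).contDiff_toFun (n := 1) |>.differentiable one_ne_zero).differentiableOn
      (convex_refTriangle.addHaar_frontier volume)
  have hfr : ∀ f s, s ∈ Set.Icc (-1 : ℝ) 1 → facetParam f s ∈ frontier refTriangle := fun f s hs =>
    ⟨subset_closure (facetParam_mem_refTriangle f hs), facetParam_notMem_interior f s⟩
  have hvert : ∀ ξ ∈ refVertices, ξ ∈ frontier refTriangle := by
    intro ξ hξ
    have : ∃ f s, s ∈ Set.Icc (-1 : ℝ) 1 ∧ ξ = facetParam f s := by
      rcases hξ with rfl | rfl | rfl
      · exact ⟨2, -1, by simp, by simp [facetParam]⟩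
      · exact ⟨2, 1, by simp, by simp [facetParam]⟩
      · exact ⟨1, -1, by simp, by simp [facetParam]⟩
    obtain ⟨f, s, hs, rfl⟩ := this
    exact hfr f s hs
  have hdisj : Pairwise (Function.onFun (AEDisjoint volume)
      fun k => (m.map k).toFun '' refTriangle) := by
    intro k v hkv
    refine measure_mono_null ?_ (hnull k)
    rintro x ⟨⟨ξ, hξ, rfl⟩, η, hη, hξη⟩
    refine ⟨ξ, ?_, rfl⟩
    rcases m.conforming k v hkv ξ hξ η hη hξη.symm with h | ⟨f, f', s, _, hs, h3, _⟩
    · exact hvert ξ h.1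
    · rw [h3]
      exact hfr f s hs
  have hint : IntegrableOn g Ω := hg.integrableOn_compact ht.isCompact
  rw [← ht.volume_eq] at hint ⊢
  rw [integral_iUnion_ae (fun k => (hcomp k).measurableSet.nullMeasurableSet) hdisj hint,
    tsum_fintype]
  refine Finset.sum_congr rfl fun k _ => ?_
  rw [integral_image_eq_integral_abs_det_fderiv_smul volume isCompact_refTriangle.measurableSet
    (fun ξ _ => (m.map k).hasFDerivWithinAt_toFun refTriangle ξ) (m.injOn k)]
  refine setIntegral_congr_fun isCompact_refTriangle.measurableSet fun ξ hξ => ?_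
  simp only [PolyMap.det_fderiv_toFun, abs_of_pos (m.jac_pos k ξ hξ), smul_eq_mul]

/-- Element areas add up to that of `Ω`, and each is at least of order `d k ^ 2`. This turns local
errors of order `e + 2` into a global error of order `e`, with no quasi-uniformity of the mesh. -/
theorem sum_sq_le (ht : m.IsTessellation Ω ΓD ΓN) {c : ℝ} {d : Fin m.ne → ℝ}
    (hd : ∀ k, ∀ ξ ∈ refTriangle, c * d k ^ 2 ≤ (m.map k).jac ξ) :
    c * volume.real refTriangle * ∑ k, d k ^ 2 ≤ volume.real Ω := by
  have h1 := ht.integral_eq_sum (g := fun _ => 1) continuousOn_const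
  simp only [mul_one, integral_const, smul_eq_mul] at h1
  rw [measureReal_restrict_apply_univ] at h1
  rw [h1, Finset.mul_sum]
  refine Finset.sum_le_sum fun k _ => ?_
  have h2 : ∫ _ in refTriangle, c * d k ^ 2 ≤ ∫ ξ in refTriangle, (m.map k).jac ξ := by
    refine setIntegral_mono_on (integrableOn_const isCompact_refTriangle.measure_ne_top) ?_
      isCompact_refTriangle.measurableSet (hd k)
    have hc : ∀ a b, Continuous ((m.map k).metric a b) := fun a b =>
      (contDiff_polyEval _ (n := 0)).continuous
    refine ContinuousOn.integrableOn_compact isCompact_refTriangle (Continuous.continuousOn ?_)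
    exact ((hc 0 0).mul (hc 1 1)).sub ((hc 0 1).mul (hc 1 0))
  rw [setIntegral_const, smul_eq_mul] at h2
  linarith

theorem volume_refTriangle_pos : 0 < volume.real refTriangle := by
  refine ENNReal.toReal_pos ?_ isCompact_refTriangle.measure_ne_top
  exact (Measure.measure_pos_of_mem_nhds volume (mem_interior_iff_mem_nhds.1 refCenter_mem_interior)).ne'

end Mesh.IsTessellation

/-! ### Families of meshes -/

section Families

variable {κ : Type*} {p np nf : ℕ}

/-- The elements of a family of meshes. -/
abbrev Elem (mesh : κ → Mesh p) : Type _ := Σ n, Fin (mesh n).ne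

/-- The mapping of an element. -/
def elemMap (mesh : κ → Mesh p) (i : Elem mesh) : PolyMap := (mesh i.1).map i.2

/-- The elements whose facet `f` is an interior facet, with the neighbour across it. -/
structure IntFacet (mesh : κ → Mesh p) (f : Fin 3) where
  n : κ
  k : Fin (mesh n).ne
  g : Fin (mesh n).ne
  f' : Fin 3
  kind_eq : (mesh n).kind k f = .interior g f'

/-- The element that owns the facet. -/
def IntFacet.own {mesh : κ → Mesh p} {f : Fin 3} (j : IntFacet mesh f) : Elem mesh := ⟨j.n, j.k⟩

/-- The element on the other side of the facet. -/
def IntFacet.nbr {mesh : κ → Mesh p} {f : Fin 3} (j : IntFacet mesh f) : Elem mesh := ⟨j.n, j.g⟩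

theorem Scaled.comp {ι ι' : Type*} {h : ι → Set.Ioc (0 : ℝ) 1} {N e : ℕ} {φ : ι → Pt → ℝ}
    (hφ : Scaled h N e φ) (r : ι' → ι) : Scaled (fun i => h (r i)) N e fun i => φ (r i) :=
  ⟨fun i => hφ.contDiffOn (r i), hφ.bound.imp fun _ hK i => hK (r i)⟩

theorem ElemFamily.comp {ι ι' : Type*} {h : ι → Set.Ioc (0 : ℝ) 1} {M : ι → PolyMap}
    (hM : ElemFamily h M) (r : ι' → ι) : ElemFamily (fun i => h (r i)) fun i => M (r i) :=
  ⟨fun N a b => (hM.metric N a b).comp r,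
    hM.jac_lower.imp fun _ hc => ⟨hc.1, fun i => hc.2 (r i)⟩⟩

theorem SmoothTensor.comp {ι ι' : Type*} {h : ι → Set.Ioc (0 : ℝ) 1} {M : ι → PolyMap}
    {lam : Pt → Matrix (Fin 2) (Fin 2) ℝ} (hl : SmoothTensor h M lam p) (r : ι' → ι) :
    SmoothTensor (fun i => h (r i)) (fun i => M (r i)) lam p :=
  ⟨fun a b => (hl.scaled a b).comp r, fun i => hl.symm (r i)⟩

/-- A family of discretizations with uniformly scaled elements and coefficients. -/
structure Setting (op : RefOperator np nf) (lam : Pt → Matrix (Fin 2) (Fin 2) ℝ)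
    (mesh : κ → Mesh p) (h : Elem mesh → Set.Ioc (0 : ℝ) 1)
    (T : ∀ n, SATCoeffs (mesh n).ne nf) : Prop where
  deg_pos : 1 ≤ p
  sbp : op.IsSBP p
  elem : ElemFamily h (elemMap mesh)
  tensor : SmoothTensor h (elemMap mesh) lam p
  symm : ∀ n, (T n).IsSymmetric
  adj : ∀ n, (T n).IsAdjointConsistent op (mesh n)
  T1 : ∀ a i j, BigOh h 0 fun k => (T k.1).T1 k.2 a i j
  T2 : ∀ a i j, BigOh h 1 fun k => (T k.1).T2 k.2 a i j
  T3 : ∀ a i j, BigOh h 1 fun k => (T k.1).T3 k.2 a i j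
  T4 : ∀ a i j, BigOh h 2 fun k => (T k.1).T4 k.2 a i j
  T5 : ∀ a b i j, BigOh h 0 fun k => (T k.1).T5 k.2 a b i j
  T6 : ∀ a b i j, BigOh h 0 fun k => (T k.1).T6 k.2 a b i j
  TD : ∀ a i j, BigOh h 0 fun k => (T k.1).TD k.2 a i j

/-- A function with uniformly smooth pullbacks of its values, gradient and flux. -/
def SmoothOn (Ω : Set Pt) (lam : Pt → Matrix (Fin 2) (Fin 2) ℝ) (mesh : κ → Mesh p)
    (h : Elem mesh → Set.Ioc (0 : ℝ) 1) (u : Pt → ℝ) : Prop :=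
  SmoothFamily h (elemMap mesh) lam p (fun i ξ => u ((elemMap mesh i).toFun ξ))
    (fun a i ξ => pd Ω u a ((elemMap mesh i).toFun ξ))
    (fun a i ξ => flux Ω lam u a ((elemMap mesh i).toFun ξ))
    (fun a b i ξ => pd Ω (flux Ω lam u a) b ((elemMap mesh i).toFun ξ))

theorem fluxRestrict_eq_normalComp (m : Mesh p) (op : RefOperator np nf) (Ω : Set Pt)
    (lam : Pt → Matrix (Fin 2) (Fin 2) ℝ) (u : Pt → ℝ) (k : Fin m.ne) (f : Fin 3) :
    m.fluxRestrict op Ω lam u k f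
      = (m.map k).normalComp op f fun a ξ => flux Ω lam u a ((m.map k).toFun ξ) := by
  funext l
  simp [Mesh.fluxRestrict, normalFlux, PolyMap.normalComp, Fin.sum_univ_two, PolyMap.pfacet,
    mul_comm]

variable {op : RefOperator np nf} {Ω : Set Pt} {lam : Pt → Matrix (Fin 2) (Fin 2) ℝ}
  {mesh : κ → Mesh p} {h : Elem mesh → Set.Ioc (0 : ℝ) 1} {T : ∀ n, SATCoeffs (mesh n).ne nf}
  {e : ℕ} {f : Fin 3} {u ψ : Pt → ℝ}

theorem one_le_refHalfLength (f : Fin 3) : 1 ≤ refHalfLength f := by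
  fin_cases f <;> simp [refHalfLength]

/-- The length elements of a shared facet agree from both sides, and each is comparable to the size
of its element. They are compared at the parameter 0, which reversal of the orientation fixes. -/
theorem exists_size_nbr_le (hM : ElemFamily h (elemMap mesh)) (f : Fin 3) :
    ∃ C : ℝ, ∀ j : IntFacet mesh f, (h j.nbr : ℝ) ≤ C * h j.own := by
  obtain ⟨c, hc, hcl⟩ := hM.facetJac_lower
  have h0 : (0 : ℝ) ∈ Set.Icc (-1 : ℝ) 1 := by norm_num
  have hm : ∀ f, facetParam f 0 ∈ refTriangle := fun f => facetParam_mem_refTriangle f h0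
  obtain ⟨C, hC⟩ := hM.bigOh_facetJac (hm f) f
  refine ⟨c⁻¹ * (refHalfLength f * C), fun j => ?_⟩
  have h1 := Mesh.facetJac_match j.kind_eq h0
  rw [neg_zero] at h1
  have h2 := hcl j.nbr _ (hm j.f') j.f'
  have h3 := (le_abs_self _).trans (hC j.own)
  have h4 : (elemMap mesh j.nbr).facetJac j.f' (facetParam j.f' 0)
      ≤ refHalfLength j.f' * (elemMap mesh j.nbr).facetJac j.f' (facetParam j.f' 0) :=
    le_mul_of_one_le_left (Real.sqrt_nonneg _) (one_le_refHalfLength _)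
  have h5 : refHalfLength f * (elemMap mesh j.own).facetJac f (facetParam f 0)
      ≤ refHalfLength f * (C * (h j.own : ℝ) ^ 1) :=
    mul_le_mul_of_nonneg_left h3 (refHalfLength_pos f).le
  have h6 : c * (h j.nbr : ℝ) ≤ refHalfLength f * (C * (h j.own : ℝ) ^ 1) :=
    (h2.trans h4).trans (le_trans (le_of_eq h1.symm) h5)
  rw [mul_assoc, le_inv_mul_iff₀ hc]
  rw [pow_one] at h6
  linarith

theorem BigOh.nbr (hM : ElemFamily h (elemMap mesh)) {X : Fin 3 → Elem mesh → ℝ}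
    (hX : ∀ f', BigOh h e (X f')) (f : Fin 3) :
    BigOh (fun j : IntFacet mesh f => h j.own) e fun j => X j.f' j.nbr := by
  choose C hC0 hC using fun f' => (hX f').exists_nonneg
  have h1 : BigOh (fun j : IntFacet mesh f => h j.nbr) e fun j => X j.f' j.nbr := by
    refine ⟨∑ f', C f', fun j => (hC j.f' j.nbr).trans ?_⟩
    have hp := (h j.nbr).2.1
    have := Finset.single_le_sum (f := C) (fun f' _ => hC0 f') (Finset.mem_univ j.f')
    gcongr
  exact h1.of_le (exists_size_nbr_le hM f)

theorem BigOh.of_interior {X : Elem mesh → ℝ}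
    (hX : BigOh (fun j : IntFacet mesh f => h j.own) e fun j => X j.own)
    (h0 : ∀ i, (∀ g f', (mesh i.1).kind i.2 f ≠ .interior g f') → X i = 0) : BigOh h e X := by
  obtain ⟨C, hC0, hC⟩ := hX.exists_nonneg
  refine ⟨C, fun i => ?_⟩
  by_cases hi : ∃ g f', (mesh i.1).kind i.2 f = .interior g f'
  · obtain ⟨g, f', hk⟩ := hi
    exact hC ⟨i.1, i.2, g, f', hk⟩
  · push Not at hi
    rw [h0 i hi, abs_zero]
    have := (h i).2.1
    positivity

/-! ### Orders of the facet errors and of the truncation error -/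

namespace Setting

theorem B_entry (hS : Setting op lam mesh h T) (f : Fin 3) (a b : Fin nf) :
    BigOh h 1 fun i => (elemMap mesh i).B op f a b := by
  have h1 := hS.elem.bigOh_B_mulVec hS.sbp f (e := 0) (x := fun _ => Pi.single b 1)
    (fun l => BigOh.const _) a
  rw [zero_add] at h1
  exact h1.congr fun i => by simp

theorem trace_error (hS : Setting op lam mesh h T) (hu : SmoothOn Ω lam mesh h u) (f : Fin 3)
    (l : Fin nf) : BigOh h (p + 1) fun i =>
      (tr op (mesh i.1) ((mesh i.1).restrict op u) i.2 f
        - (mesh i.1).facetRestrict op u i.2 f) l := by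
  have := hS.sbp.R_approx (hu.scaled.of_le (show p + 1 ≤ 2 * p + 1 by omega)) f l
  rw [zero_add] at this
  exact this

theorem dn_error (hS : Setting op lam mesh h T) (hu : SmoothOn Ω lam mesh h u) (f : Fin 3)
    (l : Fin nf) : BigOh h p fun i =>
      (dn op lam (mesh i.1) ((mesh i.1).restrict op u) i.2 f
        - (mesh i.1).fluxRestrict op Ω lam u i.2 f) l := by
  refine (hS.elem.Dn_approx hS.sbp hS.tensor hu hS.deg_pos f l).congr fun i => ?_
  rw [fluxRestrict_eq_normalComp]
  rfl

/-- Exact facet values agree from both sides, so the jump is a difference of two extrapolation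
errors. -/
theorem jump_interior (hS : Setting op lam mesh h T) (hu : SmoothOn Ω lam mesh h u) (f : Fin 3)
    (l : Fin nf) : BigOh (fun j : IntFacet mesh f => h j.own) (p + 1) fun j =>
      jump op (mesh j.n) ((mesh j.n).restrict op u) j.k f l := by
  have h1 := (hS.trace_error hu f l).comp (IntFacet.own (mesh := mesh) (f := f))
  have h2 := BigOh.nbr hS.elem (fun f' => hS.trace_error hu f' l.rev) f
  refine (h1.sub h2).congr fun j => ?_
  have h3 := congrFun (Mesh.flip_facetRestrict hS.sbp j.kind_eq u) l
  rw [jump_eq j.kind_eq]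
  simp only [flip, IntFacet.own, IntFacet.nbr, Pi.sub_apply] at h3 ⊢
  linarith

theorem jump (hS : Setting op lam mesh h T) (hu : SmoothOn Ω lam mesh h u) (f : Fin 3)
    (l : Fin nf) : BigOh h (p + 1) fun i =>
      jump op (mesh i.1) ((mesh i.1).restrict op u) i.2 f l := by
  refine BigOh.of_interior (f := f) (hS.jump_interior hu f l) fun i hi => ?_
  rw [SBPSAT.jump]
  rcases hk : (mesh i.1).kind i.2 f with ⟨g, f'⟩ | _ | _
  · exact absurd hk (hi g f')
  · rfl
  · rfl

/-- Exact conormal derivatives cancel because the two normals are opposite, leaving the sum of the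
two errors. -/
theorem dsum_interior (hS : Setting op lam mesh h T) (hu : SmoothOn Ω lam mesh h u) (f : Fin 3)
    (l : Fin nf) : BigOh (fun j : IntFacet mesh f => h j.own) p fun j =>
      dsum op lam (mesh j.n) ((mesh j.n).restrict op u) j.k f j.g j.f' l := by
  have h1 := (hS.dn_error hu f l).comp (IntFacet.own (mesh := mesh) (f := f))
  have h2 := BigOh.nbr hS.elem (fun f' => hS.dn_error hu f' l.rev) f
  refine (h1.add h2).congr fun j => ?_
  have h3 := congrFun (Mesh.flip_fluxRestrict hS.sbp j.kind_eq Ω lam u) l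
  rw [dsum]
  simp only [flip, IntFacet.own, IntFacet.nbr, Pi.sub_apply, Pi.add_apply, Pi.neg_apply] at h3 ⊢
  linarith

/-- Order count: `T1` on jumps, `T3` on flux sums and the wide-stencil terms have order `p + 1`;
`T2` on jumps and `T4` on flux sums have order `p + 2`, of which the transposed conormal operator
consumes one. -/
theorem satI_bigOh (hS : Setting op lam mesh h T) (hu : SmoothOn Ω lam mesh h u) (a : Fin np) :
    BigOh h (p + 1) fun i =>
      satI op lam (mesh i.1) (T i.1) ((mesh i.1).restrict op u) i.2 a := by
  have main : ∀ f : Fin 3, BigOh (fun j : IntFacet mesh f => h j.own) (p + 1) fun j =>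
      ((op.R f)ᵀ *ᵥ ((T j.n).T1 j.k f *ᵥ SBPSAT.jump op (mesh j.n) ((mesh j.n).restrict op u) j.k f
          + (T j.n).T3 j.k f *ᵥ dsum op lam (mesh j.n) ((mesh j.n).restrict op u) j.k f j.g j.f')
        + (((mesh j.n).map j.k).Dn op lam f)ᵀ *ᵥ ((T j.n).T2 j.k f *ᵥ SBPSAT.jump op (mesh j.n)
            ((mesh j.n).restrict op u) j.k f
          + (T j.n).T4 j.k f *ᵥ dsum op lam (mesh j.n) ((mesh j.n).restrict op u) j.k f j.g j.f')
        + (∑ e ∈ Finset.univ.erase f, (op.R f)ᵀ *ᵥ ((T j.n).T5 j.k f e *ᵥ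
            SBPSAT.jump op (mesh j.n) ((mesh j.n).restrict op u) j.k e))
        + ∑ d ∈ Finset.univ.erase j.f', (op.R f)ᵀ *ᵥ flip ((T j.n).T6 j.g j.f' d *ᵥ
            SBPSAT.jump op (mesh j.n) ((mesh j.n).restrict op u) j.g d)) a := by
    intro f
    have hj := hS.jump_interior hu f
    have hd := hS.dsum_interior hu f
    have own : ∀ {e : ℕ} {X : Elem mesh → ℝ}, BigOh h e X →
        BigOh (fun j : IntFacet mesh f => h j.own) e fun j => X j.own := fun hX =>
      hX.comp IntFacet.own
    have t1 := fun l => BigOh.mulVec (a := l) (fun b => own (hS.T1 f l b)) hj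
    have t3 := fun l => BigOh.mulVec (a := l) (fun b => own (hS.T3 f l b)) hd
    have t2 := fun l => BigOh.mulVec (a := l) (fun b => own (hS.T2 f l b)) hj
    have t4 := fun l => BigOh.mulVec (a := l) (fun b => own (hS.T4 f l b)) hd
    have t5 := fun e l => BigOh.mulVec (a := l) (fun b => own (hS.T5 f e l b))
      fun b => own (hS.jump hu e b)
    have t6 : ∀ l, BigOh (fun j : IntFacet mesh f => h j.own) (0 + (p + 1)) fun j =>
        ∑ d ∈ Finset.univ.erase j.f', flip ((T j.n).T6 j.g j.f' d *ᵥ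
            SBPSAT.jump op (mesh j.n) ((mesh j.n).restrict op u) j.g d) l := fun l =>
      BigOh.nbr hS.elem (X := fun f' i => ∑ d ∈ Finset.univ.erase f', flip ((T i.1).T6 i.2 f' d *ᵥ
        SBPSAT.jump op (mesh i.1) ((mesh i.1).restrict op u) i.2 d) l)
        (fun f' => BigOh.sum fun d _ => BigOh.mulVec (a := l.rev) (fun b => hS.T6 f' d l.rev b)
          fun b => hS.jump hu d b) f
    have e1 := BigOh.const_mulVec (op.R f)ᵀ a fun l =>
      ((t1 l).mono (show p + 1 ≤ 0 + (p + 1) by omega)).add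
        ((t3 l).mono (show p + 1 ≤ 1 + p by omega))
    have e2 := (hS.elem.comp (IntFacet.own (mesh := mesh) (f := f))).bigOh_Dn_transpose hS.sbp
      (hS.tensor.comp _) f (e := p + 1) (fun l =>
        ((t2 l).mono (show p + 1 + 1 ≤ 1 + (p + 1) by omega)).add
          ((t4 l).mono (show p + 1 + 1 ≤ 2 + p by omega))) a
    have e3 := BigOh.sum (s := Finset.univ.erase f) fun e _ =>
      BigOh.const_mulVec (op.R f)ᵀ a fun l => (t5 e l).mono (show p + 1 ≤ 0 + (p + 1) by omega)
    have e4 := BigOh.const_mulVec (op.R f)ᵀ a fun l =>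
      (t6 l).mono (show p + 1 ≤ 0 + (p + 1) by omega)
    refine (((e1.add e2).add e3).add e4).congr fun j => ?_
    have e5 : (∑ d ∈ Finset.univ.erase j.f', (op.R f)ᵀ *ᵥ flip ((T j.n).T6 j.g j.f' d *ᵥ
          SBPSAT.jump op (mesh j.n) ((mesh j.n).restrict op u) j.g d)) a
        = ((op.R f)ᵀ *ᵥ fun l => ∑ d ∈ Finset.univ.erase j.f', flip ((T j.n).T6 j.g j.f' d *ᵥ
          SBPSAT.jump op (mesh j.n) ((mesh j.n).restrict op u) j.g d) l) a := by
      rw [← Matrix.mulVec_sum]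
      congr 2
      funext l
      rw [Finset.sum_apply]
    simp only [Pi.add_apply, e5, Finset.sum_apply]
    rfl
  simp only [satI, Finset.sum_apply]
  refine BigOh.sum fun f _ => BigOh.of_interior (f := f) ((main f).congr fun j => ?_) fun i hi => ?_
  · have hk : (mesh j.own.1).kind j.own.2 f = .interior j.g j.f' := j.kind_eq
    simp only [hk]
    rfl
  · rcases hk : (mesh i.1).kind i.2 f with ⟨g, f'⟩ | _ | _
    · exact absurd hk (hi g f')
    · rfl
    · rfl

theorem bigOh_boundary_cases {f : Fin 3} {X Y : Elem mesh → ℝ} (hX : BigOh h e X)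
    (hY : BigOh h e Y) :
    BigOh h e fun i => match (mesh i.1).kind i.2 f with
      | .interior _ _ => 0
      | .dirichlet => X i
      | .neumann => Y i := by
  obtain ⟨C, hC0, hC⟩ := hX.exists_nonneg
  obtain ⟨D, hD0, hD⟩ := hY.exists_nonneg
  refine ⟨C + D, fun i => ?_⟩
  have hp := (h i).2.1
  have h1 : 0 ≤ C * (h i : ℝ) ^ e := by positivity
  have h2 : 0 ≤ D * (h i : ℝ) ^ e := by positivity
  have h3 := hC i
  have h4 := hD i
  rw [add_mul]
  rcases hk : (mesh i.1).kind i.2 f with ⟨g, f'⟩ | _ | _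
  · simp only [hk, abs_zero]; linarith
  · simp only [hk]; linarith
  · simp only [hk]; linarith

theorem satB_bigOh (hS : Setting op lam mesh h T) (hu : SmoothOn Ω lam mesh h u) (a : Fin np) :
    BigOh h (p + 1) fun i =>
      satB op Ω lam (mesh i.1) (T i.1) u ((mesh i.1).restrict op u) i.2 a := by
  simp only [satB, Finset.sum_apply]
  refine BigOh.sum fun f _ => ?_
  have hB : ∀ {e : ℕ} {x : Elem mesh → Fin nf → ℝ}, (∀ l, BigOh h e fun i => x i l) → ∀ l,
      BigOh h (e + 1) fun i => (((mesh i.1).map i.2).B op f *ᵥ x i) l := fun hx l =>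
    hS.elem.bigOh_B_mulVec hS.sbp f hx l
  have e1 := BigOh.const_mulVec (op.R f)ᵀ a fun l =>
    (BigOh.mulVec (a := l) (fun b => hS.TD f l b) (hS.trace_error hu f)).mono
      (show p + 1 ≤ 0 + (p + 1) by omega)
  have e2 := hS.elem.bigOh_Dn_transpose hS.sbp hS.tensor f (e := p + 1)
    (fun l => hB (hS.trace_error hu f) l) a
  have e3 := BigOh.const_mulVec (op.R f)ᵀ a (hB (hS.dn_error hu f))
  refine (bigOh_boundary_cases (f := f) (e1.sub e2) e3).congr fun i => ?_
  rcases (mesh i.1).kind i.2 f with ⟨g, f'⟩ | _ | _ <;> rfl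

/-- The truncation error of the primal scheme. -/
theorem residual_bigOh (hS : Setting op lam mesh h T) (hu : SmoothOn Ω lam mesh h u) {F : Pt → ℝ}
    (hF : ∀ i, ∀ ξ ∈ refTriangle, diffusion Ω lam u ((elemMap mesh i).toFun ξ)
      = F ((elemMap mesh i).toFun ξ)) (j : Fin np) :
    BigOh h (p + 1) fun i => ((mesh i.1).map i.2).H op j *
      (primalOp op Ω lam (mesh i.1) (T i.1) u ((mesh i.1).restrict op u) i.2 j
        - (mesh i.1).restrict op F i.2 j) := by
  have hp := hS.deg_pos
  -- The norm matrix supplies two orders, so the pointwise order `p - 1` becomes the weighted order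
  -- `p + 1`.
  have h1 := (hS.elem.bigOh_H hS.sbp j).mul
    (hS.elem.D2_approx hS.sbp hS.tensor hu hS.deg_pos j)
  rw [show 2 + (p - 1) = p + 1 by omega] at h1
  refine (((hS.satI_bigOh hu j).add (hS.satB_bigOh hu j)).sub h1).congr fun i => ?_
  have hH := (PolyMap.H_pos _ ((mesh i.1).jac_pos i.2) hS.sbp j).ne'
  have h2 : (mesh i.1).restrict op F i.2 j
      = -∑ a, pd Ω (flux Ω lam u a) a ((elemMap mesh i).toFun (op.node j)) :=
    (hF i _ (hS.sbp.node_mem j)).symm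
  rw [h2, primalOp, Pi.add_apply, Pi.neg_apply, Matrix.mulVec_diagonal, Pi.add_apply]
  have h3 : ((elemMap mesh i).D2 op lam *ᵥ op.nodal fun ξ => u ((elemMap mesh i).toFun ξ)) j
      = (((mesh i.1).map i.2).D2 op lam *ᵥ (mesh i.1).restrict op u i.2) j := rfl
  have h4 : (elemMap mesh i).H op j = ((mesh i.1).map i.2).H op j := rfl
  rw [h3, h4]
  field_simp
  ring

end Setting

end Families

/-! ### Consistency of the bilinear form -/

namespace Mesh

variable {p : ℕ} (m : Mesh p)

theorem intSum_zero : m.intSum (fun _ _ _ _ => 0) = 0 := by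
  rw [intSum]
  refine Finset.sum_eq_zero fun k _ => Finset.sum_eq_zero fun f _ => ?_
  rcases m.kind k f with ⟨g, f'⟩ | _ | _ <;> rfl

end Mesh

section Identity

variable {p np nf : ℕ} (op : RefOperator np nf) (Ω : Set Pt)
  (lam : Pt → Matrix (Fin 2) (Fin 2) ℝ) (m : Mesh p) (T : SATCoeffs m.ne nf) (ψ u : Pt → ℝ)

/-- Extrapolation error at a facet. -/
noncomputable def trError (k : Fin m.ne) (f : Fin 3) : Fin nf → ℝ :=
  tr op m (m.restrict op u) k f - m.facetRestrict op u k f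

/-- Error of the conormal derivative at a facet. -/
noncomputable def dnError (k : Fin m.ne) (f : Fin 3) : Fin nf → ℝ :=
  dn op lam m (m.restrict op u) k f - m.fluxRestrict op Ω lam u k f

/-- The facet terms in the element-wise summation by parts. -/
noncomputable def facetTerm (k : Fin m.ne) (f : Fin 3) : ℝ :=
  m.facetRestrict op ψ k f ⬝ᵥ ((m.map k).B op f *ᵥ m.fluxRestrict op Ω lam u k f)
    + m.fluxRestrict op Ω lam ψ k f ⬝ᵥ ((m.map k).B op f *ᵥ trError op m u k f)
    + m.fluxRestrict op Ω lam u k f ⬝ᵥ ((m.map k).B op f *ᵥ trError op m ψ k f)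

/-- The contribution of an interior facet to the consistency error. -/
noncomputable def interiorError (k : Fin m.ne) (f : Fin 3) (g : Fin m.ne) (f' : Fin 3) : ℝ :=
  jump op m (m.restrict op ψ) k f ⬝ᵥ ((m.map k).B op f *ᵥ dnError op Ω lam m u k f)
    - flip (dnError op Ω lam m ψ g f') ⬝ᵥ
      ((m.map k).B op f *ᵥ jump op m (m.restrict op u) k f)
    - (jump op m (m.restrict op ψ) k f ⬝ᵥ (T.T1 k f *ᵥ jump op m (m.restrict op u) k f)
      + jump op m (m.restrict op ψ) k f ⬝ᵥ
        (T.T3 k f *ᵥ dsum op lam m (m.restrict op u) k f g f')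
      + dsum op lam m (m.restrict op ψ) k f g f' ⬝ᵥ
        (T.T2 k f *ᵥ jump op m (m.restrict op u) k f)
      + dsum op lam m (m.restrict op ψ) k f g f' ⬝ᵥ
        (T.T4 k f *ᵥ dsum op lam m (m.restrict op u) k f g f'))

variable {op lam m T}

/-- Exact values are continuous across a facet and exact conormal derivatives change sign. The
purely exact products therefore cancel between the two sides, and the extrapolation errors combine
into jumps. -/
theorem intSum_facetTerm (hop : op.IsSBP p) (hT : T.IsAdjointConsistent op m) :
    m.intSum (fun k f _ _ => facetTerm op Ω lam m ψ u k f)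
      = (1 / 2) * m.intSum fun k f _ _ =>
        m.fluxRestrict op Ω lam ψ k f ⬝ᵥ
          ((m.map k).B op f *ᵥ jump op m (m.restrict op u) k f)
        + m.fluxRestrict op Ω lam u k f ⬝ᵥ
          ((m.map k).B op f *ᵥ jump op m (m.restrict op ψ) k f) := by
  rw [Mesh.intSum_eq_half]
  congr 1
  refine m.intSum_congr fun k f g f' hk => ?_
  have tB := flipMat_B_eq hT hk
  simp only [facetTerm]
  rw [dotProduct_mulVec_flip ((m.map g).B op f'), dotProduct_mulVec_flip ((m.map g).B op f'),
    dotProduct_mulVec_flip ((m.map g).B op f'), tB]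
  simp only [trError, flip_sub, Mesh.flip_facetRestrict hop hk, Mesh.flip_fluxRestrict hop hk,
    jump_eq hk, Matrix.mulVec_sub, Matrix.mulVec_neg, dotProduct_sub, dotProduct_neg,
    neg_dotProduct]
  ring

/-- Purely algebraic. Once the element facet terms are added to the energy, every facet term linear
in an extrapolation or conormal error cancels. There remain the local energy defects and products of
two errors, jumps or flux sums. -/
theorem consistency_identity (hop : op.IsSBP p) (hT : T.IsAdjointConsistent op m)
    (hs : T.IsSymmetric) :
    dataForm op Ω lam m T u (m.restrict op ψ) + dataForm op Ω lam m T ψ (m.restrict op u)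
      - discreteForm op lam m T (m.restrict op ψ) (m.restrict op u)
      - (m.dirSum fun k f => m.facetRestrict op ψ k f ⬝ᵥ
          (T.TD k f *ᵥ m.facetRestrict op u k f))
      + (m.dirSum fun k f => m.facetRestrict op ψ k f ⬝ᵥ
          ((m.map k).B op f *ᵥ m.fluxRestrict op Ω lam u k f))
      - (m.neuSum fun k f => m.fluxRestrict op Ω lam ψ k f ⬝ᵥ
          ((m.map k).B op f *ᵥ m.facetRestrict op u k f))
    = -(∑ k, ((m.map k).energy op lam (m.restrict op ψ k) (m.restrict op u k)
        - ∑ f, facetTerm op Ω lam m ψ u k f))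
      - ∑ k, ∑ f, wideForm op m T (m.restrict op ψ) (m.restrict op u) k f
      + (m.dirSum fun k f =>
          dnError op Ω lam m ψ k f ⬝ᵥ ((m.map k).B op f *ᵥ trError op m u k f)
          + trError op m ψ k f ⬝ᵥ ((m.map k).B op f *ᵥ dnError op Ω lam m u k f)
          - trError op m ψ k f ⬝ᵥ (T.TD k f *ᵥ trError op m u k f))
      + (1 / 2) * m.intSum (interiorError op Ω lam m T ψ u) := by
  have hI : m.intSum (facetForm op lam m T (m.restrict op ψ) (m.restrict op u))
      + m.intSum (fun k f _ _ => m.fluxRestrict op Ω lam ψ k f ⬝ᵥ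
          ((m.map k).B op f *ᵥ jump op m (m.restrict op u) k f)
        + m.fluxRestrict op Ω lam u k f ⬝ᵥ
          ((m.map k).B op f *ᵥ jump op m (m.restrict op ψ) k f))
      + m.intSum (interiorError op Ω lam m T ψ u) = 0 := by
    rw [← Mesh.intSum_add, ← Mesh.intSum_add, ← m.intSum_zero]
    refine m.intSum_congr fun k f g f' hk => ?_
    have hB := ((m.map k).B_isSymm op f).dotProduct_mulVec_comm
      (m.fluxRestrict op Ω lam u k f) (jump op m (m.restrict op ψ) k f)
    have hz := Mesh.flip_fluxRestrict hop hk Ω lam ψ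
    simp only [facetForm, interiorError, dnError, flip_sub, hz, Matrix.mulVec_sub,
      dotProduct_sub, sub_dotProduct, neg_dotProduct] at hB ⊢
    rw [hB]
    ring
  have hD : (m.dirSum fun k f => tr op m (m.restrict op ψ) k f ⬝ᵥ
            (T.TD k f *ᵥ m.facetRestrict op u k f)
          - dn op lam m (m.restrict op ψ) k f ⬝ᵥ
            ((m.map k).B op f *ᵥ m.facetRestrict op u k f))
      + (m.dirSum fun k f => tr op m (m.restrict op u) k f ⬝ᵥ
            (T.TD k f *ᵥ m.facetRestrict op ψ k f)
          - dn op lam m (m.restrict op u) k f ⬝ᵥ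
            ((m.map k).B op f *ᵥ m.facetRestrict op ψ k f))
      + -(m.dirSum fun k f => tr op m (m.restrict op ψ) k f ⬝ᵥ
            (T.TD k f *ᵥ tr op m (m.restrict op u) k f)
          - tr op m (m.restrict op ψ) k f ⬝ᵥ
            ((m.map k).B op f *ᵥ dn op lam m (m.restrict op u) k f)
          - dn op lam m (m.restrict op ψ) k f ⬝ᵥ
            ((m.map k).B op f *ᵥ tr op m (m.restrict op u) k f))
      + -(m.dirSum fun k f => m.facetRestrict op ψ k f ⬝ᵥ
          (T.TD k f *ᵥ m.facetRestrict op u k f))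
      + (m.dirSum fun k f => m.facetRestrict op ψ k f ⬝ᵥ
          ((m.map k).B op f *ᵥ m.fluxRestrict op Ω lam u k f))
      + -m.dirSum (facetTerm op Ω lam m ψ u)
      = m.dirSum fun k f =>
          dnError op Ω lam m ψ k f ⬝ᵥ ((m.map k).B op f *ᵥ trError op m u k f)
          + trError op m ψ k f ⬝ᵥ ((m.map k).B op f *ᵥ dnError op Ω lam m u k f)
          - trError op m ψ k f ⬝ᵥ (T.TD k f *ᵥ trError op m u k f) := by
    simp only [← Mesh.dirSum_add, ← Mesh.dirSum_neg]
    congr 1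
    funext k f
    have hB := ((m.map k).B_isSymm op f).dotProduct_mulVec_comm
    rw [(hs.TD_symm k f).dotProduct_mulVec_comm (tr op m (m.restrict op u) k f),
      hB (dn op lam m (m.restrict op u) k f)]
    simp only [facetTerm, dnError, trError]
    rw [hB (m.fluxRestrict op Ω lam u k f)]
    simp only [Matrix.mulVec_sub, dotProduct_sub, sub_dotProduct]
    ring
  have hN : (m.neuSum fun k f => tr op m (m.restrict op ψ) k f ⬝ᵥ
          ((m.map k).B op f *ᵥ m.fluxRestrict op Ω lam u k f))
      + (m.neuSum fun k f => tr op m (m.restrict op u) k f ⬝ᵥ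
          ((m.map k).B op f *ᵥ m.fluxRestrict op Ω lam ψ k f))
      = m.neuSum (facetTerm op Ω lam m ψ u)
        + m.neuSum fun k f => m.fluxRestrict op Ω lam ψ k f ⬝ᵥ
          ((m.map k).B op f *ᵥ m.facetRestrict op u k f) := by
    simp only [← Mesh.neuSum_add]
    congr 1
    funext k f
    have hB := ((m.map k).B_isSymm op f).dotProduct_mulVec_comm
    rw [hB (tr op m (m.restrict op u) k f)]
    simp only [facetTerm, trError]
    rw [hB (m.fluxRestrict op Ω lam u k f)]
    simp only [Matrix.mulVec_sub, dotProduct_sub, sub_dotProduct]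
    ring
  have hP := m.sum_facets (facetTerm op Ω lam m ψ u)
  have hPI := intSum_facetTerm Ω ψ u hop hT (lam := lam)
  rw [Finset.sum_sub_distrib, hP, hPI, dataForm, dataForm, discreteForm]
  linarith

end Identity

/-! ### Summation of the local consistency errors -/

section Families

variable {κ : Type*} {p np nf : ℕ} {op : RefOperator np nf} {Ω : Set Pt}
  {lam : Pt → Matrix (Fin 2) (Fin 2) ℝ} {mesh : κ → Mesh p} {h : Elem mesh → Set.Ioc (0 : ℝ) 1}
  {T : ∀ n, SATCoeffs (mesh n).ne nf} {u ψ F : Pt → ℝ} {X Y : κ → ℝ} {e : ℕ}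

/-- `X` is a sum over the elements of contributions of order `e`. -/
def SumOh (h : Elem mesh → Set.Ioc (0 : ℝ) 1) (e : ℕ) (X : κ → ℝ) : Prop :=
  ∃ Z : Elem mesh → ℝ, BigOh h e Z ∧ ∀ n, X n = ∑ k, Z ⟨n, k⟩

namespace SumOh

theorem congr (hX : SumOh h e X) (hXY : ∀ n, X n = Y n) : SumOh h e Y := by
  rwa [← funext hXY]

theorem add (hX : SumOh h e X) (hY : SumOh h e Y) : SumOh h e fun n => X n + Y n := by
  obtain ⟨Z, hZ, hXZ⟩ := hX
  obtain ⟨W, hW, hYW⟩ := hY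
  exact ⟨_, hZ.add hW, fun n => by
    rw [Finset.sum_add_distrib, ← hXZ, ← hYW]⟩

theorem const_mul (c : ℝ) (hX : SumOh h e X) : SumOh h e fun n => c * X n := by
  obtain ⟨Z, hZ, hXZ⟩ := hX
  exact ⟨_, hZ.const_mul c, fun n => by rw [← Finset.mul_sum, ← hXZ]⟩

theorem neg (hX : SumOh h e X) : SumOh h e fun n => -X n :=
  (hX.const_mul (-1)).congr fun n => by ring

theorem sub (hX : SumOh h e X) (hY : SumOh h e Y) : SumOh h e fun n => X n - Y n :=
  (hX.add hY.neg).congr fun n => by ring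

theorem of_bigOh {Z : Elem mesh → ℝ} (hZ : BigOh h e Z) : SumOh h e fun n => ∑ k, Z ⟨n, k⟩ :=
  ⟨Z, hZ, fun _ => rfl⟩

theorem intSum {Z : ∀ n, Fin (mesh n).ne → Fin 3 → Fin (mesh n).ne → Fin 3 → ℝ}
    (hZ : ∀ f, BigOh (fun j : IntFacet mesh f => h j.own) e fun j => Z j.n j.k f j.g j.f') :
    SumOh h e fun n => (mesh n).intSum (Z n) := by
  refine (SumOh.of_bigOh (Z := fun i => ∑ f, match (mesh i.1).kind i.2 f with
    | .interior g f' => Z i.1 i.2 f g f'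
    | _ => 0) (BigOh.sum fun f _ => BigOh.of_interior (f := f) ((hZ f).congr fun j => ?_)
      fun i hi => ?_)).congr fun n => ?_
  · have hk : (mesh j.own.1).kind j.own.2 f = .interior j.g j.f' := j.kind_eq
    simp only [hk]
    rfl
  · rcases hk : (mesh i.1).kind i.2 f with ⟨g, f'⟩ | _ | _
    · exact absurd hk (hi g f')
    · rfl
    · rfl
  · refine Finset.sum_congr rfl fun k _ => Finset.sum_congr rfl fun f _ => ?_
    simp only
    rcases (mesh n).kind k f with ⟨g, f'⟩ | _ | _ <;> rfl

theorem dirSum {Z : ∀ n, Fin (mesh n).ne → Fin 3 → ℝ}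
    (hZ : ∀ f, BigOh h e fun i => Z i.1 i.2 f) : SumOh h e fun n => (mesh n).dirSum (Z n) := by
  refine (SumOh.of_bigOh (BigOh.sum (s := Finset.univ) fun f _ =>
    Setting.bigOh_boundary_cases (f := f) (hZ f) BigOh.zero)).congr fun n => ?_
  refine Finset.sum_congr rfl fun k _ => Finset.sum_congr rfl fun f _ => ?_
  simp only
  rcases (mesh n).kind k f with ⟨g, f'⟩ | _ | _ <;> rfl

theorem neuSum {Z : ∀ n, Fin (mesh n).ne → Fin 3 → ℝ}
    (hZ : ∀ f, BigOh h e fun i => Z i.1 i.2 f) : SumOh h e fun n => (mesh n).neuSum (Z n) := by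
  refine (SumOh.of_bigOh (BigOh.sum (s := Finset.univ) fun f _ =>
    Setting.bigOh_boundary_cases (f := f) BigOh.zero (hZ f))).congr fun n => ?_
  refine Finset.sum_congr rfl fun k _ => Finset.sum_congr rfl fun f _ => ?_
  simp only
  rcases (mesh n).kind k f with ⟨g, f'⟩ | _ | _ <;> rfl

end SumOh

namespace Setting

theorem trError_bigOh (hS : Setting op lam mesh h T) (hu : SmoothOn Ω lam mesh h u) (f : Fin 3)
    (l : Fin nf) : BigOh h (p + 1) fun i => trError op (mesh i.1) u i.2 f l :=
  hS.trace_error hu f l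

theorem dnError_bigOh (hS : Setting op lam mesh h T) (hu : SmoothOn Ω lam mesh h u) (f : Fin 3)
    (l : Fin nf) : BigOh h p fun i => dnError op Ω lam (mesh i.1) u i.2 f l :=
  hS.dn_error hu f l

/-- Jumps have order `p + 1`, flux sums and conormal errors order `p`; the order of the coefficient
between two factors brings each product to `2 * p + 2`. -/
theorem interiorError_bigOh (hS : Setting op lam mesh h T) (hψ : SmoothOn Ω lam mesh h ψ)
    (hu : SmoothOn Ω lam mesh h u) (f : Fin 3) :
    BigOh (fun j : IntFacet mesh f => h j.own) (2 * p + 2) fun j =>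
      interiorError op Ω lam (mesh j.n) (T j.n) ψ u j.k f j.g j.f' := by
  have ju := hS.jump_interior hu f
  have jψ := hS.jump_interior hψ f
  have du := hS.dsum_interior hu f
  have dψ := hS.dsum_interior hψ f
  have own : ∀ {e : ℕ} {X : Elem mesh → ℝ}, BigOh h e X →
      BigOh (fun j : IntFacet mesh f => h j.own) e fun j => X j.own := fun hX =>
    hX.comp IntFacet.own
  have e1 := BigOh.dotProduct jψ fun l => BigOh.mulVec (a := l) (fun b => own (hS.T1 f l b)) ju
  have e2 := BigOh.dotProduct jψ fun l => BigOh.mulVec (a := l) (fun b => own (hS.T3 f l b)) du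
  have e3 := BigOh.dotProduct dψ fun l => BigOh.mulVec (a := l) (fun b => own (hS.T2 f l b)) ju
  have e4 := BigOh.dotProduct dψ fun l => BigOh.mulVec (a := l) (fun b => own (hS.T4 f l b)) du
  have e5 := BigOh.dotProduct jψ fun l => BigOh.mulVec (a := l) (fun b => own (hS.B_entry f l b))
    fun b => own (hS.dnError_bigOh hu f b)
  have e6 := BigOh.dotProduct
    (x := fun j : IntFacet mesh f => flip (dnError op Ω lam (mesh j.n) ψ j.g j.f'))
    (fun l => BigOh.nbr hS.elem (fun f' => hS.dnError_bigOh hψ f' l.rev) f)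
    fun l => BigOh.mulVec (a := l) (fun b => own (hS.B_entry f l b)) ju
  exact (((e5.mono (by omega)).sub (e6.mono (by omega))).sub ((((e1.mono (by omega)).add
    (e2.mono (by omega))).add (e3.mono (by omega))).add (e4.mono (by omega))))

/-- This is the discrete Green identity for `ψ` and `u` with its boundary data. The energy defect is
superconvergent after the equation replaces the divergence of the flux by `-F`, and every other
defect is quadratic in small facet quantities. -/
theorem consistency (hS : Setting op lam mesh h T) (hψ : SmoothOn Ω lam mesh h ψ)
    (hu : SmoothOn Ω lam mesh h u)
    (hF : ∀ i, ∀ ξ ∈ refTriangle, diffusion Ω lam u ((elemMap mesh i).toFun ξ)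
      = F ((elemMap mesh i).toFun ξ)) :
    SumOh h (2 * p + 2) fun n =>
      ∑ k, ∑ j, (mesh n).restrict op ψ k j *
        (((mesh n).map k).H op j * (mesh n).restrict op F k j)
      + dataForm op Ω lam (mesh n) (T n) u ((mesh n).restrict op ψ)
      + dataForm op Ω lam (mesh n) (T n) ψ ((mesh n).restrict op u)
      - discreteForm op lam (mesh n) (T n) ((mesh n).restrict op ψ) ((mesh n).restrict op u)
      - ((mesh n).dirSum fun k f => (mesh n).facetRestrict op ψ k f ⬝ᵥ
          ((T n).TD k f *ᵥ (mesh n).facetRestrict op u k f))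
      + ((mesh n).dirSum fun k f => (mesh n).facetRestrict op ψ k f ⬝ᵥ
          (((mesh n).map k).B op f *ᵥ (mesh n).fluxRestrict op Ω lam u k f))
      - ((mesh n).neuSum fun k f => (mesh n).fluxRestrict op Ω lam ψ k f ⬝ᵥ
          (((mesh n).map k).B op f *ᵥ (mesh n).facetRestrict op u k f)) := by
  have hB : ∀ {e : ℕ} {x : Elem mesh → Fin nf → ℝ} (f : Fin 3),
      (∀ l, BigOh h e fun i => x i l) → ∀ l,
      BigOh h (e + 1) fun i => (((mesh i.1).map i.2).B op f *ᵥ x i) l := fun f hx l =>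
    hS.elem.bigOh_B_mulVec hS.sbp f hx l
  have e1 : SumOh h (2 * p + 2) _ :=
    SumOh.of_bigOh (hS.elem.energy_approx hS.sbp hS.tensor hu hψ hS.deg_pos)
  have e2 : SumOh h (2 * p + 2) fun n => ∑ k, ∑ f, wideForm op (mesh n) (T n)
      ((mesh n).restrict op ψ) ((mesh n).restrict op u) k f :=
    SumOh.of_bigOh (Z := fun i => ∑ f, wideForm op (mesh i.1) (T i.1)
      ((mesh i.1).restrict op ψ) ((mesh i.1).restrict op u) i.2 f) (BigOh.sum fun f _ =>
      BigOh.sum fun e _ => (BigOh.dotProduct (hS.jump hψ f) fun l =>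
        BigOh.mulVec (a := l) (fun b => hS.T5 f e l b) (hS.jump hu e)).mono (by omega))
  have e3 : SumOh h (2 * p + 2) fun n => (mesh n).dirSum fun k f =>
      dnError op Ω lam (mesh n) ψ k f ⬝ᵥ (((mesh n).map k).B op f *ᵥ trError op (mesh n) u k f)
        + trError op (mesh n) ψ k f ⬝ᵥ
          (((mesh n).map k).B op f *ᵥ dnError op Ω lam (mesh n) u k f)
        - trError op (mesh n) ψ k f ⬝ᵥ ((T n).TD k f *ᵥ trError op (mesh n) u k f) := by
    refine SumOh.dirSum fun f => ?_
    refine (BigOh.add ?_ ?_).sub ?_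
    · exact (BigOh.dotProduct (hS.dnError_bigOh hψ f)
        (hB f (hS.trError_bigOh hu f))).mono (by omega)
    · exact (BigOh.dotProduct (hS.trError_bigOh hψ f)
        (hB f (hS.dnError_bigOh hu f))).mono (by omega)
    · exact (BigOh.dotProduct (hS.trError_bigOh hψ f) fun l =>
        BigOh.mulVec (a := l) (fun b => hS.TD f l b) (hS.trError_bigOh hu f)).mono (by omega)
  have e4 := SumOh.intSum (Z := fun n => interiorError op Ω lam (mesh n) (T n) ψ u)
    (hS.interiorError_bigOh hψ hu)
  refine (((e3.sub e2).sub e1).add (e4.const_mul (1 / 2))).congr fun n => ?_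
  have key := consistency_identity Ω ψ u hS.sbp (hS.adj n) (hS.symm n) (lam := lam)
  have hF' : ∀ k j, ∑ a, pd Ω (flux Ω lam u a) a (((mesh n).map k).toFun (op.node j))
      = -(mesh n).restrict op F k j := by
    intro k j
    have h1 := hF ⟨n, k⟩ _ (hS.sbp.node_mem j)
    rw [diffusion] at h1
    rw [← neg_neg (∑ a, _)]
    exact congrArg Neg.neg h1
  have hE : ∑ k : Fin (mesh n).ne, ((elemMap mesh ⟨n, k⟩).energy op lam
        (op.nodal fun ξ => ψ ((elemMap mesh ⟨n, k⟩).toFun ξ))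
        (op.nodal fun ξ => u ((elemMap mesh ⟨n, k⟩).toFun ξ))
      + ∑ j, (elemMap mesh ⟨n, k⟩).H op j * (ψ ((elemMap mesh ⟨n, k⟩).toFun (op.node j)) *
          ∑ a, pd Ω (flux Ω lam u a) a ((elemMap mesh ⟨n, k⟩).toFun (op.node j)))
      - ∑ f, facetTerm op Ω lam (mesh n) ψ u k f)
      = ∑ k, (((mesh n).map k).energy op lam ((mesh n).restrict op ψ k)
          ((mesh n).restrict op u k) - ∑ f, facetTerm op Ω lam (mesh n) ψ u k f)
        - ∑ k, ∑ j, (mesh n).restrict op ψ k j *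
        (((mesh n).map k).H op j * (mesh n).restrict op F k j) := by
    rw [← Finset.sum_sub_distrib]
    refine Finset.sum_congr rfl fun k _ => ?_
    have h2 : ∑ j, (elemMap mesh ⟨n, k⟩).H op j * (ψ ((elemMap mesh ⟨n, k⟩).toFun (op.node j)) *
          ∑ a, pd Ω (flux Ω lam u a) a ((elemMap mesh ⟨n, k⟩).toFun (op.node j)))
        = -∑ j, (mesh n).restrict op ψ k j *
        (((mesh n).map k).H op j * (mesh n).restrict op F k j) := by
      rw [← Finset.sum_neg_distrib]
      refine Finset.sum_congr rfl fun j _ => ?_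
      have h3 := hF' k j
      change ∑ a, pd Ω (flux Ω lam u a) a ((elemMap mesh ⟨n, k⟩).toFun (op.node j)) = _ at h3
      rw [h3]
      simp only [elemMap, Mesh.restrict, PolyMap.pnode]
      ring
    rw [h2]
    simp only [elemMap]
    have h4 : op.nodal (fun ξ => ψ (((mesh n).map k).toFun ξ)) = (mesh n).restrict op ψ k := rfl
    have h5 : op.nodal (fun ξ => u (((mesh n).map k).toFun ξ)) = (mesh n).restrict op u k := rfl
    rw [h4, h5]
    ring
  have hP : ∀ k f, facetTerm op Ω lam (mesh n) ψ u k f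
      = op.facetNodal f (fun ξ => ψ ((elemMap mesh ⟨n, k⟩).toFun ξ)) ⬝ᵥ
          ((elemMap mesh ⟨n, k⟩).B op f *ᵥ (elemMap mesh ⟨n, k⟩).normalComp op f
            fun a ξ => flux Ω lam u a ((elemMap mesh ⟨n, k⟩).toFun ξ))
        + ((elemMap mesh ⟨n, k⟩).normalComp op f
            fun a ξ => flux Ω lam ψ a ((elemMap mesh ⟨n, k⟩).toFun ξ)) ⬝ᵥ
          ((elemMap mesh ⟨n, k⟩).B op f *ᵥ (op.R f *ᵥ
            op.nodal (fun ξ => u ((elemMap mesh ⟨n, k⟩).toFun ξ))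
            - op.facetNodal f fun ξ => u ((elemMap mesh ⟨n, k⟩).toFun ξ)))
        + ((elemMap mesh ⟨n, k⟩).normalComp op f
            fun a ξ => flux Ω lam u a ((elemMap mesh ⟨n, k⟩).toFun ξ)) ⬝ᵥ
          ((elemMap mesh ⟨n, k⟩).B op f *ᵥ (op.R f *ᵥ
            op.nodal (fun ξ => ψ ((elemMap mesh ⟨n, k⟩).toFun ξ))
            - op.facetNodal f fun ξ => ψ ((elemMap mesh ⟨n, k⟩).toFun ξ))) := by
    intro k f
    rw [facetTerm, fluxRestrict_eq_normalComp, fluxRestrict_eq_normalComp]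
    rfl
  simp only [hP] at hE key
  rw [hE]
  linarith

end Setting

end Families

/-! ### The discrete functional -/

section Functional

variable {p np nf : ℕ} {op : RefOperator np nf} {Ω : Set Pt}
  {lam : Pt → Matrix (Fin 2) (Fin 2) ℝ} {m : Mesh p} {T : SATCoeffs m.ne nf} {F G ψ U : Pt → ℝ}

/-- The boundary terms of the modified functional are those of the adjoint data form, so up to a
constant `I_h` is the right-hand side of the adjoint problem applied to `v`. -/
theorem discreteFunctional_eq (hs : T.IsSymmetric) (v : m.GridFun np) :
    discreteFunctional op Ω lam m T G ψ U v
      = ∑ k, ∑ j, v k j * ((m.map k).H op j * m.restrict op G k j) + dataForm op Ω lam m T ψ v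
        - m.dirSum fun k f => m.facetRestrict op ψ k f ⬝ᵥ (T.TD k f *ᵥ m.facetRestrict op U k f) := by
  rw [discreteFunctional, Finset.sum_add_distrib, add_sub_assoc]
  congr 1
  · exact Finset.sum_congr rfl fun k _ => Finset.sum_congr rfl fun j _ => by ring
  · rw [dataForm, sub_eq_add_neg, ← Mesh.dirSum_neg, add_right_comm, ← Mesh.dirSum_add]
    simp only [Mesh.dirSum, Mesh.neuSum, ← Finset.sum_add_distrib]
    refine Finset.sum_congr rfl fun k _ => Finset.sum_congr rfl fun f _ => ?_
    have hB := ((m.map k).B_isSymm op f).dotProduct_mulVec_comm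
    rcases m.kind k f with ⟨g, f'⟩ | _ | _
    · simp
    · simp only [Matrix.mulVec_sub, dotProduct_sub]
      rw [hB (dn op lam m v k f), (hs.TD_symm k f).dotProduct_mulVec_comm (tr op m v k f)]
      ring
    · simp only
      rw [hB (tr op m v k f)]
      ring

/-- The functional error in terms of the truncation error and of the error of the discrete adjoint
solution. -/
theorem discreteFunctional_identity (hop : op.IsSBP p) (hT : T.IsAdjointConsistent op m)
    (hs : T.IsSymmetric)
    (hlam : ∀ k j a b, lam ((m.map k).pnode op j) a b = lam ((m.map k).pnode op j) b a)
    {uh ψh : m.GridFun np} (huh : primalOp op Ω lam m T U uh = m.restrict op F)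
    (hψh : adjointOp op Ω lam m T ψ ψh = m.restrict op G) :
    discreteFunctional op Ω lam m T G ψ U uh
      = ∑ k, ∑ j, m.restrict op U k j * ((m.map k).H op j * m.restrict op G k j)
        + (∑ k, ∑ j, m.restrict op ψ k j * ((m.map k).H op j * m.restrict op F k j)
          + dataForm op Ω lam m T U (m.restrict op ψ) + dataForm op Ω lam m T ψ (m.restrict op U)
          - discreteForm op lam m T (m.restrict op ψ) (m.restrict op U)
          - m.dirSum fun k f => m.facetRestrict op ψ k f ⬝ᵥ
              (T.TD k f *ᵥ m.facetRestrict op U k f))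
        - ∑ k, ∑ j, (ψh k j - m.restrict op ψ k j) * ((m.map k).H op j *
            (primalOp op Ω lam m T U (m.restrict op U) k j - m.restrict op F k j)) := by
  -- `t1` and `t2` express `a(ψh, uh)` in two ways and so move the functional from `uh` to `ψh`.
  -- `t3` introduces the exact `U` in the adjoint equation; the difference of `t4` and `t5` is the
  -- residual of `U` weighted by `ψh - ψ`.
  have t1 := primalOp_test Ω hop hT U ψh uh (lam := lam)
  have t2 := adjointOp_test Ω hop hT hs hlam ψ ψh uh
  have t3 := adjointOp_test Ω hop hT hs hlam ψ ψh (m.restrict op U)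
  have t4 := primalOp_test Ω hop hT U ψh (m.restrict op U) (lam := lam)
  have t5 := primalOp_test Ω hop hT U (m.restrict op ψ) (m.restrict op U) (lam := lam)
  rw [huh] at t1
  rw [hψh] at t2 t3
  rw [discreteFunctional_eq hs]
  simp only [sub_mul, mul_sub, Finset.sum_sub_distrib]
  linarith

theorem Mesh.dirSum_eq [DecidableEq (FacetKind m.ne)] (X : Fin m.ne → Fin 3 → ℝ) :
    ∑ k, ∑ f, (if m.kind k f = .dirichlet then X k f else 0) = m.dirSum X := by
  refine Finset.sum_congr rfl fun k _ => Finset.sum_congr rfl fun f _ => ?_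
  rcases m.kind k f with ⟨g, f'⟩ | _ | _ <;> simp

theorem Mesh.neuSum_eq [DecidableEq (FacetKind m.ne)] (X : Fin m.ne → Fin 3 → ℝ) :
    ∑ k, ∑ f, (if m.kind k f = .neumann then X k f else 0) = m.neuSum X := by
  refine Finset.sum_congr rfl fun k _ => Finset.sum_congr rfl fun f _ => ?_
  rcases m.kind k f with ⟨g, f'⟩ | _ | _ <;> simp

theorem Mesh.continuousOn_normal (k : Fin m.ne) (f : Fin 3) (a : Fin 2) :
    ContinuousOn (fun s => (m.map k).normal f a (facetParam f s)) (Set.Icc (-1) 1) := by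
  have ht : ∀ a, Continuous fun s => (m.map k).tangent f a (facetParam f s) := fun a =>
    ((m.map k).continuous_tangent f a).comp (PolyMap.continuous_facetParam f)
  have hJ : Continuous fun s => (m.map k).facetJac f (facetParam f s) :=
    Real.continuous_sqrt.comp (continuous_finsetSum _ fun a _ => (ht a).pow 2)
  have hJ0 : ∀ s ∈ Set.Icc (-1 : ℝ) 1, (m.map k).facetJac f (facetParam f s) ≠ 0 := fun s hs =>
    ((m.map k).facetJac_pos (m.jac_pos k _ (facetParam_mem_refTriangle f hs))).ne'
  fin_cases a
  · simp only [Fin.zero_eta, PolyMap.normal_zero]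
    exact (ht 1).continuousOn.div hJ.continuousOn hJ0
  · simp only [Fin.mk_one, PolyMap.normal_one]
    exact (ht 0).neg.continuousOn.div hJ.continuousOn hJ0

/-- The facet integral of the conormal derivative of `v` times `φ`. -/
noncomputable def facetIntegral (Ω : Set Pt) (lam : Pt → Matrix (Fin 2) (Fin 2) ℝ) (m : Mesh p)
    (v φ : Pt → ℝ) (k : Fin m.ne) (f : Fin 3) : ℝ :=
  ∫ s in (-1 : ℝ)..1, refHalfLength f * (m.map k).facetJac f (facetParam f s) *
    ((∑ a, flux Ω lam v a ((m.map k).toFun (facetParam f s)) *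
      (m.map k).normal f a (facetParam f s)) * φ ((m.map k).toFun (facetParam f s)))

/-- Boundary integrals of a conormal derivative times a function. -/
theorem Mesh.IsTessellation.integral_flux_mul {ΓD ΓN : Set Pt} (ht : m.IsTessellation Ω ΓD ΓN)
    {ν : Pt → Pt} {κ : FacetKind m.ne} (hκ : ∀ v g, κ ≠ .interior v g) {Γ : Set Pt}
    (hΓ : ⋃ k, ⋃ f, ⋃ _ : m.kind k f = κ, m.facetSet k f = Γ)
    (hν : ∀ᵐ x ∂(μH[1] : Measure Pt).restrict Γ, IsOutwardUnitNormal Ω x (ν x)) {v φ g : Pt → ℝ}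
    (hv : ∀ a, ContinuousOn (flux Ω lam v a) Ω) (hφ : ContinuousOn φ Ω)
    (hg : ∀ᵐ x ∂(μH[1] : Measure Pt).restrict Γ, g x = normalFlux Ω lam v (ν x) x * φ x)
    [DecidableEq (FacetKind m.ne)] :
    ∫ x in Γ, g x ∂μH[1]
      = ∑ k, ∑ f, if m.kind k f = κ then facetIntegral Ω lam m v φ k f else 0 := by
  have hmaps : ∀ k f, Set.MapsTo (fun s => (m.map k).toFun (facetParam f s))
      (Set.Icc (-1) 1) Ω := fun k f s hs => ht.mapsTo k (facetParam_mem_refTriangle f hs)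
  have hcurve : ∀ k f, ContinuousOn (fun s => (m.map k).toFun (facetParam f s))
      (Set.Icc (-1) 1) := fun k f => ((m.map k).continuous_facetCurve f).continuousOn
  have hF : ∀ k f, ContinuousOn (fun s => (∑ a, flux Ω lam v a ((m.map k).toFun (facetParam f s)) *
      (m.map k).normal f a (facetParam f s)) * φ ((m.map k).toFun (facetParam f s)))
      (Set.Icc (-1) 1) := fun k f =>
    (continuousOn_finsetSum _ fun a _ => ((hv a).comp (hcurve k f) (hmaps k f)).mul
      (m.continuousOn_normal k f a)).mul (hφ.comp (hcurve k f) (hmaps k f))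
  have hsub : ∀ k f, m.kind k f = κ → m.facetSet k f ⊆ Γ := by
    intro k f hk x hx
    rw [← hΓ]
    exact Set.mem_iUnion.2 ⟨k, Set.mem_iUnion.2 ⟨f, Set.mem_iUnion.2 ⟨hk, hx⟩⟩⟩
  have h1 := m.integral_boundary hκ hΓ hF (g := g) fun k f hk => by
    have h2 := ae_restrict_of_ae_restrict_of_subset (hsub k f hk) hν
    have h3 := ae_restrict_of_ae_restrict_of_subset (hsub k f hk) hg
    filter_upwards [m.ae_facetSet_normal (ht.image_subset k) h2, h3] with x hx1 hx2 s hs hsx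
    rw [hx2, hx1 s hs hsx, normalFlux, ← hsx]
    rfl
  rw [h1]
  refine Finset.sum_congr rfl fun k _ => Finset.sum_congr rfl fun f _ => ?_
  simp only [facetIntegral]
  congr

end Functional

/-! ### Sizes of elements -/

section Sizes

variable {p np nf : ℕ} {op : RefOperator np nf}

theorem PolyMap.diam_nonneg (M : PolyMap) : 0 ≤ M.diam op :=
  Real.iSup_nonneg fun _ => Real.iSup_nonneg fun _ => dist_nonneg

theorem Mesh.diam_le_h (m : Mesh p) (k : Fin m.ne) : (m.map k).diam op ≤ m.h op :=
  le_ciSup (f := fun k => (m.map k).diam op) (Set.finite_range _).bddAbove k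

theorem Mesh.h_nonneg (m : Mesh p) : 0 ≤ m.h op :=
  Real.iSup_nonneg fun _ => PolyMap.diam_nonneg _

/-- A vanishing diameter would force the first derivatives of the mapping, and with them its
Jacobian, to vanish. -/
theorem Mesh.ShapeRegular.diam_pos {mesh : ℕ → Mesh p} (hreg : Mesh.ShapeRegular op mesh) (n : ℕ)
    (k : Fin (mesh n).ne) : 0 < ((mesh n).map k).diam op := by
  refine lt_of_le_of_ne (PolyMap.diam_nonneg _) fun h0 => ?_
  obtain ⟨c, C, -, hC⟩ := hreg
  have h1 := (hC n k _ refCenter_mem).2 1 le_rfl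
  rw [← h0, pow_one, mul_zero, norm_iteratedFDeriv_one] at h1
  have h2 : fderiv ℝ ((mesh n).map k).toFun refCenter = 0 := norm_le_zero_iff.1 h1
  have h3 := ((mesh n).map k).det_fderiv_toFun refCenter
  have h4 := (mesh n).jac_pos k _ refCenter_mem
  have h5 : ∀ a b, ((mesh n).map k).metric a b refCenter = 0 := by
    intro a b
    have := ((mesh n).map k).fderiv_toFun_apply refCenter (EuclideanSpace.single b 1) a
    rw [h2] at this
    fin_cases b <;> simpa [Fin.sum_univ_two] using this.symm
  rw [PolyMap.jac, h5, h5, h5, h5] at h4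
  simp at h4

/-- Sums of element contributions of order `2 p + 2`. -/
theorem SumOh.exists_bound {κ : Type*} {mesh : κ → Mesh p} {h : Elem mesh → Set.Ioc (0 : ℝ) 1}
    {H : κ → ℝ} (hH0 : ∀ n, 0 ≤ H n) (hH : ∀ i, (h i : ℝ) ≤ H i.1) {A : ℝ}
    (hA : ∀ n, ∑ k, (h ⟨n, k⟩ : ℝ) ^ 2 ≤ A) {e : ℕ} {X : κ → ℝ} (hX : SumOh h (e + 2) X) :
    ∃ C : ℝ, ∀ n, |X n| ≤ C * H n ^ e := by
  obtain ⟨Z, hZ, hXZ⟩ := hX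
  obtain ⟨K, hK0, hK⟩ := hZ.exists_nonneg
  refine ⟨K * A, fun n => ?_⟩
  rw [hXZ]
  refine (Finset.abs_sum_le_sum_abs _ _).trans ?_
  have h1 : ∀ k, |Z ⟨n, k⟩| ≤ K * H n ^ e * (h ⟨n, k⟩ : ℝ) ^ 2 := by
    intro k
    refine (hK ⟨n, k⟩).trans ?_
    have hp := (h ⟨n, k⟩).2.1
    have := hH ⟨n, k⟩
    rw [pow_add, ← mul_assoc]
    gcongr
  refine (Finset.sum_le_sum fun k _ => h1 k).trans ?_
  rw [← Finset.mul_sum]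
  have h0 := hH0 n
  have h2 := hA n
  calc K * H n ^ e * ∑ k, (h ⟨n, k⟩ : ℝ) ^ 2 ≤ K * H n ^ e * A := by gcongr
    _ = K * A * H n ^ e := by ring

end Sizes

/-! ### The error of the functional -/

section FunctionalError

variable {κ : Type*} {p np nf : ℕ} {op : RefOperator np nf} {Ω ΓD ΓN : Set Pt}
  {lam : Pt → Matrix (Fin 2) (Fin 2) ℝ} {mesh : κ → Mesh p}
  {h : Elem mesh → Set.Ioc (0 : ℝ) 1} {T : ∀ n, SATCoeffs (mesh n).ne nf}
  {U ψ F G ψD ψN : Pt → ℝ} {ν : Pt → Pt}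

namespace Setting

/-- Quadrature of the functional on a family of meshes. -/
theorem functional_quadrature (hS : Setting op lam mesh h T) (hψ : SmoothOn Ω lam mesh h ψ)
    (hU : SmoothOn Ω lam mesh h U) (ht : ∀ n, (mesh n).IsTessellation Ω ΓD ΓN)
    (hG : Scaled h (2 * p) 0 fun i ξ => G ((elemMap mesh i).toFun ξ))
    (hGc : ContinuousOn G Ω) (hUc : ContinuousOn U Ω) (hψc : ContinuousOn ψ Ω)
    (hfU : ∀ a, ContinuousOn (flux Ω lam U a) Ω) (hfψ : ∀ a, ContinuousOn (flux Ω lam ψ a) Ω)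
    (hνD : ∀ᵐ x ∂(μH[1] : Measure Pt).restrict ΓD, IsOutwardUnitNormal Ω x (ν x))
    (hνN : ∀ᵐ x ∂(μH[1] : Measure Pt).restrict ΓN, IsOutwardUnitNormal Ω x (ν x))
    (hψD : ∀ᵐ x ∂(μH[1] : Measure Pt).restrict ΓD, ψ x = ψD x)
    (hψN : ∀ᵐ x ∂(μH[1] : Measure Pt).restrict ΓN, normalFlux Ω lam ψ (ν x) x = ψN x) :
    SumOh h (2 * p + 2) fun n =>
      (∑ k, ∑ j, (mesh n).restrict op U k j *
          (((mesh n).map k).H op j * (mesh n).restrict op G k j)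
        - ((mesh n).dirSum fun k f => (mesh n).facetRestrict op ψ k f ⬝ᵥ
            (((mesh n).map k).B op f *ᵥ (mesh n).fluxRestrict op Ω lam U k f))
        + ((mesh n).neuSum fun k f => (mesh n).fluxRestrict op Ω lam ψ k f ⬝ᵥ
            (((mesh n).map k).B op f *ᵥ (mesh n).facetRestrict op U k f)))
      - functional Ω ΓD ΓN ν lam G ψD ψN U := by
  classical
  have hv := SumOh.of_bigOh (hS.elem.volume_quadrature hS.sbp hS.deg_pos
    (hG.mul (hU.scaled.of_le (show 2 * p ≤ 2 * p + 1 by omega))))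
  have hD := SumOh.dirSum (h := h) (e := 2 * p + 2) (Z := fun n k f =>
    (mesh n).facetRestrict op ψ k f ⬝ᵥ
      (((mesh n).map k).B op f *ᵥ (mesh n).fluxRestrict op Ω lam U k f)
      - facetIntegral Ω lam (mesh n) U ψ k f) fun f =>
    (hS.elem.facet_quadrature hS.sbp hU.scaled_flux hψ.scaled f).congr fun i => by
      rw [(((mesh i.1).map i.2).B_isSymm op f).dotProduct_mulVec_comm, fluxRestrict_eq_normalComp]
      rfl
  have hN := SumOh.neuSum (h := h) (e := 2 * p + 2) (Z := fun n k f =>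
    (mesh n).fluxRestrict op Ω lam ψ k f ⬝ᵥ
      (((mesh n).map k).B op f *ᵥ (mesh n).facetRestrict op U k f)
      - facetIntegral Ω lam (mesh n) ψ U k f) fun f =>
    (hS.elem.facet_quadrature hS.sbp hψ.scaled_flux hU.scaled f).congr fun i => by
      rw [fluxRestrict_eq_normalComp]
      rfl
  refine ((hv.sub hD).add hN).congr fun n => ?_
  have e1 := (ht n).integral_eq_sum (g := fun x => G x * U x) (hGc.mul hUc)
  have e2 := (ht n).integral_flux_mul (by simp) (ht n).dirichlet_eq hνD hfU hψc
    (g := fun x => ψD x * normalFlux Ω lam U (ν x) x)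
    (by filter_upwards [hψD] with x hx; rw [← hx, mul_comm])
  have e3 := (ht n).integral_flux_mul (by simp) (ht n).neumann_eq hνN hfψ hUc
    (g := fun x => ψN x * U x) (by filter_upwards [hψN] with x hx; rw [hx])
  rw [Mesh.dirSum_eq] at e2
  rw [Mesh.neuSum_eq] at e3
  rw [functional, e1, e2, e3]
  have e4 : ∑ k, ∑ j, (mesh n).restrict op U k j *
      (((mesh n).map k).H op j * (mesh n).restrict op G k j)
      = ∑ k, ∑ j, (elemMap mesh ⟨n, k⟩).H op j * (G ((elemMap mesh ⟨n, k⟩).toFun (op.node j)) *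
        U ((elemMap mesh ⟨n, k⟩).toFun (op.node j))) :=
    Finset.sum_congr rfl fun k _ => Finset.sum_congr rfl fun j _ => by
      simp only [elemMap, Mesh.restrict, PolyMap.pnode]
      ring
  rw [e4, Finset.sum_sub_distrib]
  simp only [sub_eq_add_neg, Mesh.dirSum_add, Mesh.dirSum_neg, Mesh.neuSum_add, Mesh.neuSum_neg]
  simp only [elemMap]
  ring

/-- The adjoint-weighted residual is of order `2 p`. -/
theorem exists_residual_bound (hS : Setting op lam mesh h T) (hU : SmoothOn Ω lam mesh h U)
    (hF : ∀ i, ∀ ξ ∈ refTriangle, diffusion Ω lam U ((elemMap mesh i).toFun ξ)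
      = F ((elemMap mesh i).toFun ξ)) {ψh : ∀ n, (mesh n).GridFun np} {C : ℝ}
    {H : κ → ℝ} (hH0 : ∀ n, 0 ≤ H n) (hH : ∀ i, (h i : ℝ) ≤ H i.1) {A : ℝ}
    (hA : ∀ n, ∑ k, (h ⟨n, k⟩ : ℝ) ^ 2 ≤ A)
    (hconv : ∀ n k j, |ψh n k j - (mesh n).restrict op ψ k j| ≤ C * H n ^ (p + 1)) :
    ∃ C' : ℝ, ∀ n, |∑ k, ∑ j, (ψh n k j - (mesh n).restrict op ψ k j) *
      (((mesh n).map k).H op j *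
        (primalOp op Ω lam (mesh n) (T n) U ((mesh n).restrict op U) k j
          - (mesh n).restrict op F k j))| ≤ C' * H n ^ (2 * p) := by
  have hp := hS.deg_pos
  -- The weighted residual has order `p + 1 = (p - 1) + 2` per element. Summation spends two powers,
  -- and the adjoint error restores `p + 1`, for a total of `2 * p`.
  have h1 : BigOh h (p - 1 + 2) fun i => ∑ j, |((mesh i.1).map i.2).H op j *
        (primalOp op Ω lam (mesh i.1) (T i.1) U ((mesh i.1).restrict op U) i.2 j
          - (mesh i.1).restrict op F i.2 j)| :=
    BigOh.sum fun j _ => ((hS.residual_bigOh hU hF j).mono (show p - 1 + 2 ≤ p + 1 by omega)).imp fun K hK i => by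
      rw [abs_abs]
      exact hK i
  obtain ⟨K, hK⟩ := (SumOh.of_bigOh h1).exists_bound hH0 hH hA
  refine ⟨|C| * K, fun n => ?_⟩
  have h2 : H n ^ (2 * p) = H n ^ (p + 1) * H n ^ (p - 1) := by
    rw [← pow_add]
    congr 1
    omega
  have h3 := pow_nonneg (hH0 n) (p + 1)
  calc _ ≤ ∑ k, ∑ j, |(ψh n k j - (mesh n).restrict op ψ k j) *
      (((mesh n).map k).H op j *
        (primalOp op Ω lam (mesh n) (T n) U ((mesh n).restrict op U) k j
          - (mesh n).restrict op F k j))| := (Finset.abs_sum_le_sum_abs _ _).trans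
        (Finset.sum_le_sum fun k _ => Finset.abs_sum_le_sum_abs _ _)
    _ ≤ ∑ k, ∑ j, (|C| * H n ^ (p + 1)) * |(((mesh n).map k).H op j *
        (primalOp op Ω lam (mesh n) (T n) U ((mesh n).restrict op U) k j
          - (mesh n).restrict op F k j))| := by
        refine Finset.sum_le_sum fun k _ => Finset.sum_le_sum fun j _ => ?_
        rw [abs_mul]
        refine mul_le_mul_of_nonneg_right ((hconv n k j).trans ?_) (abs_nonneg _)
        exact mul_le_mul_of_nonneg_right (le_abs_self C) h3
    _ = (|C| * H n ^ (p + 1)) * ∑ k, ∑ j, |(((mesh n).map k).H op j *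
        (primalOp op Ω lam (mesh n) (T n) U ((mesh n).restrict op U) k j
          - (mesh n).restrict op F k j))| := by simp only [Finset.mul_sum]
    _ ≤ (|C| * H n ^ (p + 1)) * (K * H n ^ (p - 1)) :=
        mul_le_mul_of_nonneg_left ((le_abs_self _).trans (hK n))
          (mul_nonneg (abs_nonneg C) h3)
    _ = |C| * K * H n ^ (2 * p) := by rw [h2]; ring

end Setting

end FunctionalError

end SBPSAT

/-! ### The functional error estimate -/

theorem mainTheorem1 (p np nf : ℕ) (hp : 1 ≤ p)
    -- a diagonal-norm SBP operator of degree `p` on the reference triangle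
    (op : RefOperator np nf) (hop : op.IsSBP p)
    -- the domain, the two parts of its boundary, and its outward unit normal
    (Ω ΓD ΓN : Set Pt) (hΓ : frontier Ω = ΓD ∪ ΓN)
    (ν : Pt → Pt) (hν : ∀ᵐ x ∂(μH[1] : Measure Pt).restrict (frontier Ω),
      IsOutwardUnitNormal Ω x (ν x))
    -- the diffusivity tensor
    (lam : Pt → Matrix (Fin 2) (Fin 2) ℝ) (hlam : ∀ x ∈ Ω, (lam x).PosDef)
    (hlamC : ∀ a b, ContDiffOn ℝ (2 * p + 1 : ℕ) (fun x => lam x a b) Ω)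
    -- the exact primal and adjoint solutions
    (U ψ F G ψD ψN : Pt → ℝ)
    (hUC : ContDiffOn ℝ (2 * p + 2 : ℕ) U Ω) (hψC : ContDiffOn ℝ (2 * p + 2 : ℕ) ψ Ω)
    (hU : ∀ x ∈ Ω, diffusion Ω lam U x = F x)
    (hψ : ∀ x ∈ Ω, diffusion Ω lam ψ x = G x)
    (hψD : ∀ x ∈ ΓD, ψ x = ψD x)
    (hψN : ∀ᵐ x ∂(μH[1] : Measure Pt).restrict ΓN, normalFlux Ω lam ψ (ν x) x = ψN x)
    -- the family of meshes
    (mesh : ℕ → Mesh p) (htess : ∀ n, (mesh n).IsTessellation Ω ΓD ΓN)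
    (hreg : Mesh.ShapeRegular op mesh)
    (hh : Tendsto (fun n => (mesh n).h op) atTop (𝓝 0))
    -- the SAT coefficients
    (T : ∀ n, SATCoeffs (mesh n).ne nf) (hsymm : ∀ n, (T n).IsSymmetric)
    (hadj : ∀ n, (T n).IsAdjointConsistent op (mesh n))
    (hscale : SATCoeffs.IsScaled op mesh T)
    -- the discrete primal and adjoint solutions
    (uh ψh : ∀ n, (mesh n).GridFun np)
    (huh : ∀ n, IsUniquePrimalSolution op Ω lam (mesh n) (T n) F U (uh n))
    (hψh : ∀ n, IsUniqueAdjointSolution op Ω lam (mesh n) (T n) G ψ (ψh n))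
    (huconv : ∃ C : ℝ, ∀ᶠ n in atTop, ∀ k i,
      |uh n k i - (mesh n).restrict op U k i| ≤ C * (mesh n).h op ^ (p + 1))
    (hψconv : ∃ C : ℝ, ∀ᶠ n in atTop, ∀ k i,
      |ψh n k i - (mesh n).restrict op ψ k i| ≤ C * (mesh n).h op ^ (p + 1)) :
    (fun n => functional Ω ΓD ΓN ν lam G ψD ψN U
        - discreteFunctional op Ω lam (mesh n) (T n) G ψ U (uh n))
      =O[atTop] fun n => (mesh n).h op ^ (2 * p) := by
  obtain ⟨Cψ, hCψ⟩ := hψconv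
  -- Beyond `n₀` the adjoint error bound holds and the mesh size is at most 1. Restricting the
  -- family to these meshes puts every diameter in `(0, 1]`.
  obtain ⟨n₀, hn₀⟩ := eventually_atTop.1 (hCψ.and (hh.eventually (Iic_mem_nhds one_pos)))
  obtain ⟨c, C, hc, hcC⟩ := id hreg
  obtain ⟨K, hK⟩ := hscale
  let mesh' : {n // n₀ ≤ n} → Mesh p := fun n => mesh n.1
  let h : Elem mesh' → Set.Ioc (0 : ℝ) 1 := fun i => ⟨((mesh i.1.1).map i.2).diam op,
    hreg.diam_pos i.1.1 i.2, ((mesh i.1.1).diam_le_h i.2).trans (hn₀ i.1.1 i.1.2).2⟩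
  have hΩ := (htess 0).uniqueDiffOn
  have hΩc := (htess 0).isCompact
  have hmaps : ∀ i, Set.MapsTo (elemMap mesh' i).toFun refTriangle Ω := fun i =>
    (htess i.1.1).mapsTo i.2
  have hD : ∃ C : ℝ, ∀ i, ∀ ξ ∈ refTriangle, ∀ j : ℕ, 1 ≤ j →
      ‖iteratedFDeriv ℝ j (elemMap mesh' i).toFun ξ‖ ≤ C * (h i : ℝ) ^ j :=
    ⟨C, fun i ξ hξ => (hcC i.1.1 i.2 ξ hξ).2⟩
  have hJ : ∃ c : ℝ, 0 < c ∧ ∀ i, ∀ ξ ∈ refTriangle,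
      c * (h i : ℝ) ^ 2 ≤ (elemMap mesh' i).jac ξ :=
    ⟨c, hc, fun i ξ hξ => (hcC i.1.1 i.2 ξ hξ).1⟩
  have hsym : ∀ x ∈ Ω, ∀ a b, lam x a b = lam x b a := fun x hx a b => by
    simpa using ((hlam x hx).isHermitian.apply a b).symm
  have hS : Setting op lam mesh' h fun n => T n.1 :=
    { deg_pos := hp
      sbp := hop
      elem := elemFamily_of_bounds hD hJ
      tensor := ⟨fun a b => Scaled.comp_toFun hΩ hΩc hmaps hD (hlamC a b),
        fun i ξ hξ => hsym _ (hmaps i hξ)⟩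
      symm := fun n => hsymm n.1
      adj := fun n => hadj n.1
      T1 := fun a i j => ⟨K, fun k => by simpa using (hK k.1.1 k.2 a i j).1⟩
      T2 := fun a i j => ⟨K, fun k => by simpa using (hK k.1.1 k.2 a i j).2.1⟩
      T3 := fun a i j => ⟨K, fun k => by simpa using (hK k.1.1 k.2 a i j).2.2.1⟩
      T4 := fun a i j => ⟨K, fun k => (hK k.1.1 k.2 a i j).2.2.2.1⟩
      T5 := fun a b i j => ⟨K, fun k => by simpa using ((hK k.1.1 k.2 a i j).2.2.2.2.1 b).1⟩
      T6 := fun a b i j => ⟨K, fun k => by simpa using ((hK k.1.1 k.2 a i j).2.2.2.2.1 b).2⟩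
      TD := fun a i j => ⟨K, fun k => by simpa using (hK k.1.1 k.2 a i j).2.2.2.2.2⟩ }
  have hSU : SmoothOn Ω lam mesh' h U := smoothFamily_of_contDiffOn hΩ hΩc hmaps hD hlamC hUC
  have hSψ : SmoothOn Ω lam mesh' h ψ := smoothFamily_of_contDiffOn hΩ hΩc hmaps hD hlamC hψC
  -- The regularity of the source is not assumed; it is inherited from `ψ` and the tensor through
  -- the adjoint equation.
  have hGC : ContDiffOn ℝ (2 * p : ℕ) G Ω :=
    (ContDiffOn.neg (ContDiffOn.sum fun a _ => contDiffOn_pd hΩ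
      (contDiffOn_flux hΩ hlamC hψC a) a)).congr fun x hx => (hψ x hx).symm
  have hF : ∀ i, ∀ ξ ∈ refTriangle, diffusion Ω lam U ((elemMap mesh' i).toFun ξ)
      = F ((elemMap mesh' i).toFun ξ) := fun i ξ hξ => hU _ (hmaps i hξ)
  have hH0 : ∀ n : {n // n₀ ≤ n}, 0 ≤ (mesh n.1).h op := fun n => (mesh n.1).h_nonneg
  have hH : ∀ i, (h i : ℝ) ≤ (mesh i.1.1).h op := fun i => (mesh i.1.1).diam_le_h i.2
  have hA : ∀ n, ∑ k, (h ⟨n, k⟩ : ℝ) ^ 2 ≤ volume.real Ω / (c * volume.real refTriangle) :=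
    fun n => by
      rw [le_div_iff₀' (mul_pos hc Mesh.IsTessellation.volume_refTriangle_pos)]
      exact (htess n.1).sum_sq_le fun k ξ hξ => (hcC n.1 k ξ hξ).1
  have hD_ae : ∀ᵐ x ∂(μH[1] : Measure Pt).restrict ΓD, ψ x = ψD x := by
    have hm : MeasurableSet ΓD := by
      rw [← (htess 0).dirichlet_eq]
      exact (isCompact_iUnion fun k => isCompact_iUnion fun f => isCompact_iUnion fun _ =>
        isCompact_Icc.image (((mesh 0).map k).continuous_facetCurve f)).measurableSet
    exact (ae_restrict_iff' hm).2 (Eventually.of_forall hψD)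
  obtain ⟨C₁, hC₁⟩ := (hS.functional_quadrature hSψ hSU (fun n => htess n.1)
    (Scaled.comp_toFun hΩ hΩc hmaps hD hGC) hGC.continuousOn hUC.continuousOn hψC.continuousOn
    (fun a => (contDiffOn_flux hΩ hlamC hUC a).continuousOn)
    (fun a => (contDiffOn_flux hΩ hlamC hψC a).continuousOn)
    (ae_restrict_of_ae_restrict_of_subset (hΓ ▸ Set.subset_union_left) hν)
    (ae_restrict_of_ae_restrict_of_subset (hΓ ▸ Set.subset_union_right) hν)
    hD_ae hψN).exists_bound hH0 hH hA
  obtain ⟨C₂, hC₂⟩ := (hS.consistency hSψ hSU hF).exists_bound hH0 hH hA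
  obtain ⟨C₃, hC₃⟩ := hS.exists_residual_bound hSU hF (ψh := fun n => ψh n.1) hH0 hH hA
    fun n => (hn₀ n.1 n.2).1
  refine IsBigO.of_bound (C₁ + C₂ + C₃) (eventually_atTop.2 ⟨n₀, fun n hn => ?_⟩)
  -- The error is the adjoint-weighted residual minus the quadrature error and minus the consistency
  -- defect; the discrete boundary integrals occur in the last two with opposite signs and cancel.
  have e := discreteFunctional_identity hop (hadj n) (hsymm n)
    (fun k j => hsym _ ((htess n).mapsTo k (hop.node_mem j)))
    ((huh n (uh n)).2 rfl) ((hψh n (ψh n)).2 rfl)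
  have h1 := abs_le.1 (hC₁ ⟨n, hn⟩)
  have h2 := abs_le.1 (hC₂ ⟨n, hn⟩)
  have h3 := abs_le.1 (hC₃ ⟨n, hn⟩)
  rw [e, Real.norm_eq_abs, Real.norm_of_nonneg (pow_nonneg (mesh n).h_nonneg _), abs_le]
  simp only [mesh'] at h1 h2 h3
  constructor <;> linarith [h1.1, h1.2, h2.1, h2.2, h3.1, h3.2]
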